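/- Let $F$ be a field of characteristic zero. For $t\in F$ let $\underline{\mathrm{Re}}\mathrm{p}(S_t)$ be Deligne's category: the Karoubi envelope of the additive envelope of the category whose objects are $[U]$ for finite sets $U$ (write $[n]=[\{1,\dots,n\}]$), whose morphisms $[U]\to[V]$ are the $F$-linear combinations of partition diagrams with top vertices $U$ and bottom vertices $V$, and in which the composite of two diagrams is $t^{\ell}$ times their vertical concatenation, $\ell$ being the number of parts consisting of middle vertices only. It is an $F$-linear symmetric ribbon category with trivial twist: tensor products are given by horizontal concatenation, $[U]^*=[U]$, and the coevaluation and evaluation of $[U]$ are the diagrams pairing each $u\in U$ with its copy. For a Young diagram $\lambda$ with $n$ boxes, $L(\lambda)$ denotes the indecomposable object, well defined up to isomorphism, given by $([n],e)$ with $e$ a primitive idempotent of the partition algebra $FP_n(t)=\mathrm{End}([n])$ whose image under the projection $FP_n(t)\to FS_n$ killing all non-permutation diagrams is a primitive idempotent belonging to the Specht module of $\lambda$. Write $L_n=L((1^n))$, where $(1^n)$ corresponds to the sign representation, and $L(\Box)=L_1$. For an object $J$ let $\mathcal I_J$ be the ideal of all retracts of objects $J\otimes X$. A trace on $\mathcal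 I_J$ is a family of linear maps $\mathsf t_V:\mathrm{End}(V)\to F$, $V\in\mathcal I_J$, such that $\mathsf t_{U\otimes W}(f)=\mathsf t_U(\mathrm{tr}_R(f))$ for all $U\in\mathcal I_J$, all objects $W$ and all $f\in\mathrm{End}(U\otimes W)$, where $\mathrm{tr}_R(f)\in\mathrm{End}(U)$ is the right partial trace, and such that $\mathsf t_V(gf)=\mathsf t_U(fg)$ for all $U,V\in\mathcal I_J$, $f:V\to U$, $g:U\to V$. Its modified dimension function is $\mathsf d_{\mathsf t}(V)=\mathsf t_V(\mathrm{Id}_V)$. Now let $t=0$. The objects $L_n$ exist for all $n\ge 0$, and there is exactly one trace $\mathsf t$ on $\mathcal I_{L(\Box)}$ with $\mathsf t_{L(\Box)}(\mathrm{Id}_{L(\Box)})=1$. For every $n>0$ the object $L_n$ lies in $\mathcal I_{L(\Box)}$, and $$\mathsf d_{\mathsf t}(L_n)=(-1)^{n+1}\,\frac{\#\{n\text{-cycles in }S_n\}}{n!}=\frac{(-1)^{n+1}}{n}.$$ -/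

import Mathlib

open CategoryTheory MonoidalCategory

universe u v w

namespace Deligne

/-- Partition diagrams with top vertices `A` and bottom vertices `B`: partitions of the disjoint
union `A ⊕ B`, given as equivalence relations. -/
abbrev Diagram (A B : Type) : Type := Setoid (A ⊕ B)

namespace Diagram

variable {A B C D A' B' C' D' : Type}

/-- The partition of `A ⊕ B ⊕ C` generated by `p` placed on top of `q`. -/
def stack (p : Diagram A B) (q : Diagram B C) : Setoid (A ⊕ (B ⊕ C)) :=
  Setoid.map p (Sum.map id Sum.inl) ⊔ Setoid.map q Sum.inr

/-- The concatenation of `p` (on top) and `q`: the restriction of the stacked partition to the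
outer vertices `A ⊕ C`. -/
def comp (p : Diagram A B) (q : Diagram B C) : Diagram A C :=
  (stack p q).comap (Sum.map id Sum.inr)

/-- The number of parts of the stacked partition that consist of middle vertices only. -/
noncomputable def loops (p : Diagram A B) (q : Diagram B C) : ℕ :=
  Nat.card {c : Quotient (stack p q) //
    ∀ x : A ⊕ C, Quotient.mk (stack p q) (Sum.map id Sum.inr x) ≠ c}

/-- The diagram of a bijection: the parts are `{a, e a}`. -/
def ofEquiv (e : A ≃ B) : Diagram A B := Setoid.ker (Sum.elim e id)

/-- The horizontal juxtaposition of two diagrams. -/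
def tensor (p : Diagram A B) (q : Diagram C D) : Diagram (A ⊕ C) (B ⊕ D) :=
  Setoid.ker (Sum.map (Quotient.mk p) (Quotient.mk q) ∘ Equiv.sumSumSumComm A C B D)

/-- The diagram without top vertices and with parts `{a, a}`, one element in each copy of `A`. -/
def cup (A : Type) : Diagram Empty (A ⊕ A) :=
  Setoid.ker (Sum.elim Empty.elim (Sum.elim id id))

/-- The diagram without bottom vertices and with parts `{a, a}`, one element in each copy of `A`. -/
def cap (A : Type) : Diagram (A ⊕ A) Empty :=
  Setoid.ker (Sum.elim (Sum.elim id id) Empty.elim)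

open scoped Classical in
/-- The action of a diagram on `Bool`-valued colourings of the vertices. This faithful
representation is only used to verify identities between diagrams. -/
noncomputable def mat (p : Diagram A B) : Matrix (A → Bool) (B → Bool) ℕ :=
  fun f g => if p ≤ Setoid.ker (Sum.elim f g) then 1 else 0

theorem map_le {X Y : Type} (r : Setoid X) (φ : X → Y) (s : Setoid Y) :
    Setoid.map r φ ≤ s ↔ ∀ x y, r x y → s (φ x) (φ y) := by
  constructor
  · intro hle x y hxy
    exact hle (Relation.EqvGen.rel _ _ ⟨x, y, hxy, rfl, rfl⟩)
  · intro hh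
    refine Setoid.eqvGen_le ?_
    rintro _ _ ⟨x, y, hxy, rfl, rfl⟩
    exact hh x y hxy

theorem stack_le (p : Diagram A B) (q : Diagram B C) (f : A → Bool) (g : B → Bool) (h : C → Bool) :
    stack p q ≤ Setoid.ker (Sum.elim f (Sum.elim g h)) ↔
      p ≤ Setoid.ker (Sum.elim f g) ∧ q ≤ Setoid.ker (Sum.elim g h) := by
  unfold stack
  rw [sup_le_iff, map_le, map_le]
  have e1 : Sum.elim f (Sum.elim g h) ∘ Sum.map id Sum.inl = Sum.elim f g := by
    ext (x | x) <;> rfl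
  rw [← e1]
  exact Iff.rfl

theorem card_ext (p : Diagram A B) (q : Diagram B C) (f : A → Bool) (h : C → Bool)
    (hc : comp p q ≤ Setoid.ker (Sum.elim f h)) :
    Nonempty (({c : Quotient (stack p q) //
      ∀ x : A ⊕ C, Quotient.mk (stack p q) (Sum.map id Sum.inr x) ≠ c} → Bool) ≃
      {g : B → Bool // stack p q ≤ Setoid.ker (Sum.elim f (Sum.elim g h))}) := by
  classical
  let S := stack p q
  let i : A ⊕ C → A ⊕ (B ⊕ C) := Sum.map id Sum.inr
  let G : ({c : Quotient S // ∀ x : A ⊕ C, Quotient.mk S (i x) ≠ c} → Bool) →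
      Quotient S → Bool := fun c k =>
    if hk : ∃ x, Quotient.mk S (i x) = k then Sum.elim f h hk.choose
    else c ⟨k, fun x hx => hk ⟨x, hx⟩⟩
  have hG : ∀ c x, G c (Quotient.mk S (i x)) = Sum.elim f h x := by
    intro c x
    have hk : ∃ y, Quotient.mk S (i y) = Quotient.mk S (i x) := ⟨x, rfl⟩
    simp only [G, dif_pos hk]
    have h1 : S (i hk.choose) (i x) := Quotient.exact hk.choose_spec
    exact hc h1
  have hG' : ∀ c z, Sum.elim f (Sum.elim (fun b => G c (Quotient.mk S (Sum.inr (Sum.inl b)))) h) z =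
      G c (Quotient.mk S z) := by
    rintro c (a | b | d)
    · exact (hG c (Sum.inl a)).symm
    · rfl
    · exact (hG c (Sum.inr d)).symm
  refine ⟨⟨fun c => ⟨fun b => G c (Quotient.mk S (Sum.inr (Sum.inl b))), ?_⟩,
    fun g k => Quotient.lift (Sum.elim f (Sum.elim g.1 h)) (fun x y hxy => g.2 hxy) k.1, ?_, ?_⟩⟩
  · intro x y hxy
    change Sum.elim f _ x = Sum.elim f _ y
    rw [hG', hG', Quotient.sound (s := S) hxy]
  · intro c
    funext ⟨k, hk⟩
    induction k using Quotient.inductionOn with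
    | h z =>
      change Sum.elim f (Sum.elim _ h) z = _
      rw [hG']
      exact dif_neg fun ⟨x, hx⟩ => hk x hx
  · rintro ⟨g, hg⟩
    apply Subtype.ext
    funext b
    dsimp only [G]
    split_ifs with hk
    · have h1 : S (i hk.choose) (Sum.inr (Sum.inl b)) := Quotient.exact hk.choose_spec
      have h2 := hg h1
      change Sum.elim f (Sum.elim g h) (i hk.choose) = g b at h2
      rw [← h2]
      rcases hk.choose with x | x <;> rfl
    · rfl

theorem mat_mul [Finite A] [Fintype B] [Finite C] [DecidableEq B]
    (p : Diagram A B) (q : Diagram B C) :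
    mat p * mat q = 2 ^ loops p q • mat (comp p q) := by
  classical
  ext f h
  have h1 : (mat p * mat q) f h =
      Nat.card {g : B → Bool // stack p q ≤ Setoid.ker (Sum.elim f (Sum.elim g h))} := by
    rw [Matrix.mul_apply, Nat.card_eq_fintype_card, Fintype.card_subtype, Finset.card_filter]
    refine Finset.sum_congr rfl fun g _ => ?_
    simp only [mat, stack_le, ite_and, mul_ite, mul_one, mul_zero]
    split_ifs <;> rfl
  rw [h1, Matrix.smul_apply, mat]
  split_ifs with hc
  · obtain ⟨e⟩ := card_ext p q f h hc
    rw [← Nat.card_congr e, Nat.card_fun, Nat.card_eq_fintype_card (α := Bool), Fintype.card_bool]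
    simp [loops]
  · rw [smul_zero, Nat.card_eq_zero]
    left
    refine ⟨fun g => hc ?_⟩
    intro x y hxy
    have := g.2 hxy
    rcases x with x | x <;> rcases y with y | y <;> exact this

theorem mat_faithful [Finite A] [Finite B] {p q : Diagram A B} {a b : ℕ}
    (h : 2 ^ a • mat p = 2 ^ b • mat q) : a = b ∧ p = q := by
  classical
  have h1 : a = b := by
    have := congrFun (congrFun h fun _ => true) fun _ => true
    have hc : ∀ r : Diagram A B, r ≤ Setoid.ker (Sum.elim (fun _ => true) fun _ => true) := by
      intro r x y _
      rcases x with x | x <;> rcases y with y | y <;> rfl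
    have hp := hc p
    have hq := hc q
    simp only [Matrix.smul_apply, mat, if_pos hp, if_pos hq, smul_eq_mul, mul_one] at this
    exact Nat.pow_right_injective le_rfl this
  subst h1
  refine ⟨rfl, ?_⟩
  have h2 : mat p = mat q := by
    ext f g
    have := congrFun (congrFun h f) g
    simpa using this
  have key : ∀ {r s : Diagram A B}, mat r = mat s → s ≤ r := by
    intro r s hrs x y hxy
    let φ : A ⊕ B → Bool := fun z => decide (r x z)
    have hr : r ≤ Setoid.ker (Sum.elim (φ ∘ Sum.inl) (φ ∘ Sum.inr)) := by
      intro z w hzw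
      rw [Sum.elim_comp_inl_inr]
      change φ z = φ w
      simp only [φ, decide_eq_decide]
      exact ⟨fun k => r.trans k hzw, fun k => r.trans k (r.symm hzw)⟩
    have := congrFun (congrFun hrs (φ ∘ Sum.inl)) (φ ∘ Sum.inr)
    have hs : s ≤ Setoid.ker (Sum.elim (φ ∘ Sum.inl) (φ ∘ Sum.inr)) := by
      by_contra hcon
      rw [mat, mat, if_pos hr, if_neg hcon] at this
      exact one_ne_zero this
    have h3 := hs hxy
    rw [Sum.elim_comp_inl_inr] at h3
    change φ x = φ y at h3
    have h4 : φ x = true := by simp only [φ, decide_eq_true_eq]; exact r.refl x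
    rw [h4] at h3
    simpa only [φ, decide_eq_true_eq] using h3.symm
  exact le_antisymm (key h2.symm) (key h2)


theorem mat_ofEquiv (e : A ≃ B) (f : A → Bool) (g : B → Bool) [Decidable (f = g ∘ e)] :
    mat (ofEquiv e) f g = if f = g ∘ e then 1 else 0 := by
  have : ofEquiv e ≤ Setoid.ker (Sum.elim f g) ↔ f = g ∘ e := by
    constructor
    · intro h
      funext a
      exact h (show ofEquiv e (Sum.inl a) (Sum.inr (e a)) from rfl)
    · rintro rfl
      intro x y hxy
      have hg : Sum.elim (g ∘ e) g = g ∘ Sum.elim e id := by ext (z | z) <;> rfl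
      change Sum.elim (g ∘ e) g x = Sum.elim (g ∘ e) g y
      rw [hg]
      exact congrArg g hxy
  simp only [mat, this]

theorem mat_cup (f : Empty → Bool) (g : A ⊕ A → Bool) [Decidable (g ∘ Sum.inl = g ∘ Sum.inr)] :
    mat (cup A) f g = if g ∘ Sum.inl = g ∘ Sum.inr then 1 else 0 := by
  have : cup A ≤ Setoid.ker (Sum.elim f g) ↔ g ∘ Sum.inl = g ∘ Sum.inr := by
    constructor
    · intro h
      funext a
      exact h (show cup A (Sum.inr (Sum.inl a)) (Sum.inr (Sum.inr a)) from rfl)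
    · intro h
      have hg : Sum.elim f g =
          (g ∘ Sum.inr) ∘ Sum.elim Empty.elim (Sum.elim id id) := by
        rw [← Sum.elim_comp_inl_inr g, h]
        ext (z | z | z)
        · exact z.elim
        · rfl
        · rfl
      intro x y hxy
      change Sum.elim f g x = Sum.elim f g y
      rw [hg]
      exact congrArg (g ∘ Sum.inr) hxy
  simp only [mat, this]

theorem mat_cap (f : A ⊕ A → Bool) (g : Empty → Bool) [Decidable (f ∘ Sum.inl = f ∘ Sum.inr)] :
    mat (cap A) f g = if f ∘ Sum.inl = f ∘ Sum.inr then 1 else 0 := by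
  have : cap A ≤ Setoid.ker (Sum.elim f g) ↔ f ∘ Sum.inl = f ∘ Sum.inr := by
    constructor
    · intro h
      funext a
      exact h (show cap A (Sum.inl (Sum.inl a)) (Sum.inl (Sum.inr a)) from rfl)
    · intro h
      have hg : Sum.elim f g =
          (f ∘ Sum.inr) ∘ Sum.elim (Sum.elim id id) Empty.elim := by
        rw [← Sum.elim_comp_inl_inr f, h]
        ext ((z | z) | z)
        · rfl
        · rfl
        · exact z.elim
      intro x y hxy
      change Sum.elim f g x = Sum.elim f g y
      rw [hg]
      exact congrArg (f ∘ Sum.inr) hxy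
  simp only [mat, this]

theorem mat_tensor (p : Diagram A B) (q : Diagram C D) (f : A ⊕ C → Bool) (g : B ⊕ D → Bool) :
    mat (tensor p q) f g =
      mat p (f ∘ Sum.inl) (g ∘ Sum.inl) * mat q (f ∘ Sum.inr) (g ∘ Sum.inr) := by
  have : tensor p q ≤ Setoid.ker (Sum.elim f g) ↔
      p ≤ Setoid.ker (Sum.elim (f ∘ Sum.inl) (g ∘ Sum.inl)) ∧
      q ≤ Setoid.ker (Sum.elim (f ∘ Sum.inr) (g ∘ Sum.inr)) := by
    constructor
    · intro h
      constructor
      · intro x y hxy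
        have h1 : tensor p q (Sum.map Sum.inl Sum.inl x) (Sum.map Sum.inl Sum.inl y) := by
          have := congrArg (Sum.inl (β := Quotient q)) (Quotient.sound (s := p) hxy)
          rcases x with x | x <;> rcases y with y | y <;> exact this
        have h2 := h h1
        rcases x with x | x <;> rcases y with y | y <;> exact h2
      · intro x y hxy
        have h1 : tensor p q (Sum.map Sum.inr Sum.inr x) (Sum.map Sum.inr Sum.inr y) := by
          have := congrArg (Sum.inr (α := Quotient p)) (Quotient.sound (s := q) hxy)
          rcases x with x | x <;> rcases y with y | y <;> exact this
        have h2 := h h1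
        rcases x with x | x <;> rcases y with y | y <;> exact h2
    · rintro ⟨h1, h2⟩ x y hxy
      rcases x with (x | x) | (x | x) <;> rcases y with (y | y) | (y | y) <;>
        first
        | exact absurd (show Sum.inl _ = Sum.inr _ from hxy) Sum.inl_ne_inr
        | exact absurd (show Sum.inr _ = Sum.inl _ from hxy) Sum.inr_ne_inl
        | exact h1 (Quotient.exact (s := p) (Sum.inl_injective hxy))
        | exact h2 (Quotient.exact (s := q) (Sum.inr_injective hxy))
  classical
  unfold mat
  rw [if_congr this rfl rfl, ite_and]
  split_ifs <;> simp

end Diagram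

/-- A pair `(k, p)`, which stands for the multiple `t ^ k • p` of the diagram `p`. -/
structure SDiagram (A B : Type) where
  exp : ℕ
  diag : Diagram A B

namespace SDiagram
variable {A B C D A' B' C' D' : Type}

noncomputable def val (x : SDiagram A B) : Matrix (A → Bool) (B → Bool) ℕ :=
  2 ^ x.exp • Diagram.mat x.diag

theorem val_injective [Finite A] [Finite B] {x y : SDiagram A B} (h : x.val = y.val) : x = y := by
  obtain ⟨h1, h2⟩ := Diagram.mat_faithful h
  cases x; cases y; simp_all

noncomputable def comp (x : SDiagram A B) (y : SDiagram B C) : SDiagram A C :=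
  ⟨x.exp + y.exp + Diagram.loops x.diag y.diag, Diagram.comp x.diag y.diag⟩

def tensor (x : SDiagram A B) (y : SDiagram C D) : SDiagram (A ⊕ C) (B ⊕ D) :=
  ⟨x.exp + y.exp, Diagram.tensor x.diag y.diag⟩

def ofEquiv (e : A ≃ B) : SDiagram A B := ⟨0, Diagram.ofEquiv e⟩
def cup (A : Type) : SDiagram Empty (A ⊕ A) := ⟨0, Diagram.cup A⟩
def cap (A : Type) : SDiagram (A ⊕ A) Empty := ⟨0, Diagram.cap A⟩

theorem val_comp [Finite A] [Fintype B] [Finite C] [DecidableEq B]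
    (x : SDiagram A B) (y : SDiagram B C) : (x.comp y).val = x.val * y.val := by
  simp only [val, comp, Matrix.smul_mul, Matrix.mul_smul, Diagram.mat_mul, smul_smul]
  congr 1
  ring

theorem val_tensor (x : SDiagram A B) (y : SDiagram C D) (f : A ⊕ C → Bool) (g : B ⊕ D → Bool) :
    (x.tensor y).val f g =
      x.val (f ∘ Sum.inl) (g ∘ Sum.inl) * y.val (f ∘ Sum.inr) (g ∘ Sum.inr) := by
  simp only [val, tensor, Matrix.smul_apply, Diagram.mat_tensor, smul_eq_mul]
  ring

theorem val_ofEquiv (e : A ≃ B) (f : A → Bool) (g : B → Bool) [Decidable (f = g ∘ e)] :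
    (ofEquiv e).val f g = if f = g ∘ e then 1 else 0 := by
  simp [val, ofEquiv, Diagram.mat_ofEquiv]

theorem val_cup (f : Empty → Bool) (g : A ⊕ A → Bool) [Decidable (g ∘ Sum.inl = g ∘ Sum.inr)] :
    (cup A).val f g = if g ∘ Sum.inl = g ∘ Sum.inr then 1 else 0 := by
  simp [val, cup, Diagram.mat_cup]

theorem val_cap (f : A ⊕ A → Bool) (g : Empty → Bool) [Decidable (f ∘ Sum.inl = f ∘ Sum.inr)] :
    (cap A).val f g = if f ∘ Sum.inl = f ∘ Sum.inr then 1 else 0 := by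
  simp [val, cap, Diagram.mat_cap]

theorem val_ofEquiv_comp [Finite A] [Finite B] [Finite C] (e : A ≃ B) (x : SDiagram B C)
    (f : A → Bool) (g : C → Bool) : ((ofEquiv e).comp x).val f g = x.val (f ∘ e.symm) g := by
  classical
  cases nonempty_fintype B
  have h : ∀ k : B → Bool, f = k ∘ e ↔ f ∘ e.symm = k := fun k =>
    ⟨fun h => by subst h; ext; simp, fun h => by subst h; ext; simp⟩
  rw [val_comp, Matrix.mul_apply]
  simp only [val_ofEquiv, h, ite_mul, one_mul, zero_mul, Finset.sum_ite_eq, Finset.mem_univ, if_true]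

theorem val_comp_ofEquiv [Finite A] [Finite B] [Finite C] (x : SDiagram A B) (e : B ≃ C)
    (f : A → Bool) (g : C → Bool) : (x.comp (ofEquiv e)).val f g = x.val f (g ∘ e) := by
  classical
  cases nonempty_fintype B
  rw [val_comp, Matrix.mul_apply]
  simp only [val_ofEquiv, mul_ite, mul_one, mul_zero, Finset.sum_ite_eq', Finset.mem_univ, if_true]

theorem comp_assoc [Finite A] [Finite B] [Finite C] [Finite D]
    (x : SDiagram A B) (y : SDiagram B C) (z : SDiagram C D) :
    (x.comp y).comp z = x.comp (y.comp z) := by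
  classical
  cases nonempty_fintype B
  cases nonempty_fintype C
  apply val_injective
  simp only [val_comp, Matrix.mul_assoc]

theorem id_comp [Finite A] [Finite B] (x : SDiagram A B) : (ofEquiv (Equiv.refl A)).comp x = x :=
  val_injective (by ext f g; rw [val_ofEquiv_comp]; rfl)

theorem comp_id [Finite A] [Finite B] (x : SDiagram A B) : x.comp (ofEquiv (Equiv.refl B)) = x :=
  val_injective (by ext f g; rw [val_comp_ofEquiv]; rfl)

theorem ofEquiv_comp_ofEquiv [Finite A] [Finite B] [Finite C] (e : A ≃ B) (e' : B ≃ C) :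
    (ofEquiv e).comp (ofEquiv e') = ofEquiv (e.trans e') := by
  classical
  refine val_injective (by ext f g; rw [val_comp_ofEquiv, val_ofEquiv, val_ofEquiv]; rfl)

theorem tensor_comp [Finite A] [Finite B] [Finite C] [Finite A'] [Finite B'] [Finite C']
    (x : SDiagram A B) (y : SDiagram B C) (x' : SDiagram A' B') (y' : SDiagram B' C') :
    (x.tensor x').comp (y.tensor y') = (x.comp y).tensor (x'.comp y') := by
  classical
  cases nonempty_fintype B
  cases nonempty_fintype B'
  apply val_injective
  ext f g
  rw [val_comp, val_tensor, val_comp, val_comp, Matrix.mul_apply, Matrix.mul_apply,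
    Matrix.mul_apply, Finset.sum_mul_sum, ← Finset.sum_product', Finset.univ_product_univ]
  refine Fintype.sum_equiv (Equiv.sumArrowEquivProdArrow B B' Bool) _ _ fun k => ?_
  rw [val_tensor, val_tensor]
  simp only [Equiv.sumArrowEquivProdArrow]
  exact mul_mul_mul_comm _ _ _ _

theorem tensor_ofEquiv [Finite A] [Finite B] [Finite C] [Finite D] (e : A ≃ B) (e' : C ≃ D) :
    (ofEquiv e).tensor (ofEquiv e') = ofEquiv (Equiv.sumCongr e e') := by
  classical
  apply val_injective
  ext f g
  rw [val_tensor, val_ofEquiv, val_ofEquiv, val_ofEquiv]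
  have : f = g ∘ Equiv.sumCongr e e' ↔
      f ∘ Sum.inl = (g ∘ Sum.inl) ∘ e ∧ f ∘ Sum.inr = (g ∘ Sum.inr) ∘ e' := by
    constructor
    · rintro rfl; exact ⟨rfl, rfl⟩
    · rintro ⟨h1, h2⟩
      ext (z | z)
      · exact congrFun h1 z
      · exact congrFun h2 z
  rw [if_congr this rfl rfl, ite_and]
  split_ifs <;> simp

theorem assoc_natural [Finite A] [Finite B] [Finite C] [Finite A'] [Finite B'] [Finite C']
    (x : SDiagram A A') (y : SDiagram B B') (z : SDiagram C C') :
    ((x.tensor y).tensor z).comp (ofEquiv (Equiv.sumAssoc A' B' C')) =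
      (ofEquiv (Equiv.sumAssoc A B C)).comp (x.tensor (y.tensor z)) := by
  apply val_injective
  ext f g
  rw [val_comp_ofEquiv, val_ofEquiv_comp]
  simp only [val_tensor, mul_assoc]
  rfl

theorem comm_natural [Finite A] [Finite B] [Finite A'] [Finite B']
    (x : SDiagram A A') (y : SDiagram B B') :
    (x.tensor y).comp (ofEquiv (Equiv.sumComm A' B')) =
      (ofEquiv (Equiv.sumComm A B)).comp (y.tensor x) := by
  apply val_injective
  ext f g
  rw [val_comp_ofEquiv, val_ofEquiv_comp]
  simp only [val_tensor]
  exact mul_comm _ _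

theorem empty_natural [Finite A] [Finite B] (x : SDiagram A B) :
    ((ofEquiv (Equiv.refl Empty)).tensor x).comp (ofEquiv (Equiv.emptySum Empty B)) =
      (ofEquiv (Equiv.emptySum Empty A)).comp x := by
  classical
  apply val_injective
  ext f g
  rw [val_comp_ofEquiv, val_ofEquiv_comp, val_tensor, val_ofEquiv,
    if_pos (Subsingleton.elim _ _), one_mul]
  rfl

theorem natural_empty [Finite A] [Finite B] (x : SDiagram A B) :
    (x.tensor (ofEquiv (Equiv.refl Empty))).comp (ofEquiv (Equiv.sumEmpty B Empty)) =
      (ofEquiv (Equiv.sumEmpty A Empty)).comp x := by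
  classical
  apply val_injective
  ext f g
  rw [val_comp_ofEquiv, val_ofEquiv_comp, val_tensor, val_ofEquiv,
    if_pos (Subsingleton.elim _ _), mul_one]
  rfl

theorem zigzag [Finite A] :
    ((cup A).tensor (ofEquiv (Equiv.refl A))).comp
        ((ofEquiv (Equiv.sumAssoc A A A)).comp ((ofEquiv (Equiv.refl A)).tensor (cap A))) =
      ofEquiv ((Equiv.emptySum Empty A).trans (Equiv.sumEmpty A Empty).symm) := by
  classical
  cases nonempty_fintype A
  apply val_injective
  ext f g
  rw [val_comp, Matrix.mul_apply]
  simp only [val_ofEquiv_comp, val_tensor, val_ofEquiv, val_cup, val_cap]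
  rw [Finset.sum_eq_single
    (Sum.elim (Sum.elim (f ∘ Sum.inr) (f ∘ Sum.inr)) (f ∘ Sum.inr) : (A ⊕ A) ⊕ A → Bool)]
  · refine (congrArg₂ (· * ·) (congrArg₂ (· * ·) (if_pos rfl) (if_pos rfl))
      (congrArg₂ (· * ·) rfl (if_pos rfl))).trans ?_
    rw [one_mul, one_mul, mul_one]
    refine if_congr ?_ rfl rfl
    constructor
    · intro h
      funext z
      rcases z with z | z
      · exact z.elim
      · exact congrFun h z
    · intro h
      funext z
      exact congrFun h (Sum.inr z)
  · intro k _ hk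
    by_contra hne
    apply hk
    have h1 := right_ne_zero_of_mul (left_ne_zero_of_mul hne)
    have h2 := left_ne_zero_of_mul (left_ne_zero_of_mul hne)
    have h3 := right_ne_zero_of_mul (right_ne_zero_of_mul hne)
    have h1' : f ∘ Sum.inr = (k ∘ Sum.inr) ∘ Equiv.refl A := by
      by_contra hc; exact h1 (if_neg hc)
    have h2' : (k ∘ Sum.inl) ∘ Sum.inl = (k ∘ Sum.inl) ∘ Sum.inr := by
      by_contra hc; exact h2 (if_neg hc)
    have h3' : k ∘ Sum.inl ∘ Sum.inr = k ∘ Sum.inr := by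
      by_contra hc; exact h3 (if_neg hc)
    funext z
    rcases z with (z | z) | z
    · exact ((congrFun h2' z).trans (congrFun h3' z)).trans (congrFun h1' z).symm
    · exact (congrFun h3' z).trans (congrFun h1' z).symm
    · exact (congrFun h1' z).symm
  · simp

theorem zigzag' [Finite A] :
    ((ofEquiv (Equiv.refl A)).tensor (cup A)).comp
        ((ofEquiv (Equiv.sumAssoc A A A).symm).comp ((cap A).tensor (ofEquiv (Equiv.refl A)))) =
      ofEquiv ((Equiv.sumEmpty A Empty).trans (Equiv.emptySum Empty A).symm) := by
  classical
  cases nonempty_fintype A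
  apply val_injective
  ext f g
  rw [val_comp, Matrix.mul_apply]
  simp only [val_ofEquiv_comp, val_tensor, val_ofEquiv, val_cup, val_cap]
  rw [Finset.sum_eq_single
    (Sum.elim (f ∘ Sum.inl) (Sum.elim (f ∘ Sum.inl) (f ∘ Sum.inl)) : A ⊕ (A ⊕ A) → Bool)]
  · refine (congrArg₂ (· * ·) (congrArg₂ (· * ·) (if_pos rfl) (if_pos rfl))
      (congrArg₂ (· * ·) (if_pos rfl) rfl)).trans ?_
    rw [one_mul, one_mul, one_mul]
    refine if_congr ?_ rfl rfl
    constructor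
    · intro h
      funext z
      rcases z with z | z
      · exact congrFun h z
      · exact z.elim
    · intro h
      funext z
      exact congrFun h (Sum.inl z)
  · intro k _ hk
    by_contra hne
    apply hk
    have h1 := left_ne_zero_of_mul (left_ne_zero_of_mul hne)
    have h2 := right_ne_zero_of_mul (left_ne_zero_of_mul hne)
    have h3 := left_ne_zero_of_mul (right_ne_zero_of_mul hne)
    have h1' : f ∘ Sum.inl = (k ∘ Sum.inl) ∘ Equiv.refl A := by
      by_contra hc; exact h1 (if_neg hc)
    have h2' : (k ∘ Sum.inr) ∘ Sum.inl = (k ∘ Sum.inr) ∘ Sum.inr := by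
      by_contra hc; exact h2 (if_neg hc)
    have h3' : k ∘ Sum.inl = k ∘ Sum.inr ∘ Sum.inl := by
      by_contra hc; exact h3 (if_neg hc)
    funext z
    rcases z with z | (z | z)
    · exact (congrFun h1' z).symm
    · exact (congrFun h3' z).symm.trans (congrFun h1' z).symm
    · exact ((congrFun h2' z).symm.trans (congrFun h3' z).symm).trans (congrFun h1' z).symm
  · simp

end SDiagram

section linear

variable {F : Type u} [Field F] (t : F) {A B C D A' B' : Type}

/-- The bilinear composition: `p` followed by `q` is `t ^ loops` times the concatenation. -/
noncomputable def compL : (Diagram A B →₀ F) →ₗ[F] (Diagram B C →₀ F) →ₗ[F] (Diagram A C →₀ F) :=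
  Finsupp.linearCombination F fun p => Finsupp.linearCombination F fun q =>
    Finsupp.single (p.comp q) (t ^ p.loops q)

/-- The bilinear juxtaposition of linear combinations of diagrams. -/
noncomputable def tensorL :
    (Diagram A B →₀ F) →ₗ[F] (Diagram C D →₀ F) →ₗ[F] (Diagram (A ⊕ C) (B ⊕ D) →₀ F) :=
  Finsupp.linearCombination F fun p => Finsupp.linearCombination F fun q =>
    Finsupp.single (p.tensor q) 1

/-- The linear combination `t ^ k • p` attached to a scaled diagram `(k, p)`. -/
noncomputable def ofS (x : SDiagram A B) : Diagram A B →₀ F := Finsupp.single x.diag (t ^ x.exp)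

theorem compL_ofS (x : SDiagram A B) (y : SDiagram B C) :
    compL t (ofS t x) (ofS t y) = ofS t (x.comp y) := by
  simp only [compL, ofS, Finsupp.linearCombination_single, LinearMap.smul_apply,
    Finsupp.smul_single, smul_eq_mul, SDiagram.comp]
  congr 1
  ring

theorem tensorL_ofS (x : SDiagram A B) (y : SDiagram C D) :
    tensorL (ofS t x) (ofS t y) = ofS t (x.tensor y) := by
  simp only [tensorL, ofS, Finsupp.linearCombination_single, LinearMap.smul_apply,
    Finsupp.smul_single, smul_eq_mul, SDiagram.tensor]
  congr 1
  ring

theorem ind {P : (Diagram A B →₀ F) → Prop} (h0 : P 0)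
    (hadd : ∀ f g, P f → P g → P (f + g)) (hs : ∀ (c : F) (x : SDiagram A B), P (c • ofS t x))
    (f : Diagram A B →₀ F) : P f := by
  induction f using Finsupp.induction_linear with
  | zero => exact h0
  | add f g hf hg => exact hadd f g hf hg
  | single p c =>
    have := hs c ⟨0, p⟩
    simpa [ofS] using this

theorem compL_id_left [Finite A] [Finite B] (f : Diagram A B →₀ F) :
    compL t (ofS t (SDiagram.ofEquiv (Equiv.refl A))) f = f := by
  induction f using ind t with
  | h0 => simp
  | hadd a b ha hb => simp only [map_add, LinearMap.add_apply, ha, hb]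
  | hs c x =>
    rw [map_smul, compL_ofS, SDiagram.id_comp]

theorem compL_id_right [Finite A] [Finite B] (f : Diagram A B →₀ F) :
    compL t f (ofS t (SDiagram.ofEquiv (Equiv.refl B))) = f := by
  induction f using ind t with
  | h0 => simp
  | hadd a b ha hb => simp only [map_add, LinearMap.add_apply, ha, hb]
  | hs c x =>
    rw [map_smul, LinearMap.smul_apply, compL_ofS, SDiagram.comp_id]

theorem compL_assoc [Finite A] [Finite B] [Finite C] [Finite D]
    (f : Diagram A B →₀ F) (g : Diagram B C →₀ F) (h : Diagram C D →₀ F) :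
    compL t (compL t f g) h = compL t f (compL t g h) := by
  induction f using ind t with
  | h0 => simp
  | hadd a b ha hb => simp only [map_add, LinearMap.add_apply, ha, hb]
  | hs a x =>
    induction g using ind t with
    | h0 => simp
    | hadd a b ha hb => simp only [map_add, LinearMap.add_apply, ha, hb]
    | hs b y =>
      induction h using ind t with
      | h0 => simp
      | hadd a b ha hb => simp only [map_add, LinearMap.add_apply, ha, hb]
      | hs c z =>
        simp only [map_smul, LinearMap.smul_apply, compL_ofS, SDiagram.comp_assoc]

theorem compL_tensorL [Finite A] [Finite B] [Finite C] [Finite A'] [Finite B'] {C' : Type}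
    [Finite C'] (f : Diagram A B →₀ F) (g : Diagram B C →₀ F) (f' : Diagram A' B' →₀ F)
    (g' : Diagram B' C' →₀ F) :
    compL t (tensorL f f') (tensorL g g') = tensorL (compL t f g) (compL t f' g') := by
  induction f using ind t with
  | h0 => simp
  | hadd a b ha hb => simp only [map_add, LinearMap.add_apply, ha, hb]
  | hs a x =>
    induction g using ind t with
    | h0 => simp
    | hadd a b ha hb => simp only [map_add, LinearMap.add_apply, ha, hb]
    | hs b y =>
      induction f' using ind t with
      | h0 => simp
      | hadd a b ha hb => simp only [map_add, LinearMap.add_apply, ha, hb]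
      | hs c z =>
        induction g' using ind t with
        | h0 => simp
        | hadd a b ha hb => simp only [map_add, LinearMap.add_apply, ha, hb]
        | hs d w =>
          simp only [map_smul, LinearMap.smul_apply, compL_ofS, tensorL_ofS, SDiagram.tensor_comp]
          rw [smul_comm b c]

end linear

/-- The objects `[U]`, for finite sets `U`, of the category of partition diagrams over `F` with
parameter `t`; morphisms `[U] ⟶ [V]` are linear combinations of diagrams from `U` to `V`. -/
structure RepZero (F : Type u) (t : F) : Type 1 where
  of ::
  V : Type
  [fin : Finite V]

attribute [instance] RepZero.fin

namespace RepZero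
variable {F : Type u} [Field F] {t : F}

noncomputable instance : Category (RepZero F t) where
  Hom X Y := Diagram X.V Y.V →₀ F
  id X := ofS t (SDiagram.ofEquiv (Equiv.refl X.V))
  comp f g := compL t f g
  id_comp f := compL_id_left t f
  comp_id f := compL_id_right t f
  assoc f g h := compL_assoc t f g h

noncomputable instance : Preadditive (RepZero F t) where
  homGroup X Y := inferInstanceAs (AddCommGroup (Diagram X.V Y.V →₀ F))
  add_comp X Y Z f f' g := LinearMap.map_add₂ (compL (A := X.V) (B := Y.V) (C := Z.V) t) f f' g
  comp_add X Y Z f g g' := (compL (A := X.V) (B := Y.V) (C := Z.V) t f).map_add g g'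

noncomputable instance : Linear F (RepZero F t) where
  homModule X Y := inferInstanceAs (Module F (Diagram X.V Y.V →₀ F))
  smul_comp X Y Z a f g := LinearMap.map_smul₂ (compL (A := X.V) (B := Y.V) (C := Z.V) t) a f g
  comp_smul X Y Z f a g := (compL (A := X.V) (B := Y.V) (C := Z.V) t f).map_smul a g

/-- The isomorphism given by the diagram of a bijection. -/
noncomputable def isoOfEquiv {X Y : RepZero F t} (e : X.V ≃ Y.V) : X ≅ Y where
  hom := ofS t (SDiagram.ofEquiv e)
  inv := ofS t (SDiagram.ofEquiv e.symm)
  hom_inv_id := by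
    change compL t _ _ = ofS t _
    rw [compL_ofS, SDiagram.ofEquiv_comp_ofEquiv, Equiv.self_trans_symm]
  inv_hom_id := by
    change compL t _ _ = ofS t _
    rw [compL_ofS, SDiagram.ofEquiv_comp_ofEquiv, Equiv.symm_trans_self]

/-- The tensor product of morphisms. -/
noncomputable def tensorMap {X Y X' Y' : RepZero F t} (f : X ⟶ Y) (g : X' ⟶ Y') :
    (of (X.V ⊕ X'.V) : RepZero F t) ⟶ of (Y.V ⊕ Y'.V) := tensorL f g

theorem tensor_comp {X Y Z X' Y' Z' : RepZero F t} (f : X ⟶ Y) (g : Y ⟶ Z) (f' : X' ⟶ Y')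
    (g' : Y' ⟶ Z') : tensorMap f f' ≫ tensorMap g g' = tensorMap (f ≫ g) (f' ≫ g') :=
  compL_tensorL t f g f' g'

theorem isoOfEquiv_comp {X Y Z : RepZero F t} (e : X.V ≃ Y.V) (e' : Y.V ≃ Z.V) :
    (isoOfEquiv e : X ≅ Y).hom ≫ (isoOfEquiv e' : Y ≅ Z).hom = (isoOfEquiv (e.trans e')).hom := by
  change compL t (ofS t _) (ofS t _) = ofS t _
  rw [compL_ofS, SDiagram.ofEquiv_comp_ofEquiv]

theorem tensor_isoOfEquiv {X Y X' Y' : RepZero F t} (e : X.V ≃ Y.V) (e' : X'.V ≃ Y'.V) :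
    tensorMap (isoOfEquiv e : X ≅ Y).hom (isoOfEquiv e' : X' ≅ Y').hom =
      (isoOfEquiv (X := of (X.V ⊕ X'.V)) (Y := of (Y.V ⊕ Y'.V)) (Equiv.sumCongr e e')).hom := by
  change tensorL (ofS t _) (ofS t _) = ofS t _
  rw [tensorL_ofS t, SDiagram.tensor_ofEquiv]

theorem id_eq (X : RepZero F t) : 𝟙 X = (isoOfEquiv (Equiv.refl X.V) : X ≅ X).hom := rfl

noncomputable instance : MonoidalCategoryStruct (RepZero F t) where
  tensorObj X Y := of (X.V ⊕ Y.V)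
  tensorHom f g := tensorMap f g
  whiskerLeft X _ _ f := tensorMap (𝟙 X) f
  whiskerRight f X := tensorMap f (𝟙 X)
  tensorUnit := of Empty
  associator X Y Z := isoOfEquiv (Equiv.sumAssoc X.V Y.V Z.V)
  leftUnitor X := isoOfEquiv (Equiv.emptySum Empty X.V)
  rightUnitor X := isoOfEquiv (Equiv.sumEmpty X.V Empty)

theorem assoc_nat {X Y Z X' Y' Z' : RepZero F t} (f : X ⟶ X') (g : Y ⟶ Y') (h : Z ⟶ Z') :
    tensorMap (tensorMap f g) h ≫ (α_ X' Y' Z').hom =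
      (α_ X Y Z).hom ≫ tensorMap f (tensorMap g h) := by
  change compL t (tensorL (tensorL f g) h) (ofS t _) = compL t (ofS t _) (tensorL f (tensorL g h))
  induction f using ind t with
  | h0 => simp
  | hadd a b ha hb => simp only [map_add, LinearMap.add_apply, ha, hb]
  | hs a x =>
    induction g using ind t with
    | h0 => simp
    | hadd a b ha hb => simp only [map_add, LinearMap.add_apply, ha, hb]
    | hs b y =>
      induction h using ind t with
      | h0 => simp
      | hadd a b ha hb => simp only [map_add, LinearMap.add_apply, ha, hb]
      | hs c z =>
        simp only [map_smul, LinearMap.smul_apply, compL_ofS, tensorL_ofS]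
        congr 4
        exact SDiagram.assoc_natural x y z

theorem left_nat {X Y : RepZero F t} (f : X ⟶ Y) :
    tensorMap (𝟙 (𝟙_ (RepZero F t))) f ≫ (λ_ Y).hom = (λ_ X).hom ≫ f := by
  change compL t (tensorL (ofS t _) f) (ofS t _) = compL t (ofS t _) f
  induction f using ind t with
  | h0 => simp
  | hadd a b ha hb => simp only [map_add, LinearMap.add_apply, ha, hb]
  | hs a x =>
    simp only [map_smul, LinearMap.smul_apply, compL_ofS, tensorL_ofS]
    congr 2
    exact SDiagram.empty_natural x

theorem right_nat {X Y : RepZero F t} (f : X ⟶ Y) :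
    tensorMap f (𝟙 (𝟙_ (RepZero F t))) ≫ (ρ_ Y).hom = (ρ_ X).hom ≫ f := by
  change compL t (tensorL f (ofS t _)) (ofS t _) = compL t (ofS t _) f
  induction f using ind t with
  | h0 => simp
  | hadd a b ha hb => simp only [map_add, LinearMap.add_apply, ha, hb]
  | hs a x =>
    simp only [map_smul, LinearMap.smul_apply, compL_ofS, tensorL_ofS]
    congr 2
    exact SDiagram.natural_empty x

theorem tensor_id (X Y : RepZero F t) : tensorMap (𝟙 X) (𝟙 Y) = 𝟙 (X ⊗ Y) := by
  rw [id_eq, id_eq, tensor_isoOfEquiv, Equiv.sumCongr_refl]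
  rfl

noncomputable instance : MonoidalCategory (RepZero F t) := MonoidalCategory.ofTensorHom
  (id_tensorHom_id := tensor_id)
  (id_tensorHom := fun _ _ _ _ => rfl)
  (tensorHom_id := fun _ _ => rfl)
  (tensorHom_comp_tensorHom := fun f₁ f₂ g₁ g₂ => tensor_comp f₁ g₁ f₂ g₂)
  (associator_naturality := assoc_nat)
  (leftUnitor_naturality := left_nat)
  (rightUnitor_naturality := right_nat)
  (pentagon := fun W X Y Z => by
    change tensorMap (isoOfEquiv _).hom (isoOfEquiv _).hom ≫ (isoOfEquiv _).hom ≫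
      tensorMap (isoOfEquiv _).hom (isoOfEquiv _).hom = (isoOfEquiv _).hom ≫ (isoOfEquiv _).hom
    simp only [tensor_isoOfEquiv, isoOfEquiv_comp]
    congr 2
    ext (((x | x) | x) | x) <;> rfl)
  (triangle := fun X Y => by
    change (isoOfEquiv _).hom ≫ tensorMap (isoOfEquiv _).hom (isoOfEquiv _).hom =
      tensorMap (isoOfEquiv _).hom (isoOfEquiv _).hom
    simp only [tensor_isoOfEquiv, isoOfEquiv_comp]
    congr 2
    ext ((x | x) | x)
    · rfl
    · exact x.elim
    · rfl)

instance : MonoidalPreadditive (RepZero F t) where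
  whiskerLeft_zero {X _ _} := map_zero (tensorL (F := F) (𝟙 X : Diagram X.V X.V →₀ F))
  zero_whiskerRight {X _ _} := LinearMap.map_zero₂ (tensorL (F := F)) (𝟙 X : Diagram X.V X.V →₀ F)
  whiskerLeft_add {X _ _} f g := map_add (tensorL (F := F) (𝟙 X : Diagram X.V X.V →₀ F)) f g
  add_whiskerRight {X _ _} f g :=
    LinearMap.map_add₂ (tensorL (F := F)) f g (𝟙 X : Diagram X.V X.V →₀ F)

noncomputable instance : SymmetricCategory (RepZero F t) where
  braiding X Y := isoOfEquiv (Equiv.sumComm X.V Y.V)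
  braiding_naturality_right X Y Z f := by
    change compL t (tensorL (ofS t _) f) (ofS t _) = compL t (ofS t _) (tensorL f (ofS t _))
    induction f using ind t with
    | h0 => simp
    | hadd a b ha hb => simp only [map_add, LinearMap.add_apply, ha, hb]
    | hs a x =>
      simp only [map_smul, LinearMap.smul_apply, compL_ofS, tensorL_ofS]
      congr 2
      exact SDiagram.comm_natural _ _
  braiding_naturality_left f Z := by
    change compL t (tensorL f (ofS t _)) (ofS t _) = compL t (ofS t _) (tensorL (ofS t _) f)
    induction f using ind t with
    | h0 => simp
    | hadd a b ha hb => simp only [map_add, LinearMap.add_apply, ha, hb]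
    | hs a x =>
      simp only [map_smul, LinearMap.smul_apply, compL_ofS, tensorL_ofS]
      congr 2
      exact SDiagram.comm_natural _ _
  hexagon_forward X Y Z := by
    change (isoOfEquiv _).hom ≫ (isoOfEquiv _).hom ≫ (isoOfEquiv _).hom =
      tensorMap (isoOfEquiv _).hom (isoOfEquiv _).hom ≫ (isoOfEquiv _).hom ≫
      tensorMap (isoOfEquiv _).hom (isoOfEquiv _).hom
    simp only [tensor_isoOfEquiv, isoOfEquiv_comp]
    congr 2
    ext ((x | x) | x) <;> rfl
  hexagon_reverse X Y Z := by
    change (isoOfEquiv _).hom ≫ (isoOfEquiv _).hom ≫ (isoOfEquiv _).hom =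
      tensorMap (isoOfEquiv _).hom (isoOfEquiv _).hom ≫ (isoOfEquiv _).hom ≫
      tensorMap (isoOfEquiv _).hom (isoOfEquiv _).hom
    simp only [tensor_isoOfEquiv, isoOfEquiv_comp]
    congr 2
    ext (x | (x | x)) <;> rfl
  symmetry X Y := by
    change (isoOfEquiv _).hom ≫ (isoOfEquiv _).hom = (isoOfEquiv _).hom
    simp only [isoOfEquiv_comp]
    congr 2
    ext (x | x) <;> rfl

noncomputable instance : RightRigidCategory (RepZero F t) where
  rightDual X :=
    { rightDual := X
      exact :=
        { coevaluation' := ofS t (SDiagram.cup X.V)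
          evaluation' := ofS t (SDiagram.cap X.V)
          coevaluation_evaluation' := by
            change compL t (tensorL (ofS t _) (ofS t _)) (compL t (ofS t _)
              (tensorL (ofS t _) (ofS t _))) = compL t (ofS t _) (ofS t _)
            simp only [compL_ofS, tensorL_ofS]
            erw [SDiagram.zigzag', SDiagram.ofEquiv_comp_ofEquiv]
          evaluation_coevaluation' := by
            change compL t (tensorL (ofS t _) (ofS t _)) (compL t (ofS t _)
              (tensorL (ofS t _) (ofS t _))) = compL t (ofS t _) (ofS t _)
            simp only [compL_ofS, tensorL_ofS]
            erw [SDiagram.zigzag, SDiagram.ofEquiv_comp_ofEquiv] } }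

end RepZero

namespace MatEnv

variable {C : Type u} [Category.{v} C] [Preadditive C]

noncomputable instance (R : Type w) [Semiring R] [Linear R C] : Linear R (Mat_ C) where
  homModule M N := inferInstanceAs (Module R (∀ (i : M.ι) (j : N.ι), M.X i ⟶ N.X j))
  smul_comp M N K r f g := by
    ext i k
    change ∑ j, (r • f i j) ≫ g j k = r • ∑ j, f i j ≫ g j k
    simp only [Linear.smul_comp, Finset.smul_sum]
  comp_smul M N K f r g := by
    ext i k
    change ∑ j, f i j ≫ (r • g j k) = r • ∑ j, f i j ≫ g j k
    simp only [Linear.comp_smul, Finset.smul_sum]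

open scoped Classical in
/-- The matrix with entries `φ i` at the places `(i, σ i)` and zeros elsewhere. -/
noncomputable def permHom {M N : Mat_ C} (σ : M.ι → N.ι) (φ : ∀ i, M.X i ⟶ N.X (σ i)) : M ⟶ N :=
  (fun i j => if h : σ i = j then φ i ≫ eqToHom (congrArg N.X h) else 0 : Mat_.Hom M N)

/-- `f` is the matrix with entries `φ i` at the places `(i, σ i)` and zeros elsewhere. -/
def IsPerm {M N : Mat_ C} (f : M ⟶ N) (σ : M.ι → N.ι) (φ : ∀ i, M.X i ⟶ N.X (σ i)) : Prop :=
  (∀ i, f i (σ i) = φ i) ∧ ∀ i j, σ i ≠ j → f i j = 0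

theorem isPerm_permHom {M N : Mat_ C} (σ : M.ι → N.ι) (φ : ∀ i, M.X i ⟶ N.X (σ i)) :
    IsPerm (permHom σ φ) σ φ := by
  constructor
  · intro i
    simp [permHom]
  · intro i j h
    simp [permHom, h]

theorem isPerm_id (M : Mat_ C) : IsPerm (𝟙 M) (fun i => i) (fun i => 𝟙 (M.X i)) :=
  ⟨fun i => Mat_.id_apply_self M i, fun i j h => Mat_.id_apply_of_ne M i j h⟩

theorem IsPerm.ext {M N : Mat_ C} {f g : M ⟶ N} {σ : M.ι → N.ι} {φ ψ : ∀ i, M.X i ⟶ N.X (σ i)}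
    (hf : IsPerm f σ φ) (hg : IsPerm g σ ψ) (h : ∀ i, φ i = ψ i) : f = g := by
  ext i j
  by_cases hij : σ i = j
  · subst hij
    rw [hf.1, hg.1, h]
  · rw [hf.2 i j hij, hg.2 i j hij]

theorem IsPerm.comp_apply {M N K : Mat_ C} {f : M ⟶ N} {σ : M.ι → N.ι}
    {φ : ∀ i, M.X i ⟶ N.X (σ i)} (hf : IsPerm f σ φ) (g : N ⟶ K) (i : M.ι) (k : K.ι) :
    (f ≫ g : Mat_.Hom M K) i k = φ i ≫ g (σ i) k := by
  rw [Mat_.comp_apply, Finset.sum_eq_single (σ i), hf.1]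
  · intro j _ hj
    rw [hf.2 i j hj.symm, Limits.zero_comp]
  · simp

theorem IsPerm.apply_comp {M N K : Mat_ C} {f : M ⟶ N} {σ : M.ι → N.ι}
    {φ : ∀ i, M.X i ⟶ N.X (σ i)} (hf : IsPerm f σ φ) (hσ : Function.Injective σ)
    (g : K ⟶ M) (k : K.ι) (i : M.ι) :
    (g ≫ f : Mat_.Hom K N) k (σ i) = g k i ≫ φ i := by
  rw [Mat_.comp_apply, Finset.sum_eq_single i, hf.1]
  · intro j _ hj
    rw [hf.2 j (σ i) (fun h => hj (hσ h)), Limits.comp_zero]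
  · simp

theorem IsPerm.comp {M N K : Mat_ C} {f : M ⟶ N} {σ : M.ι → N.ι}
    {φ : ∀ i, M.X i ⟶ N.X (σ i)} (hf : IsPerm f σ φ) {g : N ⟶ K} {τ : N.ι → K.ι}
    {ψ : ∀ i, N.X i ⟶ K.X (τ i)} (hg : IsPerm g τ ψ) :
    IsPerm (f ≫ g) (fun i => τ (σ i)) (fun i => φ i ≫ ψ (σ i)) := by
  constructor
  · intro i
    rw [hf.comp_apply, hg.1]
  · intro i k h
    rw [hf.comp_apply, hg.2 _ _ h, Limits.comp_zero]

variable [MonoidalCategory C] [MonoidalPreadditive C]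

@[reducible] def tensorObj (M N : Mat_ C) : Mat_ C := ⟨M.ι × N.ι, fun x => M.X x.1 ⊗ N.X x.2⟩

def tensorHom {M N M' N' : Mat_ C} (f : M ⟶ N) (g : M' ⟶ N') :
    tensorObj M M' ⟶ tensorObj N N' :=
  (fun x y => f x.1 y.1 ⊗ₘ g x.2 y.2 : Mat_.Hom (tensorObj M M') (tensorObj N N'))

theorem tensorHom_apply {M N M' N' : Mat_ C} (f : M ⟶ N) (g : M' ⟶ N')
    (x : (tensorObj M M').ι) (y : (tensorObj N N').ι) :
    (tensorHom f g : Mat_.Hom (tensorObj M M') (tensorObj N N')) x y = f x.1 y.1 ⊗ₘ g x.2 y.2 := rfl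

theorem zero_tensor' {X Y X' Y' : C} (g : X' ⟶ Y') : (0 : X ⟶ Y) ⊗ₘ g = 0 := by
  simp [MonoidalCategory.tensorHom_def]

theorem tensor_zero' {X Y X' Y' : C} (g : X' ⟶ Y') : g ⊗ₘ (0 : X ⟶ Y) = 0 := by
  simp [MonoidalCategory.tensorHom_def]

theorem tensor_comp {M N K M' N' K' : Mat_ C} (f : M ⟶ N) (g : N ⟶ K) (f' : M' ⟶ N')
    (g' : N' ⟶ K') : tensorHom f f' ≫ tensorHom g g' = tensorHom (f ≫ g) (f' ≫ g') := by
  ext x y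
  rw [tensorHom_apply, Mat_.comp_apply, Mat_.comp_apply, Mat_.comp_apply, sum_tensor]
  simp only [tensor_sum, ← MonoidalCategory.tensorHom_comp_tensorHom]
  rw [← Finset.sum_product', Finset.univ_product_univ]
  rfl

theorem IsPerm.tensor {M N M' N' : Mat_ C} {f : M ⟶ N} {σ : M.ι → N.ι}
    {φ : ∀ i, M.X i ⟶ N.X (σ i)} (hf : IsPerm f σ φ) {g : M' ⟶ N'} {τ : M'.ι → N'.ι}
    {ψ : ∀ i, M'.X i ⟶ N'.X (τ i)} (hg : IsPerm g τ ψ) :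
    IsPerm (tensorHom f g) (fun x => (σ x.1, τ x.2)) (fun x => φ x.1 ⊗ₘ ψ x.2) := by
  constructor
  · intro x
    rw [tensorHom_apply]
    exact congrArg₂ _ (hf.1 x.1) (hg.1 x.2)
  · intro x y h
    rw [tensorHom_apply]
    by_cases h1 : σ x.1 = y.1
    · have h2 : τ x.2 ≠ y.2 := fun h2 => h (Prod.ext h1 h2)
      rw [hg.2 _ _ h2, tensor_zero']
    · rw [hf.2 _ _ h1, zero_tensor']

theorem tensor_id (M N : Mat_ C) : tensorHom (𝟙 M) (𝟙 N) = 𝟙 (tensorObj M N) :=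
  IsPerm.ext ((isPerm_id M).tensor (isPerm_id N)) (isPerm_id (tensorObj M N))
    (fun _ => MonoidalCategory.id_tensorHom_id _ _)

/-- An isomorphism given by a pair of mutually inverse permutation matrices. -/
noncomputable def permIso {M N : Mat_ C} (σ : M.ι → N.ι) (φ : ∀ i, M.X i ⟶ N.X (σ i))
    (τ : N.ι → M.ι) (ψ : ∀ i, N.X i ⟶ M.X (τ i)) (h : permHom σ φ ≫ permHom τ ψ = 𝟙 M)
    (h' : permHom τ ψ ≫ permHom σ φ = 𝟙 N) : M ≅ N where
  hom := permHom σ φ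
  inv := permHom τ ψ
  hom_inv_id := h
  inv_hom_id := h'

/-- The unit object: one summand, the unit of `C`. -/
@[reducible] def tensorUnit (C : Type u) [Category.{v} C] [Preadditive C] [MonoidalCategory C] :
    Mat_ C := ⟨PUnit, fun _ => 𝟙_ C⟩

noncomputable def assoc (X Y Z : Mat_ C) :
    tensorObj (tensorObj X Y) Z ≅ tensorObj X (tensorObj Y Z) :=
  permIso (M := tensorObj (tensorObj X Y) Z) (N := tensorObj X (tensorObj Y Z))
    (fun x => (x.1.1, (x.1.2, x.2))) (fun x => (α_ (X.X x.1.1) (Y.X x.1.2) (Z.X x.2)).hom)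
    (fun x => ((x.1, x.2.1), x.2.2)) (fun x => (α_ (X.X x.1) (Y.X x.2.1) (Z.X x.2.2)).inv)
    (IsPerm.ext ((isPerm_permHom _ _).comp (isPerm_permHom _ _)) (isPerm_id _)
      fun _ => Iso.hom_inv_id _)
    (IsPerm.ext ((isPerm_permHom _ _).comp (isPerm_permHom _ _)) (isPerm_id _)
      fun _ => Iso.inv_hom_id _)

noncomputable def leftUnit (X : Mat_ C) : tensorObj (tensorUnit C) X ≅ X :=
  permIso (M := tensorObj (tensorUnit C) X) (N := X)
    (fun x => x.2) (fun x => (λ_ (X.X x.2)).hom) (fun x => (PUnit.unit, x))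
    (fun x => (λ_ (X.X x)).inv)
    (IsPerm.ext ((isPerm_permHom _ _).comp (isPerm_permHom _ _)) (isPerm_id _)
      fun _ => Iso.hom_inv_id _)
    (IsPerm.ext ((isPerm_permHom _ _).comp (isPerm_permHom _ _)) (isPerm_id _)
      fun _ => Iso.inv_hom_id _)

noncomputable def rightUnit (X : Mat_ C) : tensorObj X (tensorUnit C) ≅ X :=
  permIso (M := tensorObj X (tensorUnit C)) (N := X)
    (fun x => x.1) (fun x => (ρ_ (X.X x.1)).hom) (fun x => (x, PUnit.unit))
    (fun x => (ρ_ (X.X x)).inv)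
    (IsPerm.ext ((isPerm_permHom _ _).comp (isPerm_permHom _ _)) (isPerm_id _)
      fun _ => Iso.hom_inv_id _)
    (IsPerm.ext ((isPerm_permHom _ _).comp (isPerm_permHom _ _)) (isPerm_id _)
      fun _ => Iso.inv_hom_id _)

noncomputable instance : MonoidalCategoryStruct (Mat_ C) where
  tensorObj M N := tensorObj M N
  tensorHom f g := tensorHom f g
  whiskerLeft X _ _ f := tensorHom (𝟙 X) f
  whiskerRight f X := tensorHom f (𝟙 X)
  tensorUnit := tensorUnit C
  associator X Y Z := assoc X Y Z
  leftUnitor X := leftUnit X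
  rightUnitor X := rightUnit X

theorem isPerm_assoc (X Y Z : Mat_ C) : IsPerm (assoc X Y Z).hom (fun x => (x.1.1, (x.1.2, x.2)))
    (fun x => (α_ (X.X x.1.1) (Y.X x.1.2) (Z.X x.2)).hom) := isPerm_permHom _ _

theorem isPerm_assoc_inv (X Y Z : Mat_ C) :
    IsPerm (assoc X Y Z).inv (fun x => ((x.1, x.2.1), x.2.2))
      (fun x => (α_ (X.X x.1) (Y.X x.2.1) (Z.X x.2.2)).inv) := isPerm_permHom _ _

theorem isPerm_leftUnit (X : Mat_ C) : IsPerm (leftUnit X).hom (fun x => x.2)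
    (fun x => (λ_ (X.X x.2)).hom) := isPerm_permHom _ _

theorem isPerm_rightUnit (X : Mat_ C) : IsPerm (rightUnit X).hom (fun x => x.1)
    (fun x => (ρ_ (X.X x.1)).hom) := isPerm_permHom _ _

theorem assoc_naturality {X₁ X₂ X₃ Y₁ Y₂ Y₃ : Mat_ C} (f : X₁ ⟶ Y₁) (g : X₂ ⟶ Y₂) (h : X₃ ⟶ Y₃) :
    tensorHom (tensorHom f g) h ≫ (assoc Y₁ Y₂ Y₃).hom =
      (assoc X₁ X₂ X₃).hom ≫ tensorHom f (tensorHom g h) := by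
  ext x ⟨y₁, y₂, y₃⟩
  refine ((isPerm_assoc Y₁ Y₂ Y₃).apply_comp ?_ _ x ((y₁, y₂), y₃)).trans
    (Eq.trans ?_ ((isPerm_assoc X₁ X₂ X₃).comp_apply _ _ _).symm)
  · rintro ⟨⟨a, b⟩, c⟩ ⟨⟨a', b'⟩, c'⟩ h
    simpa [and_assoc] using h
  · exact MonoidalCategory.associator_naturality _ _ _

theorem leftUnit_naturality {X Y : Mat_ C} (f : X ⟶ Y) :
    tensorHom (𝟙 (tensorUnit C)) f ≫ (leftUnit Y).hom = (leftUnit X).hom ≫ f := by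
  ext x y
  refine ((isPerm_leftUnit Y).apply_comp ?_ _ x (PUnit.unit, y)).trans
    (Eq.trans ?_ ((isPerm_leftUnit X).comp_apply _ _ _).symm)
  · rintro ⟨a, b⟩ ⟨a', b'⟩ h
    exact Prod.ext rfl h
  · rw [tensorHom_apply, Mat_.id_apply_self, MonoidalCategory.id_tensorHom]
    exact MonoidalCategory.leftUnitor_naturality _

theorem rightUnit_naturality {X Y : Mat_ C} (f : X ⟶ Y) :
    tensorHom f (𝟙 (tensorUnit C)) ≫ (rightUnit Y).hom = (rightUnit X).hom ≫ f := by
  ext x y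
  refine ((isPerm_rightUnit Y).apply_comp ?_ _ x (y, PUnit.unit)).trans
    (Eq.trans ?_ ((isPerm_rightUnit X).comp_apply _ _ _).symm)
  · rintro ⟨a, b⟩ ⟨a', b'⟩ h
    exact Prod.ext h rfl
  · rw [tensorHom_apply, Mat_.id_apply_self, MonoidalCategory.tensorHom_id]
    exact MonoidalCategory.rightUnitor_naturality _

theorem pentagon (W X Y Z : Mat_ C) :
    tensorHom (assoc W X Y).hom (𝟙 Z) ≫ (assoc W (tensorObj X Y) Z).hom ≫
      tensorHom (𝟙 W) (assoc X Y Z).hom =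
    (assoc (tensorObj W X) Y Z).hom ≫ (assoc W X (tensorObj Y Z)).hom :=
  IsPerm.ext
    (((isPerm_assoc W X Y).tensor (isPerm_id Z)).comp
      ((isPerm_assoc W (tensorObj X Y) Z).comp ((isPerm_id W).tensor (isPerm_assoc X Y Z))))
    ((isPerm_assoc (tensorObj W X) Y Z).comp (isPerm_assoc W X (tensorObj Y Z)))
    (fun x => by
      have := MonoidalCategory.pentagon (W.X x.1.1.1) (X.X x.1.1.2) (Y.X x.1.2) (Z.X x.2)
      rw [← MonoidalCategory.tensorHom_id, ← MonoidalCategory.id_tensorHom] at this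
      exact this)

theorem triangle (X Y : Mat_ C) :
    (assoc X (tensorUnit C) Y).hom ≫ tensorHom (𝟙 X) (leftUnit Y).hom =
      tensorHom (rightUnit X).hom (𝟙 Y) :=
  IsPerm.ext
    ((isPerm_assoc X (tensorUnit C) Y).comp ((isPerm_id X).tensor (isPerm_leftUnit Y)))
    ((isPerm_rightUnit X).tensor (isPerm_id Y))
    (fun x => by
      have := MonoidalCategory.triangle (X.X x.1.1) (Y.X x.2)
      rw [← MonoidalCategory.tensorHom_id, ← MonoidalCategory.id_tensorHom] at this
      exact this)

noncomputable instance : MonoidalCategory (Mat_ C) := MonoidalCategory.ofTensorHom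
  (id_tensorHom_id := tensor_id)
  (id_tensorHom := fun _ _ _ _ => rfl)
  (tensorHom_id := fun _ _ => rfl)
  (tensorHom_comp_tensorHom := fun f₁ f₂ g₁ g₂ => tensor_comp f₁ g₁ f₂ g₂)
  (associator_naturality := assoc_naturality)
  (leftUnitor_naturality := leftUnit_naturality)
  (rightUnitor_naturality := rightUnit_naturality)
  (pentagon := pentagon)
  (triangle := triangle)

section braiding

variable [SymmetricCategory C]

noncomputable def braid (X Y : Mat_ C) : tensorObj X Y ≅ tensorObj Y X :=
  permIso (M := tensorObj X Y) (N := tensorObj Y X)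
    (fun x => (x.2, x.1)) (fun x => (β_ (X.X x.1) (Y.X x.2)).hom)
    (fun x => (x.2, x.1)) (fun x => (β_ (X.X x.2) (Y.X x.1)).inv)
    (IsPerm.ext ((isPerm_permHom _ _).comp (isPerm_permHom _ _)) (isPerm_id _)
      fun _ => Iso.hom_inv_id _)
    (IsPerm.ext ((isPerm_permHom _ _).comp (isPerm_permHom _ _)) (isPerm_id _)
      fun _ => Iso.inv_hom_id _)

theorem isPerm_braid (X Y : Mat_ C) : IsPerm (braid X Y).hom (fun x => (x.2, x.1))
    (fun x => (β_ (X.X x.1) (Y.X x.2)).hom) := isPerm_permHom _ _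

theorem braid_naturality {X Y X' Y' : Mat_ C} (f : X ⟶ Y) (g : X' ⟶ Y') :
    tensorHom f g ≫ (braid Y Y').hom = (braid X X').hom ≫ tensorHom g f := by
  ext x ⟨y, y'⟩
  refine ((isPerm_braid Y Y').apply_comp ?_ _ x (y', y)).trans
    (Eq.trans ?_ ((isPerm_braid X X').comp_apply _ _ _).symm)
  · rintro ⟨a, b⟩ ⟨a', b'⟩ h
    exact Prod.ext (congrArg Prod.snd h) (congrArg Prod.fst h)
  · exact BraidedCategory.braiding_naturality _ _

theorem hexagon_forward (X Y Z : Mat_ C) :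
    (assoc X Y Z).hom ≫ (braid X (tensorObj Y Z)).hom ≫ (assoc Y Z X).hom =
      tensorHom (braid X Y).hom (𝟙 Z) ≫ (assoc Y X Z).hom ≫ tensorHom (𝟙 Y) (braid X Z).hom :=
  IsPerm.ext
    ((isPerm_assoc X Y Z).comp ((isPerm_braid X (tensorObj Y Z)).comp (isPerm_assoc Y Z X)))
    (((isPerm_braid X Y).tensor (isPerm_id Z)).comp
      ((isPerm_assoc Y X Z).comp ((isPerm_id Y).tensor (isPerm_braid X Z))))
    (fun x => by
      have := BraidedCategory.hexagon_forward (X.X x.1.1) (Y.X x.1.2) (Z.X x.2)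
      rw [← MonoidalCategory.tensorHom_id, ← MonoidalCategory.id_tensorHom] at this
      exact this)

theorem hexagon_reverse (X Y Z : Mat_ C) :
    (assoc X Y Z).inv ≫ (braid (tensorObj X Y) Z).hom ≫ (assoc Z X Y).inv =
      tensorHom (𝟙 X) (braid Y Z).hom ≫ (assoc X Z Y).inv ≫ tensorHom (braid X Z).hom (𝟙 Y) :=
  IsPerm.ext
    ((isPerm_assoc_inv X Y Z).comp
      ((isPerm_braid (tensorObj X Y) Z).comp (isPerm_assoc_inv Z X Y)))
    (((isPerm_id X).tensor (isPerm_braid Y Z)).comp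
      ((isPerm_assoc_inv X Z Y).comp ((isPerm_braid X Z).tensor (isPerm_id Y))))
    (fun x => by
      have := BraidedCategory.hexagon_reverse (X.X x.1) (Y.X x.2.1) (Z.X x.2.2)
      rw [← MonoidalCategory.tensorHom_id, ← MonoidalCategory.id_tensorHom] at this
      exact this)

theorem braid_symmetry (X Y : Mat_ C) : (braid X Y).hom ≫ (braid Y X).hom = 𝟙 (tensorObj X Y) :=
  IsPerm.ext ((isPerm_braid X Y).comp (isPerm_braid Y X)) (isPerm_id (tensorObj X Y))
    (fun _ => SymmetricCategory.symmetry _ _)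

noncomputable instance : SymmetricCategory (Mat_ C) where
  braiding X Y := braid X Y
  braiding_naturality_right X _ _ f := braid_naturality (𝟙 X) f
  braiding_naturality_left f Z := braid_naturality f (𝟙 Z)
  hexagon_forward := hexagon_forward
  hexagon_reverse := hexagon_reverse
  symmetry := braid_symmetry

end braiding

section duality

variable [RightRigidCategory C]

/-- The dual object, summand by summand. -/
@[reducible] def dual (X : Mat_ C) : Mat_ C := ⟨X.ι, fun i => (X.X i)ᘁ⟩

open scoped Classical in
/-- The coevaluation: the coevaluations of the summands on the diagonal, zero elsewhere. -/
noncomputable def coev (X : Mat_ C) : tensorUnit C ⟶ tensorObj X (dual X) :=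
  (fun _ x => if h : x.1 = x.2 then
    η_ (X.X x.1) (X.X x.1)ᘁ ≫ (X.X x.1 ◁ eqToHom (congrArg (fun i => (X.X i)ᘁ) h)) else 0 :
    Mat_.Hom (tensorUnit C) (tensorObj X (dual X)))

open scoped Classical in
/-- The evaluation: the evaluations of the summands on the diagonal, zero elsewhere. -/
noncomputable def ev (X : Mat_ C) : tensorObj (dual X) X ⟶ tensorUnit C :=
  (fun x _ => if h : x.1 = x.2 then
    (eqToHom (congrArg (fun i => (X.X i)ᘁ) h) ▷ X.X x.2) ≫ ε_ (X.X x.2) (X.X x.2)ᘁ else 0 :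
    Mat_.Hom (tensorObj (dual X) X) (tensorUnit C))

theorem coev_self (X : Mat_ C) (i : X.ι) :
    (coev X : Mat_.Hom (tensorUnit C) (tensorObj X (dual X))) PUnit.unit (i, i) =
      η_ (X.X i) (X.X i)ᘁ := by
  simp [coev]

theorem coev_ne (X : Mat_ C) {i j : X.ι} (h : i ≠ j) :
    (coev X : Mat_.Hom (tensorUnit C) (tensorObj X (dual X))) PUnit.unit (i, j) = 0 := by
  simp [coev, h]

theorem ev_self (X : Mat_ C) (i : X.ι) :
    (ev X : Mat_.Hom (tensorObj (dual X) X) (tensorUnit C)) (i, i) PUnit.unit =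
      ε_ (X.X i) (X.X i)ᘁ := by
  simp [ev]

theorem ev_ne (X : Mat_ C) {i j : X.ι} (h : i ≠ j) :
    (ev X : Mat_.Hom (tensorObj (dual X) X) (tensorUnit C)) (i, j) PUnit.unit = 0 := by
  simp [ev, h]

theorem isPerm_leftUnit_inv (X : Mat_ C) : IsPerm (leftUnit X).inv (fun x => (PUnit.unit, x))
    (fun x => (λ_ (X.X x)).inv) := isPerm_permHom _ _

theorem isPerm_rightUnit_inv (X : Mat_ C) : IsPerm (rightUnit X).inv (fun x => (x, PUnit.unit))
    (fun x => (ρ_ (X.X x)).inv) := isPerm_permHom _ _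

theorem eval_coev (X : Mat_ C) :
    tensorHom (coev X) (𝟙 X) ≫ (assoc X (dual X) X).hom ≫ tensorHom (𝟙 X) (ev X) =
      (leftUnit X).hom ≫ (rightUnit X).inv := by
  have hR := (isPerm_leftUnit X).comp (isPerm_rightUnit_inv X)
  have hterm : ∀ (i j : X.ι) (z : (X.ι × X.ι) × X.ι),
      (tensorHom (coev X) (𝟙 X) : Mat_.Hom _ _) (PUnit.unit, i) z ≫
        ((assoc X (dual X) X).hom ≫ tensorHom (𝟙 X) (ev X) : Mat_.Hom _ _) z (j, PUnit.unit) =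
      ((coev X : Mat_.Hom _ _) PUnit.unit z.1 ⊗ₘ (𝟙 X : Mat_.Hom X X) i z.2) ≫
        (α_ _ _ _).hom ≫ ((𝟙 X : Mat_.Hom X X) z.1.1 j ⊗ₘ
          (ev X : Mat_.Hom _ _) (z.1.2, z.2) PUnit.unit) := by
    intro i j z
    rw [tensorHom_apply, (isPerm_assoc X (dual X) X).comp_apply]
    rfl
  have hzero : ∀ (i j a b c : X.ι), ¬ (a = b ∧ i = c ∧ a = j ∧ b = c) →
      ((coev X : Mat_.Hom _ _) PUnit.unit (a, b) ⊗ₘ (𝟙 X : Mat_.Hom X X) i c) ≫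
        (α_ _ _ _).hom ≫ ((𝟙 X : Mat_.Hom X X) a j ⊗ₘ
          (ev X : Mat_.Hom _ _) (b, c) PUnit.unit) = 0 := by
    intro i j a b c hn
    by_cases h1 : a = b
    · by_cases h2 : i = c
      · by_cases h3 : a = j
        · rw [ev_ne X (fun h4 => hn ⟨h1, h2, h3, h4⟩), tensor_zero', Limits.comp_zero,
            Limits.comp_zero]
        · rw [Mat_.id_apply_of_ne X a j h3, zero_tensor', Limits.comp_zero, Limits.comp_zero]
      · rw [Mat_.id_apply_of_ne X i c h2, tensor_zero', Limits.zero_comp]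
    · rw [coev_ne X h1, zero_tensor', Limits.zero_comp]
  refine IsPerm.ext (φ := fun x => (λ_ (X.X x.2)).hom ≫ (ρ_ (X.X x.2)).inv) ⟨?_, ?_⟩ hR
    fun _ => rfl
  · rintro ⟨⟨⟩, i⟩
    rw [Mat_.comp_apply, Finset.sum_eq_single ((i, i), i)]
    · refine (hterm i i ((i, i), i)).trans ?_
      rw [coev_self, ev_self, Mat_.id_apply_self, MonoidalCategory.tensorHom_id,
        MonoidalCategory.id_tensorHom]
      exact ExactPairing.evaluation_coevaluation _ _
    · rintro ⟨⟨a, b⟩, c⟩ _ hne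
      refine (hterm i i ((a, b), c)).trans (hzero i i a b c ?_)
      rintro ⟨rfl, rfl, _, rfl⟩
      exact hne rfl
    · simp
  · rintro ⟨⟨⟩, i⟩ ⟨j, ⟨⟩⟩ hij
    rw [Mat_.comp_apply]
    refine Finset.sum_eq_zero ?_
    rintro ⟨⟨a, b⟩, c⟩ _
    refine (hterm i j ((a, b), c)).trans (hzero i j a b c ?_)
    rintro ⟨rfl, rfl, rfl, rfl⟩
    exact hij rfl

theorem coev_eval (X : Mat_ C) :
    tensorHom (𝟙 (dual X)) (coev X) ≫ (assoc (dual X) X (dual X)).inv ≫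
        tensorHom (ev X) (𝟙 (dual X)) =
      (rightUnit (dual X)).hom ≫ (leftUnit (dual X)).inv := by
  have hR := (isPerm_rightUnit (dual X)).comp (isPerm_leftUnit_inv (dual X))
  have hterm : ∀ (i j : X.ι) (z : X.ι × (X.ι × X.ι)),
      (tensorHom (𝟙 (dual X)) (coev X) : Mat_.Hom _ _) (i, PUnit.unit) z ≫
        ((assoc (dual X) X (dual X)).inv ≫ tensorHom (ev X) (𝟙 (dual X)) : Mat_.Hom _ _) z
          (PUnit.unit, j) =
      ((𝟙 (dual X) : Mat_.Hom (dual X) (dual X)) i z.1 ⊗ₘ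
          (coev X : Mat_.Hom _ _) PUnit.unit z.2) ≫
        (α_ _ _ _).inv ≫ ((ev X : Mat_.Hom _ _) (z.1, z.2.1) PUnit.unit ⊗ₘ
          (𝟙 (dual X) : Mat_.Hom (dual X) (dual X)) z.2.2 j) := by
    intro i j z
    rw [tensorHom_apply, (isPerm_assoc_inv (dual X) X (dual X)).comp_apply]
    rfl
  have hzero : ∀ (i j a b c : X.ι), ¬ (i = a ∧ b = c ∧ a = b ∧ c = j) →
      ((𝟙 (dual X) : Mat_.Hom (dual X) (dual X)) i a ⊗ₘ
          (coev X : Mat_.Hom _ _) PUnit.unit (b, c)) ≫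
        (α_ _ _ _).inv ≫ ((ev X : Mat_.Hom _ _) (a, b) PUnit.unit ⊗ₘ
          (𝟙 (dual X) : Mat_.Hom (dual X) (dual X)) c j) = 0 := by
    intro i j a b c hn
    by_cases h1 : i = a
    · by_cases h2 : b = c
      · by_cases h3 : a = b
        · rw [Mat_.id_apply_of_ne (dual X) c j (fun h4 => hn ⟨h1, h2, h3, h4⟩), tensor_zero',
            Limits.comp_zero, Limits.comp_zero]
        · rw [ev_ne X h3, zero_tensor', Limits.comp_zero, Limits.comp_zero]
      · rw [coev_ne X h2, tensor_zero', Limits.zero_comp]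
    · rw [Mat_.id_apply_of_ne (dual X) i a h1, zero_tensor', Limits.zero_comp]
  refine IsPerm.ext (φ := fun x => (ρ_ (X.X x.1)ᘁ).hom ≫ (λ_ (X.X x.1)ᘁ).inv) ⟨?_, ?_⟩ hR
    fun _ => rfl
  · rintro ⟨i, ⟨⟩⟩
    rw [Mat_.comp_apply, Finset.sum_eq_single (i, (i, i))]
    · refine (hterm i i (i, (i, i))).trans ?_
      rw [coev_self, ev_self, Mat_.id_apply_self, MonoidalCategory.tensorHom_id,
        MonoidalCategory.id_tensorHom]
      exact ExactPairing.coevaluation_evaluation _ _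
    · rintro ⟨a, b, c⟩ _ hne
      refine (hterm i i (a, (b, c))).trans (hzero i i a b c ?_)
      rintro ⟨rfl, rfl, rfl, _⟩
      exact hne rfl
    · simp
  · rintro ⟨i, ⟨⟩⟩ ⟨⟨⟩, j⟩ hij
    rw [Mat_.comp_apply]
    refine Finset.sum_eq_zero ?_
    rintro ⟨a, b, c⟩ _
    refine (hterm i j (a, (b, c))).trans (hzero i j a b c ?_)
    rintro ⟨rfl, rfl, rfl, rfl⟩
    exact hij rfl

noncomputable instance : RightRigidCategory (Mat_ C) where
  rightDual X :=
    { rightDual := dual X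
      exact :=
        { coevaluation' := coev X
          evaluation' := ev X
          coevaluation_evaluation' := coev_eval X
          evaluation_coevaluation' := eval_coev X } }

end duality

end MatEnv

namespace KarEnv

open Idempotents

variable {C : Type u} [Category.{v} C]

section linear

variable [Preadditive C] (R : Type w) [Semiring R] [Linear R C]

instance (P Q : Karoubi C) : SMul R (P ⟶ Q) where
  smul r f := ⟨r • f.f, by rw [Linear.smul_comp, Linear.comp_smul, f.comm]⟩

instance : Linear R (Karoubi C) where
  homModule P Q := Function.Injective.module R (Karoubi.inclusionHom P Q)
    (fun _ _ h => Karoubi.hom_ext _ _ h) (fun _ _ => rfl)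
  smul_comp _ _ _ r f g := Karoubi.hom_ext _ _ (Linear.smul_comp _ _ _ r f.f g.f)
  comp_smul _ _ _ f r g := Karoubi.hom_ext _ _ (Linear.comp_smul _ _ _ f.f r g.f)

end linear

/-- `φ` is the restriction to the direct factors of a morphism `f` commuting with the
idempotents. -/
def IsCut {P Q : Karoubi C} (φ : P ⟶ Q) (f : P.X ⟶ Q.X) : Prop :=
  φ.f = P.p ≫ f ∧ P.p ≫ f = f ≫ Q.p

def cut {P Q : Karoubi C} (f : P.X ⟶ Q.X) (h : P.p ≫ f = f ≫ Q.p) : P ⟶ Q :=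
  ⟨P.p ≫ f, by rw [Category.assoc, ← h, ← Category.assoc, ← Category.assoc, P.idem, P.idem]⟩

theorem isCut_cut {P Q : Karoubi C} (f : P.X ⟶ Q.X) (h : P.p ≫ f = f ≫ Q.p) :
    IsCut (cut f h : P ⟶ Q) f := ⟨rfl, h⟩

theorem isCut_self {P Q : Karoubi C} (φ : P ⟶ Q) : IsCut φ φ.f :=
  ⟨(Karoubi.p_comp φ).symm, Karoubi.p_comm φ⟩

theorem isCut_id (P : Karoubi C) : IsCut (𝟙 P) (𝟙 P.X) :=
  ⟨(Category.comp_id _).symm, by rw [Category.comp_id, Category.id_comp]⟩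

theorem IsCut.ext {P Q : Karoubi C} {φ ψ : P ⟶ Q} {f g : P.X ⟶ Q.X} (h : IsCut φ f)
    (h' : IsCut ψ g) (hfg : f = g) : φ = ψ := by
  subst hfg
  exact Karoubi.hom_ext _ _ (h.1.trans h'.1.symm)

theorem IsCut.comp {P Q K : Karoubi C} {φ : P ⟶ Q} {ψ : Q ⟶ K} {f : P.X ⟶ Q.X} {g : Q.X ⟶ K.X}
    (h : IsCut φ f) (h' : IsCut ψ g) : IsCut (φ ≫ ψ) (f ≫ g) := by
  constructor
  · rw [Karoubi.comp_f, h.1, h'.1, h'.2, Category.assoc, ← Category.assoc f g, Category.assoc f g,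
      ← h'.2, ← Category.assoc f, ← h.2, Category.assoc, ← Category.assoc P.p P.p, P.idem]
  · rw [← Category.assoc, h.2, Category.assoc, h'.2, Category.assoc]

theorem cut_inv {P Q : Karoubi C} (e : P.X ≅ Q.X) (h : P.p ≫ e.hom = e.hom ≫ Q.p) :
    Q.p ≫ e.inv = e.inv ≫ P.p := by
  rw [Iso.comp_inv_eq, Category.assoc, h, Iso.inv_hom_id_assoc]

/-- The isomorphism obtained by restricting an isomorphism commuting with the idempotents. -/
def cutIso {P Q : Karoubi C} (e : P.X ≅ Q.X) (h : P.p ≫ e.hom = e.hom ≫ Q.p) : P ≅ Q where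
  hom := cut e.hom h
  inv := cut e.inv (cut_inv e h)
  hom_inv_id := ((isCut_cut _ _).comp (isCut_cut _ _)).ext (isCut_id P) e.hom_inv_id
  inv_hom_id := ((isCut_cut _ _).comp (isCut_cut _ _)).ext (isCut_id Q) e.inv_hom_id

theorem isCut_hom {P Q : Karoubi C} (e : P.X ≅ Q.X) (h : P.p ≫ e.hom = e.hom ≫ Q.p) :
    IsCut (cutIso e h).hom e.hom := isCut_cut e.hom h

theorem isCut_inv {P Q : Karoubi C} (e : P.X ≅ Q.X) (h : P.p ≫ e.hom = e.hom ≫ Q.p) :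
    IsCut (cutIso e h).inv e.inv := isCut_cut e.inv (cut_inv e h)

variable [MonoidalCategory C]

@[reducible] def tensorObj (P Q : Karoubi C) : Karoubi C :=
  ⟨P.X ⊗ Q.X, P.p ⊗ₘ Q.p, by rw [MonoidalCategory.tensorHom_comp_tensorHom, P.idem, Q.idem]⟩

def tensorHom {P Q P' Q' : Karoubi C} (f : P ⟶ Q) (g : P' ⟶ Q') :
    tensorObj P P' ⟶ tensorObj Q Q' :=
  ⟨f.f ⊗ₘ g.f, by rw [MonoidalCategory.tensorHom_comp_tensorHom,
    MonoidalCategory.tensorHom_comp_tensorHom, f.comm, g.comm]⟩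

theorem IsCut.tensor {P Q P' Q' : Karoubi C} {φ : P ⟶ Q} {ψ : P' ⟶ Q'} {f : P.X ⟶ Q.X}
    {g : P'.X ⟶ Q'.X} (h : IsCut φ f) (h' : IsCut ψ g) : IsCut (tensorHom φ ψ) (f ⊗ₘ g) := by
  constructor
  · change φ.f ⊗ₘ ψ.f = (P.p ⊗ₘ P'.p) ≫ (f ⊗ₘ g)
    rw [MonoidalCategory.tensorHom_comp_tensorHom, h.1, h'.1]
  · change (P.p ⊗ₘ P'.p) ≫ (f ⊗ₘ g) = (f ⊗ₘ g) ≫ (Q.p ⊗ₘ Q'.p)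
    rw [MonoidalCategory.tensorHom_comp_tensorHom, MonoidalCategory.tensorHom_comp_tensorHom,
      h.2, h'.2]

@[reducible] def tensorUnit (C : Type u) [Category.{v} C] [MonoidalCategory C] : Karoubi C :=
  ⟨𝟙_ C, 𝟙 _, Category.comp_id _⟩

def assoc (P Q K : Karoubi C) : tensorObj (tensorObj P Q) K ≅ tensorObj P (tensorObj Q K) :=
  cutIso (P := tensorObj (tensorObj P Q) K) (Q := tensorObj P (tensorObj Q K))
    (α_ P.X Q.X K.X) (MonoidalCategory.associator_naturality _ _ _)

def leftUnit (P : Karoubi C) : tensorObj (tensorUnit C) P ≅ P :=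
  cutIso (P := tensorObj (tensorUnit C) P) (Q := P) (λ_ P.X) (by
    change (𝟙 _ ⊗ₘ P.p) ≫ _ = _
    rw [MonoidalCategory.id_tensorHom, MonoidalCategory.leftUnitor_naturality])

def rightUnit (P : Karoubi C) : tensorObj P (tensorUnit C) ≅ P :=
  cutIso (P := tensorObj P (tensorUnit C)) (Q := P) (ρ_ P.X) (by
    change (P.p ⊗ₘ 𝟙 _) ≫ _ = _
    rw [MonoidalCategory.tensorHom_id, MonoidalCategory.rightUnitor_naturality])

theorem isCut_assoc (P Q K : Karoubi C) : IsCut (assoc P Q K).hom (α_ P.X Q.X K.X).hom :=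
  isCut_hom _ _

theorem isCut_assoc_inv (P Q K : Karoubi C) : IsCut (assoc P Q K).inv (α_ P.X Q.X K.X).inv :=
  isCut_inv _ _

theorem isCut_leftUnit (P : Karoubi C) : IsCut (leftUnit P).hom (λ_ P.X).hom := isCut_hom _ _

theorem isCut_leftUnit_inv (P : Karoubi C) : IsCut (leftUnit P).inv (λ_ P.X).inv := isCut_inv _ _

theorem isCut_rightUnit (P : Karoubi C) : IsCut (rightUnit P).hom (ρ_ P.X).hom := isCut_hom _ _

theorem isCut_rightUnit_inv (P : Karoubi C) : IsCut (rightUnit P).inv (ρ_ P.X).inv :=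
  isCut_inv _ _

instance : MonoidalCategoryStruct (Karoubi C) where
  tensorObj P Q := tensorObj P Q
  tensorHom f g := tensorHom f g
  whiskerLeft P _ _ f := tensorHom (𝟙 P) f
  whiskerRight f P := tensorHom f (𝟙 P)
  tensorUnit := tensorUnit C
  associator P Q K := assoc P Q K
  leftUnitor P := leftUnit P
  rightUnitor P := rightUnit P

instance : MonoidalCategory (Karoubi C) := MonoidalCategory.ofTensorHom
  (id_tensorHom_id := fun P Q =>
    ((isCut_id P).tensor (isCut_id Q)).ext (isCut_id (tensorObj P Q))
      (MonoidalCategory.id_tensorHom_id _ _))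
  (id_tensorHom := fun _ _ _ _ => rfl)
  (tensorHom_id := fun _ _ => rfl)
  (tensorHom_comp_tensorHom := fun f₁ f₂ g₁ g₂ =>
    (((isCut_self f₁).tensor (isCut_self f₂)).comp ((isCut_self g₁).tensor (isCut_self g₂))).ext
      (((isCut_self f₁).comp (isCut_self g₁)).tensor ((isCut_self f₂).comp (isCut_self g₂)))
      (MonoidalCategory.tensorHom_comp_tensorHom _ _ _ _))
  (associator_naturality := fun {X₁ X₂ X₃ Y₁ Y₂ Y₃} f g h =>
    ((((isCut_self f).tensor (isCut_self g)).tensor (isCut_self h)).comp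
      (isCut_assoc Y₁ Y₂ Y₃)).ext
      ((isCut_assoc X₁ X₂ X₃).comp ((isCut_self f).tensor ((isCut_self g).tensor (isCut_self h))))
      (MonoidalCategory.associator_naturality _ _ _))
  (leftUnitor_naturality := fun {X Y} f =>
    (((isCut_id (tensorUnit C)).tensor (isCut_self f)).comp (isCut_leftUnit Y)).ext
      ((isCut_leftUnit X).comp (isCut_self f)) (by
        rw [MonoidalCategory.id_tensorHom]
        exact MonoidalCategory.leftUnitor_naturality _))
  (rightUnitor_naturality := fun {X Y} f =>
    (((isCut_self f).tensor (isCut_id (tensorUnit C))).comp (isCut_rightUnit Y)).ext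
      ((isCut_rightUnit X).comp (isCut_self f)) (by
        rw [MonoidalCategory.tensorHom_id]
        exact MonoidalCategory.rightUnitor_naturality _))
  (pentagon := fun W X Y Z =>
    (((isCut_assoc W X Y).tensor (isCut_id Z)).comp
      ((isCut_assoc W (tensorObj X Y) Z).comp ((isCut_id W).tensor (isCut_assoc X Y Z)))).ext
      ((isCut_assoc (tensorObj W X) Y Z).comp (isCut_assoc W X (tensorObj Y Z))) (by
        rw [MonoidalCategory.tensorHom_id, MonoidalCategory.id_tensorHom]
        exact MonoidalCategory.pentagon _ _ _ _))
  (triangle := fun X Y =>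
    ((isCut_assoc X (tensorUnit C) Y).comp ((isCut_id X).tensor (isCut_leftUnit Y))).ext
      ((isCut_rightUnit X).tensor (isCut_id Y)) (by
        rw [MonoidalCategory.tensorHom_id, MonoidalCategory.id_tensorHom]
        exact MonoidalCategory.triangle _ _))

section braiding

variable [SymmetricCategory C]

def braid (P Q : Karoubi C) : tensorObj P Q ≅ tensorObj Q P :=
  cutIso (P := tensorObj P Q) (Q := tensorObj Q P) (β_ P.X Q.X)
    (BraidedCategory.braiding_naturality _ _)

theorem isCut_braid (P Q : Karoubi C) : IsCut (braid P Q).hom (β_ P.X Q.X).hom := isCut_hom _ _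

theorem braid_naturality {X Y X' Y' : Karoubi C} (f : X ⟶ Y) (g : X' ⟶ Y') :
    tensorHom f g ≫ (braid Y Y').hom = (braid X X').hom ≫ tensorHom g f :=
  (((isCut_self f).tensor (isCut_self g)).comp (isCut_braid Y Y')).ext
    ((isCut_braid X X').comp ((isCut_self g).tensor (isCut_self f)))
    (BraidedCategory.braiding_naturality _ _)

instance : SymmetricCategory (Karoubi C) where
  braiding P Q := braid P Q
  braiding_naturality_right X _ _ f := braid_naturality (𝟙 X) f
  braiding_naturality_left f Z := braid_naturality f (𝟙 Z)
  hexagon_forward X Y Z :=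
    ((isCut_assoc X Y Z).comp ((isCut_braid X (tensorObj Y Z)).comp (isCut_assoc Y Z X))).ext
      (((isCut_braid X Y).tensor (isCut_id Z)).comp
        ((isCut_assoc Y X Z).comp ((isCut_id Y).tensor (isCut_braid X Z)))) (by
        rw [MonoidalCategory.tensorHom_id, MonoidalCategory.id_tensorHom]
        exact BraidedCategory.hexagon_forward _ _ _)
  hexagon_reverse X Y Z :=
    ((isCut_assoc_inv X Y Z).comp
      ((isCut_braid (tensorObj X Y) Z).comp (isCut_assoc_inv Z X Y))).ext
      (((isCut_id X).tensor (isCut_braid Y Z)).comp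
        ((isCut_assoc_inv X Z Y).comp ((isCut_braid X Z).tensor (isCut_id Y)))) (by
        rw [MonoidalCategory.tensorHom_id, MonoidalCategory.id_tensorHom]
        exact BraidedCategory.hexagon_reverse _ _ _)
  symmetry X Y :=
    ((isCut_braid X Y).comp (isCut_braid Y X)).ext (isCut_id (tensorObj X Y))
      (SymmetricCategory.symmetry _ _)

end braiding

section duality

variable [RightRigidCategory C]

/-- The dual of `(X, p)` is `(Xᘁ, pᘁ)`. -/
@[reducible] def dual (P : Karoubi C) : Karoubi C :=
  ⟨P.Xᘁ, P.pᘁ, by rw [← comp_rightAdjointMate, P.idem]⟩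

def coev (P : Karoubi C) : tensorUnit C ⟶ tensorObj P (dual P) :=
  ⟨η_ P.X P.Xᘁ ≫ (P.p ⊗ₘ P.pᘁ), by
    change 𝟙 _ ≫ (η_ P.X P.Xᘁ ≫ (P.p ⊗ₘ P.pᘁ)) ≫ (P.p ⊗ₘ P.pᘁ) = _
    rw [Category.id_comp, Category.assoc, MonoidalCategory.tensorHom_comp_tensorHom, P.idem,
      ← comp_rightAdjointMate, P.idem]⟩

def ev (P : Karoubi C) : tensorObj (dual P) P ⟶ tensorUnit C :=
  ⟨(P.pᘁ ⊗ₘ P.p) ≫ ε_ P.X P.Xᘁ, by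
    change (P.pᘁ ⊗ₘ P.p) ≫ ((P.pᘁ ⊗ₘ P.p) ≫ ε_ P.X P.Xᘁ) ≫ 𝟙 _ = _
    rw [Category.comp_id, ← Category.assoc, MonoidalCategory.tensorHom_comp_tensorHom, P.idem,
      ← comp_rightAdjointMate, P.idem]⟩

theorem coev_f (P : Karoubi C) : (coev P).f = η_ P.X P.Xᘁ ≫ P.p ▷ P.Xᘁ := by
  change η_ P.X P.Xᘁ ≫ (P.p ⊗ₘ P.pᘁ) = _
  rw [MonoidalCategory.tensorHom_def', coevaluation_comp_rightAdjointMate_assoc,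
    ← MonoidalCategory.comp_whiskerRight, P.idem]

theorem coev_f' (P : Karoubi C) : (coev P).f = η_ P.X P.Xᘁ ≫ P.X ◁ P.pᘁ := by
  rw [coev_f, coevaluation_comp_rightAdjointMate]

theorem ev_f (P : Karoubi C) : (ev P).f = P.Xᘁ ◁ P.p ≫ ε_ P.X P.Xᘁ := by
  change (P.pᘁ ⊗ₘ P.p) ≫ ε_ P.X P.Xᘁ = _
  rw [MonoidalCategory.tensorHom_def', Category.assoc, rightAdjointMate_comp_evaluation,
    ← Category.assoc, ← MonoidalCategory.whiskerLeft_comp, P.idem]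

theorem ev_f' (P : Karoubi C) : (ev P).f = P.pᘁ ▷ P.X ≫ ε_ P.X P.Xᘁ := by
  rw [ev_f, rightAdjointMate_comp_evaluation]

theorem coev_eval (P : Karoubi C) :
    tensorHom (𝟙 (dual P)) (coev P) ≫ (assoc (dual P) P (dual P)).inv ≫
        tensorHom (ev P) (𝟙 (dual P)) =
      (rightUnit (dual P)).hom ≫ (leftUnit (dual P)).inv := by
  refine Karoubi.hom_ext _ _ ?_
  refine (((isCut_id (dual P)).tensor (isCut_self (coev P))).comp
    ((isCut_assoc_inv (dual P) P (dual P)).comp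
      ((isCut_self (ev P)).tensor (isCut_id (dual P))))).1.trans
    (Eq.trans ?_ ((isCut_rightUnit (dual P)).comp (isCut_leftUnit_inv (dual P))).1.symm)
  change (P.pᘁ ⊗ₘ 𝟙 (𝟙_ C)) ≫ (𝟙 P.Xᘁ ⊗ₘ (coev P).f) ≫ (α_ _ _ _).inv ≫
    ((ev P).f ⊗ₘ 𝟙 P.Xᘁ) = (P.pᘁ ⊗ₘ 𝟙 (𝟙_ C)) ≫ (ρ_ P.Xᘁ).hom ≫ (λ_ P.Xᘁ).inv
  have hq : P.pᘁ ≫ P.pᘁ = P.pᘁ := by rw [← comp_rightAdjointMate, P.idem]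
  have h := ExactPairing.coevaluation_evaluation P.X P.Xᘁ
  rw [coev_f', ev_f', MonoidalCategory.tensorHom_id, MonoidalCategory.tensorHom_id,
    MonoidalCategory.id_tensorHom]
  generalize P.pᘁ = q at *
  calc q ▷ 𝟙_ C ≫ P.Xᘁ ◁ (η_ P.X P.Xᘁ ≫ P.X ◁ q) ≫ (α_ _ _ _).inv ≫
        (q ▷ P.X ≫ ε_ P.X P.Xᘁ) ▷ P.Xᘁ
      = q ▷ 𝟙_ C ≫ (P.Xᘁ ◁ η_ P.X P.Xᘁ ≫ q ▷ (P.X ⊗ P.Xᘁ)) ≫ (α_ _ _ _).inv ≫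
        ((P.Xᘁ ⊗ P.X) ◁ q ≫ ε_ P.X P.Xᘁ ▷ P.Xᘁ) := by
          have key : P.Xᘁ ◁ P.X ◁ q ≫ (α_ _ _ _).inv ≫ (q ▷ P.X) ▷ P.Xᘁ =
              q ▷ (P.X ⊗ P.Xᘁ) ≫ (α_ _ _ _).inv ≫ (P.Xᘁ ⊗ P.X) ◁ q := by
            rw [associator_inv_naturality_right_assoc, MonoidalCategory.whisker_exchange,
              ← associator_inv_naturality_left_assoc]
          simp only [MonoidalCategory.whiskerLeft_comp, MonoidalCategory.comp_whiskerRight,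
            Category.assoc]
          rw [← reassoc_of% key]
    _ = (q ≫ q) ▷ 𝟙_ C ≫ (P.Xᘁ ◁ η_ P.X P.Xᘁ ≫ (α_ _ _ _).inv ≫ ε_ P.X P.Xᘁ ▷ P.Xᘁ) ≫
        𝟙_ C ◁ q := by
          rw [MonoidalCategory.whisker_exchange, MonoidalCategory.whisker_exchange]
          simp
    _ = (q ≫ q ≫ q) ▷ 𝟙_ C ≫ (ρ_ P.Xᘁ).hom ≫ (λ_ P.Xᘁ).inv := by
          rw [h]; simp
    _ = _ := by rw [hq, hq]

theorem eval_coev (P : Karoubi C) :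
    tensorHom (coev P) (𝟙 P) ≫ (assoc P (dual P) P).hom ≫ tensorHom (𝟙 P) (ev P) =
      (leftUnit P).hom ≫ (rightUnit P).inv := by
  refine Karoubi.hom_ext _ _ ?_
  refine (((isCut_self (coev P)).tensor (isCut_id P)).comp
    ((isCut_assoc P (dual P) P).comp ((isCut_id P).tensor (isCut_self (ev P))))).1.trans
    (Eq.trans ?_ ((isCut_leftUnit P).comp (isCut_rightUnit_inv P)).1.symm)
  change (𝟙 (𝟙_ C) ⊗ₘ P.p) ≫ ((coev P).f ⊗ₘ 𝟙 P.X) ≫ (α_ _ _ _).hom ≫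
    (𝟙 P.X ⊗ₘ (ev P).f) = (𝟙 (𝟙_ C) ⊗ₘ P.p) ≫ (λ_ P.X).hom ≫ (ρ_ P.X).inv
  have hq : P.p ≫ P.p = P.p := P.idem
  have h := ExactPairing.evaluation_coevaluation P.X P.Xᘁ
  rw [coev_f, ev_f, MonoidalCategory.tensorHom_id, MonoidalCategory.id_tensorHom,
    MonoidalCategory.id_tensorHom]
  generalize P.p = q at *
  calc 𝟙_ C ◁ q ≫ (η_ P.X P.Xᘁ ≫ q ▷ P.Xᘁ) ▷ P.X ≫ (α_ _ _ _).hom ≫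
        P.X ◁ (P.Xᘁ ◁ q ≫ ε_ P.X P.Xᘁ)
      = 𝟙_ C ◁ q ≫ (η_ P.X P.Xᘁ ▷ P.X ≫ (P.X ⊗ P.Xᘁ) ◁ q) ≫ (α_ _ _ _).hom ≫
        (q ▷ (P.Xᘁ ⊗ P.X) ≫ P.X ◁ ε_ P.X P.Xᘁ) := by
          have key : (q ▷ P.Xᘁ) ▷ P.X ≫ (α_ _ _ _).hom ≫ P.X ◁ P.Xᘁ ◁ q =
              (P.X ⊗ P.Xᘁ) ◁ q ≫ (α_ _ _ _).hom ≫ q ▷ (P.Xᘁ ⊗ P.X) := by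
            rw [associator_naturality_left_assoc, ← MonoidalCategory.whisker_exchange,
              ← associator_naturality_right_assoc]
          simp only [MonoidalCategory.whiskerLeft_comp, MonoidalCategory.comp_whiskerRight,
            Category.assoc]
          rw [reassoc_of% key]
    _ = 𝟙_ C ◁ (q ≫ q) ≫ (η_ P.X P.Xᘁ ▷ P.X ≫ (α_ _ _ _).hom ≫ P.X ◁ ε_ P.X P.Xᘁ) ≫
        q ▷ 𝟙_ C := by
          rw [← MonoidalCategory.whisker_exchange, ← MonoidalCategory.whisker_exchange]
          simp
    _ = 𝟙_ C ◁ (q ≫ q ≫ q) ≫ (λ_ P.X).hom ≫ (ρ_ P.X).inv := by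
          rw [h]; simp
    _ = _ := by rw [hq, hq]

instance : RightRigidCategory (Karoubi C) where
  rightDual P :=
    { rightDual := dual P
      exact :=
        { coevaluation' := coev P
          evaluation' := ev P
          coevaluation_evaluation' := coev_eval P
          evaluation_coevaluation' := eval_coev P } }

end duality

end KarEnv

/-- A twist on a braided category with duality; together they form a ribbon category. -/
class RibbonTwist (C : Type u) [Category.{v} C] [MonoidalCategory C] [BraidedCategory C]
    [RightRigidCategory C] where
  twist : ∀ V : C, V ≅ V
  twist_natural : ∀ {V W : C} (f : V ⟶ W), f ≫ (twist W).hom = (twist V).hom ≫ f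
  twist_tensor : ∀ V W : C, (twist (V ⊗ W)).hom =
    (β_ V W).hom ≫ (β_ W V).hom ≫ ((twist V).hom ⊗ₘ (twist W).hom)
  twist_dual : ∀ V : C, (twist Vᘁ).hom = (twist V).homᘁ

section ribbon

variable {C : Type u} [Category.{v} C] [MonoidalCategory C] [BraidedCategory C]
  [RightRigidCategory C] [RibbonTwist C]

/-- The morphism `ev'_W : W ⊗ W* ⟶ 𝟙`, that is `ev_W ∘ c_{W,W*} ∘ (θ_W ⊗ id)`. -/
def evPrime (W : C) : W ⊗ Wᘁ ⟶ 𝟙_ C :=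
  (RibbonTwist.twist W).hom ▷ Wᘁ ≫ (β_ W Wᘁ).hom ≫ ε_ W Wᘁ

/-- The right partial trace `(id_V ⊗ ev'_W) ∘ (f ⊗ id_{W*}) ∘ (id_V ⊗ coev_W)` of an endomorphism
`f` of `V ⊗ W`. -/
def trR {V W : C} (f : V ⊗ W ⟶ V ⊗ W) : V ⟶ V :=
  (ρ_ V).inv ≫ V ◁ η_ W Wᘁ ≫ (α_ V W Wᘁ).inv ≫ f ▷ Wᘁ ≫ (α_ V W Wᘁ).hom ≫
    V ◁ evPrime W ≫ (ρ_ V).hom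

end ribbon

/-- An ideal: a full subcategory (given by its objects) closed under tensoring with arbitrary
objects on the right and under retracts. -/
structure ObjIdeal (C : Type u) [Category.{v} C] [MonoidalCategory C] where
  mem : C → Prop
  tensor_mem : ∀ {V : C}, mem V → ∀ W : C, mem (V ⊗ W)
  retract_mem : ∀ {V W : C} (f : W ⟶ V) (g : V ⟶ W), f ≫ g = 𝟙 W → mem V → mem W

/-- The ideal `I_J` of all retracts of objects `J ⊗ X`. -/
def idealOf {C : Type u} [Category.{v} C] [MonoidalCategory C] (J : C) : ObjIdeal C where
  mem V := ∃ (X : C) (f : V ⟶ J ⊗ X) (g : J ⊗ X ⟶ V), f ≫ g = 𝟙 V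
  tensor_mem := by
    rintro V ⟨X, f, g, h⟩ W
    refine ⟨X ⊗ W, f ▷ W ≫ (α_ J X W).hom, (α_ J X W).inv ≫ g ▷ W, ?_⟩
    rw [Category.assoc, Iso.hom_inv_id_assoc, ← comp_whiskerRight, h, id_whiskerRight]
  retract_mem := by
    rintro V W f g h ⟨X, f', g', h'⟩
    refine ⟨X, f ≫ f', g' ≫ g, ?_⟩
    rw [Category.assoc, reassoc_of% h', h]

theorem mem_idealOf {C : Type u} [Category.{v} C] [MonoidalCategory C] (J : C) :
    (idealOf J).mem J :=
  ⟨𝟙_ C, (ρ_ J).inv, (ρ_ J).hom, Iso.inv_hom_id _⟩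

/-- A (modified) trace on an ideal of a `K`-linear ribbon category. -/
@[ext]
structure ModTrace (K : Type w) [Field K] {C : Type u} [Category.{v} C] [Preadditive C]
    [Linear K C] [MonoidalCategory C] [BraidedCategory C] [RightRigidCategory C] [RibbonTwist C]
    (I : ObjIdeal C) where
  app : ∀ V : C, I.mem V → ((V ⟶ V) →ₗ[K] K)
  app_tensor : ∀ {U : C} (hU : I.mem U) (W : C) (f : U ⊗ W ⟶ U ⊗ W),
    app (U ⊗ W) (I.tensor_mem hU W) f = app U hU (trR f)
  app_comm : ∀ {U V : C} (hU : I.mem U) (hV : I.mem V) (f : V ⟶ U) (g : U ⟶ V),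
    app V hV (f ≫ g) = app U hU (g ≫ f)

/-- The modified dimension `d_t(V) = t_V(id_V)`. -/
def ModTrace.dim {K : Type w} [Field K] {C : Type u} [Category.{v} C] [Preadditive C]
    [Linear K C] [MonoidalCategory C] [BraidedCategory C] [RightRigidCategory C] [RibbonTwist C]
    {I : ObjIdeal C} (tr : ModTrace K I) (V : C) (hV : I.mem V) : K :=
  tr.app V hV (𝟙 V)

/-- Deligne's category `Rep(S_t; F)`: the Karoubi envelope of the additive envelope of the
category of partition diagrams. -/
abbrev RepS (F : Type u) [Field F] (t : F) : Type (max 1 u) :=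
  Idempotents.Karoubi (Mat_ (RepZero F t))

/-- The braiding of `Rep(S_t; F)` is symmetric and its twist is the identity. -/
noncomputable instance (F : Type u) [Field F] (t : F) : RibbonTwist (RepS F t) where
  twist V := Iso.refl V
  twist_natural f := by rw [Iso.refl_hom, Iso.refl_hom, Category.comp_id, Category.id_comp]
  twist_tensor V W := by
    rw [Iso.refl_hom, Iso.refl_hom, Iso.refl_hom, id_tensorHom_id, Category.comp_id,
      SymmetricCategory.symmetry]
  twist_dual V := by rw [Iso.refl_hom, Iso.refl_hom, rightAdjointMate_id]

/-- The object `([n], e)` of `Rep(S_t; F)` for an idempotent `e` of the partition algebra. -/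
noncomputable def RepS.ofIdem {F : Type u} [Field F] {t : F} {X : RepZero F t} (e : X ⟶ X)
    (he : e ≫ e = e) : RepS F t :=
  ⟨(Mat_.embedding (RepZero F t)).obj X, (Mat_.embedding (RepZero F t)).map e, by
    rw [← Functor.map_comp, he]⟩

/-- Primitive idempotents: nonzero idempotents that are not a sum of two nonzero orthogonal
idempotents. -/
def IsPrimitiveIdem {C : Type u} [Category.{v} C] [Preadditive C] {X : C} (e : X ⟶ X) : Prop :=
  e ≫ e = e ∧ e ≠ 0 ∧ ∀ a b : X ⟶ X, a ≫ a = a → b ≫ b = b → a ≫ b = 0 → b ≫ a = 0 →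
    a + b = e → a = 0 ∨ b = 0

/-- The linear projection `F P_n → F S_n` (an algebra map for the product `f g = f ∘ g`) that kills
all diagrams that are not permutations. -/
noncomputable def permPart {F : Type u} [Field F] {n : ℕ}
    (f : Diagram (Fin n) (Fin n) →₀ F) : MonoidAlgebra F (Equiv.Perm (Fin n)) :=
  ∑ σ : Equiv.Perm (Fin n), MonoidAlgebra.single σ (f (Diagram.ofEquiv σ))

/-- The Young symmetrizer of a tableau `T` of shape `lam`: the sum of the row stabiliser times the
signed sum of the column stabiliser. The left ideal that it generates is the Specht module. -/
noncomputable def youngSymmetrizer (F : Type u) [Field F] {n : ℕ} {lam : YoungDiagram}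
    (T : Fin n ≃ lam.cells) : MonoidAlgebra F (Equiv.Perm (Fin n)) :=
  (∑ p : {p : Equiv.Perm (Fin n) // ∀ i, (T (p i)).1.1 = (T i).1.1},
      MonoidAlgebra.single p.1 1) *
    ∑ q : {q : Equiv.Perm (Fin n) // ∀ i, (T (q i)).1.2 = (T i).1.2},
      MonoidAlgebra.single q.1 ((Equiv.Perm.sign q.1 : ℤ) : F)

/-- `X` is isomorphic to the indecomposable object `L(lam)`, `n = |lam|`: it is isomorphic to
`([n], e)` for a primitive idempotent `e` of the partition algebra `F P_n(t)` whose image in `F S_n`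
does not annihilate the Specht module of `lam` (so that the image is a primitive idempotent that
belongs to `lam`). -/
def IsL {F : Type u} [Field F] {t : F} (lam : YoungDiagram) (X : RepS F t) : Prop :=
  ∃ (n : ℕ) (T : Fin n ≃ lam.cells)
    (e : (RepZero.of (Fin n) : RepZero F t) ⟶ RepZero.of (Fin n)) (he : IsPrimitiveIdem e),
    (∃ x, permPart e * x * youngSymmetrizer F T ≠ 0) ∧ Nonempty (X ≅ RepS.ofIdem e he.1)

/-- The Young diagram `(1^n)` of a column of `n` boxes. -/
def columnDiagram (n : ℕ) : YoungDiagram :=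
  YoungDiagram.ofRowLens (List.replicate n 1)
    (List.pairwise_replicate_of_refl (R := (· ≥ ·))).sortedGE

end Deligne

/-! For generic `t` the categorical trace of a diagram `p : [n] ⟶ [n]` is `t ^ c`, where `c` is the
number of components of the closure of `p` (each top vertex glued to its bottom copy). If `n > 0`
then `c ≥ 1`, so this trace vanishes at `t = 0`. Dividing it by `t` before setting `t = 0` leaves
the functional that is `1` on diagrams with connected closure and `0` on all others (`connTrace`).

Existence. Cyclicity and compatibility with partial traces are statements about component counts.
Diagrams act on two-colourings of vertices, and the matrix of a scaled diagram has trace `2 ^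
comps`, so both statements follow from the same facts about matrices (`comps_comp_comm`,
`comps_ptr`). The functional extends to Deligne's category by summing diagonal matrix entries
(`diagTrace`) and cutting down along retracts (`cutTrace_eq`). It behaves well only on objects built
from nonempty sets. That suffices, since every `J ⊗ X` is of this kind when `J` is.

Uniqueness. A trace on the ideal of `J` is determined by its values on `End J`
(`ModTrace.ext_of_generator`). Here `J` is `[1]`, and `End [1]` is spanned by the identity and the
cut strand. Moving a multiplication diagram past a section of it shows that every trace takes the
same value on these two (`app_bot`).

The objects `L_n`. Let `s` be the antisymmetrizer in `P = FP_n(0)`. A diagram that is not a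
permutation is either killed by `s` on one side or is a permutation with one strand cut
(`fixed_or_cut`). Two cuts between antisymmetrizers give zero, because `t = 0` or by antisymmetry.
So `s P s` is the scalars plus an ideal of square zero, `s` is primitive, and any primitive
idempotent belonging to the sign representation gives an object isomorphic to `([n], s)`
(`exists_factorization`).

The value. The closure of a permutation has its cycles as components, so only the `n`-cycles in `s`
contribute to the trace. All have sign `(-1)^(n+1)`, and there are `(n-1)!` of them (`endTrace_alt`,
`card_sameCycle_all`). -/

namespace Deligne

/-! ### Closures of diagrams and their components. -/

namespace Diagram
variable {A B : Type}

/-- The partition of `A` obtained from `p` by glueing each top vertex to its bottom copy. -/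
def closure (p : Diagram A A) : Setoid A := Setoid.map p (Sum.elim id id)

/-- The number of components of the closure of a diagram. -/
noncomputable def comps (p : Diagram A A) : ℕ := Nat.card (Quotient (closure p))

theorem closure_le (p : Diagram A A) (f : A → Bool) :
    closure p ≤ Setoid.ker f ↔ p ≤ Setoid.ker (Sum.elim f f) := by
  unfold closure
  rw [map_le]
  have e : f ∘ Sum.elim id id = Sum.elim f f := by
    ext (x | x) <;> rfl
  rw [← e]
  exact Iff.rfl

/-- A diagonal entry at `f` is `1` exactly when `f` is constant on the components of the closure, so
the trace counts two-colourings of the set of components. -/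
theorem trace_mat [Fintype A] [DecidableEq A] (p : Diagram A A) :
    Matrix.trace (mat p) = 2 ^ comps p := by
  classical
  have e : {f : A → Bool // p ≤ Setoid.ker (Sum.elim f f)} ≃ (Quotient (closure p) → Bool) :=
    { toFun := fun f => Quotient.lift f.1 ((closure_le p f.1).2 f.2)
      invFun := fun g => ⟨fun a => g (Quotient.mk _ a), (closure_le p _).1 fun a b hab =>
        congrArg g (Quotient.sound hab)⟩
      left_inv := fun f => rfl
      right_inv := fun g => by
        funext k
        induction k using Quotient.inductionOn with
        | h a => rfl }
  have h1 : Matrix.trace (mat p) = Nat.card {f : A → Bool // p ≤ Setoid.ker (Sum.elim f f)} := by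
    rw [Matrix.trace, Nat.card_eq_fintype_card, Fintype.card_subtype, Finset.card_filter]
    refine Finset.sum_congr rfl fun f _ => ?_
    simp only [Matrix.diag_apply, mat]
  rw [h1, Nat.card_congr e, Nat.card_fun, Nat.card_eq_fintype_card (α := Bool), Fintype.card_bool,
    comps]

theorem comps_pos [Finite A] [Nonempty A] (p : Diagram A A) : 0 < comps p :=
  have : Nonempty (Quotient (closure p)) := ⟨Quotient.mk _ (Classical.arbitrary A)⟩
  Nat.card_pos

end Diagram

/-! ### Cyclicity and partial traces for component counts. -/

namespace SDiagram
variable {A B C : Type}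

/-- The number of components of the closure, each factor `t` counting as a component. -/
noncomputable def comps (x : SDiagram A A) : ℕ := x.exp + x.diag.comps

theorem trace_val [Fintype A] [DecidableEq A] (x : SDiagram A A) :
    Matrix.trace x.val = 2 ^ x.comps := by
  rw [val, Matrix.trace_smul, Diagram.trace_mat, comps, pow_add, smul_eq_mul]

/-- Cyclicity of the matrix trace, read off in the exponent of `2`. The closed loops removed by
concatenation are included in `comps` through `exp`; without them the identity would fail. -/
theorem comps_comp_comm [Finite A] [Finite B] (x : SDiagram A B) (y : SDiagram B A) :
    (x.comp y).comps = (y.comp x).comps := by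
  classical
  cases nonempty_fintype A
  cases nonempty_fintype B
  apply Nat.pow_right_injective le_rfl
  change 2 ^ _ = 2 ^ _
  rw [← trace_val, ← trace_val, val_comp, val_comp, Matrix.trace_mul_comm]

/-- The right partial trace of a scaled diagram. -/
noncomputable def ptr (x : SDiagram (A ⊕ B) (A ⊕ B)) : SDiagram A A :=
  (ofEquiv (Equiv.sumEmpty A Empty).symm).comp
    (((ofEquiv (Equiv.refl A)).tensor (cup B)).comp
      ((ofEquiv (Equiv.sumAssoc A B B).symm).comp
        ((x.tensor (ofEquiv (Equiv.refl B))).comp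
          ((ofEquiv (Equiv.sumAssoc A B B)).comp
            (((ofEquiv (Equiv.refl A)).tensor ((ofEquiv (Equiv.sumComm B B)).comp (cap B))).comp
              (ofEquiv (Equiv.sumEmpty A Empty)))))))

/-- Among the intermediate colourings only those agreeing with `f` on `A` and colouring both copies
of `B` alike survive. `val_comp_cap` is the mirror image; together they make the partial trace of
diagrams computable. -/
theorem val_cup_comp [Finite A] [Fintype B] [Finite C] [DecidableEq B]
    (y : SDiagram (A ⊕ (B ⊕ B)) C) (f : A ⊕ Empty → Bool) (g : C → Bool) :
    (((ofEquiv (Equiv.refl A)).tensor (cup B)).comp y).val f g =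
      ∑ b : B → Bool, y.val (Sum.elim (f ∘ Sum.inl) (Sum.elim b b)) g := by
  classical
  cases nonempty_fintype A
  rw [val_comp, Matrix.mul_apply]
  symm
  refine Fintype.sum_of_injective (fun b : B → Bool => Sum.elim (f ∘ Sum.inl) (Sum.elim b b))
    ?_ _ _ ?_ ?_
  · intro b b' h
    funext i
    exact congrFun h (Sum.inr (Sum.inl i))
  · intro k hk
    by_contra hne
    have h0 := left_ne_zero_of_mul hne
    rw [val_tensor] at h0
    have h1 := left_ne_zero_of_mul h0
    have h2 := right_ne_zero_of_mul h0
    rw [val_ofEquiv] at h1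
    rw [val_cup] at h2
    have h1' := (ite_ne_right_iff.1 h1).1
    have h2' := (ite_ne_right_iff.1 h2).1
    refine hk ⟨fun i => k (Sum.inr (Sum.inl i)), ?_⟩
    funext z
    rcases z with z | z | z
    · exact congrFun h1' z
    · rfl
    · exact congrFun h2' z
  · intro b
    rw [val_tensor, val_ofEquiv, val_cup]
    refine (Eq.trans (congrArg₂ (· * ·) (congrArg₂ (· * ·) (if_pos rfl) (if_pos rfl)) rfl) ?_).symm
    rw [one_mul, one_mul]

theorem val_comp_cap [Finite A] [Fintype B] [Finite C] [DecidableEq B]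
    (y : SDiagram C (A ⊕ (B ⊕ B))) (f : C → Bool) (g : A ⊕ Empty → Bool) :
    (y.comp ((ofEquiv (Equiv.refl A)).tensor ((ofEquiv (Equiv.sumComm B B)).comp (cap B)))).val f g =
      ∑ b : B → Bool, y.val f (Sum.elim (g ∘ Sum.inl) (Sum.elim b b)) := by
  classical
  cases nonempty_fintype A
  rw [val_comp, Matrix.mul_apply]
  symm
  refine Fintype.sum_of_injective (fun b : B → Bool => Sum.elim (g ∘ Sum.inl) (Sum.elim b b))
    ?_ _ _ ?_ ?_
  · intro b b' h
    funext i
    exact congrFun h (Sum.inr (Sum.inl i))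
  · intro k hk
    by_contra hne
    have h0 := right_ne_zero_of_mul hne
    rw [val_tensor] at h0
    have h1 := left_ne_zero_of_mul h0
    have h2 := right_ne_zero_of_mul h0
    rw [val_ofEquiv] at h1
    rw [val_ofEquiv_comp, val_cap] at h2
    have h1' := (ite_ne_right_iff.1 h1).1
    have h2' := (ite_ne_right_iff.1 h2).1
    refine hk ⟨fun i => k (Sum.inr (Sum.inl i)), ?_⟩
    funext z
    rcases z with z | z | z
    · exact (congrFun h1' z).symm
    · rfl
    · exact (congrFun h2' z).symm
  · intro b
    rw [val_tensor, val_ofEquiv, val_ofEquiv_comp, val_cap]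
    refine (Eq.trans (congrArg₂ (· * ·) rfl (congrArg₂ (· * ·) (if_pos rfl) (if_pos rfl))) ?_).symm
    rw [mul_one, mul_one]

/-- On colourings the diagrammatic partial trace becomes the usual partial trace of a matrix. This
yields `comps_ptr`, since a partial trace followed by the trace is the full trace. -/
theorem val_ptr [Finite A] [Fintype B] [DecidableEq B] (x : SDiagram (A ⊕ B) (A ⊕ B))
    (f g : A → Bool) :
    x.ptr.val f g = ∑ b : B → Bool, x.val (Sum.elim f b) (Sum.elim g b) := by
  classical
  rw [ptr, val_ofEquiv_comp, val_cup_comp]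
  refine Finset.sum_congr rfl fun b _ => ?_
  rw [val_ofEquiv_comp, ← comp_assoc, ← comp_assoc, val_comp_ofEquiv, val_comp_cap,
    Finset.sum_eq_single b]
  · rw [val_comp_ofEquiv, val_tensor, val_ofEquiv, if_pos, mul_one]
    · congr 1
      · ext (i | i) <;> rfl
      · ext (i | i) <;> rfl
    · rfl
  · intro b' _ hb
    rw [val_comp_ofEquiv, val_tensor, val_ofEquiv, if_neg, mul_zero]
    exact fun h => hb h.symm
  · simp

theorem comps_ptr [Finite A] [Finite B] (x : SDiagram (A ⊕ B) (A ⊕ B)) :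
    x.ptr.comps = x.comps := by
  classical
  cases nonempty_fintype A
  cases nonempty_fintype B
  apply Nat.pow_right_injective le_rfl
  change 2 ^ _ = 2 ^ _
  rw [← trace_val, ← trace_val, Matrix.trace, Matrix.trace]
  simp only [Matrix.diag_apply, val_ptr]
  rw [← Finset.sum_product', Finset.univ_product_univ]
  exact (Fintype.sum_equiv (Equiv.sumArrowEquivProdArrow A B Bool) _ _ fun k => by
    simp [Equiv.sumArrowEquivProdArrow]).symm

end SDiagram

/-! ### The connected-closure functional at parameter zero. -/

section linear
variable {F : Type u} [Field F] {A B : Type}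

/-- The linear functional on endomorphisms that takes the value `1` on the diagrams with connected
closure and `0` on the other diagrams. -/
noncomputable def connTrace : (Diagram A A →₀ F) →ₗ[F] F :=
  Finsupp.linearCombination F fun p => if p.comps = 1 then 1 else 0

theorem connTrace_single (p : Diagram A A) (c : F) :
    connTrace (Finsupp.single p c) = if p.comps = 1 then c else 0 := by
  simp [connTrace]

/-- If `exp > 0`, the coefficient `0 ^ exp` vanishes, and `comps ≥ 2` because the closure of a
diagram on a nonempty set contributes at least one component. Nonemptiness is essential: on the
empty set one loop alone would have `comps = 1`. -/
theorem connTrace_ofS [Finite A] [Nonempty A] (x : SDiagram A A) :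
    connTrace (ofS (0 : F) x) = if x.comps = 1 then 1 else 0 := by
  rw [ofS, connTrace_single, SDiagram.comps]
  have := x.diag.comps_pos
  rcases Nat.eq_zero_or_pos x.exp with h | h
  · simp [h]
  · rw [zero_pow h.ne', ite_self, if_neg (by omega)]

theorem connTrace_comm [Finite A] [Nonempty A] [Finite B] [Nonempty B]
    (f : Diagram A B →₀ F) (g : Diagram B A →₀ F) :
    connTrace (compL (0 : F) f g) = connTrace (compL (0 : F) g f) := by
  induction f using ind (0 : F) with
  | h0 => simp
  | hadd a b ha hb => simp only [map_add, LinearMap.add_apply, ha, hb]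
  | hs a x =>
    induction g using ind (0 : F) with
    | h0 => simp
    | hadd a b ha hb => simp only [map_add, LinearMap.add_apply, ha, hb]
    | hs b y =>
      simp only [map_smul, LinearMap.smul_apply, compL_ofS, connTrace_ofS,
        SDiagram.comps_comp_comm x y, smul_comm a b]

end linear

/-! ### Naturality properties of the right partial trace. -/

section ribbon

variable {C : Type u} [Category.{v} C] [MonoidalCategory C] [BraidedCategory C]
  [RightRigidCategory C] [RibbonTwist C]

/-- The analogue for `evPrime` of sliding a morphism along an evaluation: naturality of the braiding
moves `a` across, naturality of the twist past `θ`. -/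
theorem whiskerLeft_mate_evPrime {W W' : C} (a : W ⟶ W') :
    W ◁ aᘁ ≫ evPrime W = a ▷ W'ᘁ ≫ evPrime W' := by
  unfold evPrime
  rw [MonoidalCategory.whisker_exchange_assoc, BraidedCategory.braiding_naturality_right_assoc,
    rightAdjointMate_comp_evaluation, ← BraidedCategory.braiding_naturality_left_assoc,
    ← comp_whiskerRight_assoc, ← comp_whiskerRight_assoc, RibbonTwist.twist_natural]

theorem trR_natural {V V' W : C} (a : V' ⟶ V) (f : V ⊗ W ⟶ V ⊗ W) (b : V ⟶ V') :
    trR (a ▷ W ≫ f ≫ b ▷ W) = a ≫ trR f ≫ b := by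
  unfold trR
  simp only [comp_whiskerRight, Category.assoc]
  rw [← associator_inv_naturality_left_assoc, MonoidalCategory.whisker_exchange_assoc,
    ← rightUnitor_inv_naturality_assoc, associator_naturality_left_assoc,
    ← MonoidalCategory.whisker_exchange_assoc, rightUnitor_naturality]

/-- The morphism `a` travels around the traced loop: through the coevaluation it becomes its mate,
and through `evPrime` it becomes `a` again. -/
theorem trR_dinatural {V W W' : C} (a : W ⟶ W') (f : V ⊗ W' ⟶ V ⊗ W) :
    trR (V ◁ a ≫ f) = trR (f ≫ V ◁ a) := by
  unfold trR
  simp only [comp_whiskerRight, Category.assoc]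
  rw [← associator_inv_naturality_middle_assoc, associator_naturality_middle_assoc,
    ← MonoidalCategory.whiskerLeft_comp_assoc, ← MonoidalCategory.whiskerLeft_comp_assoc,
    ← coevaluation_comp_rightAdjointMate, ← whiskerLeft_mate_evPrime]
  simp only [MonoidalCategory.whiskerLeft_comp, Category.assoc]
  rw [associator_inv_naturality_right_assoc, MonoidalCategory.whisker_exchange_assoc,
    associator_naturality_right_assoc]

theorem trR_sum [Preadditive C] [MonoidalPreadditive C] {V W : C} {ι : Type*} (s : Finset ι)
    (f : ι → (V ⊗ W ⟶ V ⊗ W)) : trR (∑ i ∈ s, f i) = ∑ i ∈ s, trR (f i) := by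
  unfold trR
  rw [sum_whiskerRight]
  simp only [Preadditive.comp_sum, Preadditive.sum_comp]

end ribbon

/-! ### Biadditivity of the tensor product in the two envelopes. -/

section preadditive

variable {C : Type u} [Category.{v} C] [Preadditive C] [MonoidalCategory C] [MonoidalPreadditive C]

theorem tensorHom_add {X Y X' Y' : C} (f : X ⟶ Y) (g h : X' ⟶ Y') :
    f ⊗ₘ (g + h) = f ⊗ₘ g + f ⊗ₘ h := by
  simp [MonoidalCategory.tensorHom_def]

theorem add_tensorHom {X Y X' Y' : C} (f g : X ⟶ Y) (h : X' ⟶ Y') :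
    (f + g) ⊗ₘ h = f ⊗ₘ h + g ⊗ₘ h := by
  simp [MonoidalCategory.tensorHom_def]

instance : MonoidalPreadditive (Mat_ C) where
  whiskerLeft_zero := by
    intros; ext x y; exact MatEnv.tensor_zero' _
  zero_whiskerRight := by
    intros; ext x y; exact MatEnv.zero_tensor' _
  whiskerLeft_add _ _ := by
    ext x y; exact tensorHom_add _ _ _
  add_whiskerRight _ _ := by
    ext x y; exact add_tensorHom _ _ _

instance : MonoidalPreadditive (Idempotents.Karoubi C) where
  whiskerLeft_zero := by
    intros; exact Idempotents.Karoubi.hom_ext _ _ (MatEnv.tensor_zero' _)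
  zero_whiskerRight := by
    intros; exact Idempotents.Karoubi.hom_ext _ _ (MatEnv.zero_tensor' _)
  whiskerLeft_add _ _ := Idempotents.Karoubi.hom_ext _ _ (tensorHom_add _ _ _)
  add_whiskerRight _ _ := Idempotents.Karoubi.hom_ext _ _ (add_tensorHom _ _ _)

end preadditive

/-! ### The functional on the category of partition diagrams. -/

namespace RepZero

variable {F : Type u} [Field F] {t : F}

/-- The morphism given by a scaled diagram. -/
noncomputable def hom (X Y : RepZero F t) (x : SDiagram X.V Y.V) : X ⟶ Y := ofS t x

theorem hom_comp {X Y Z : RepZero F t} (x : SDiagram X.V Y.V) (y : SDiagram Y.V Z.V) :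
    hom X Y x ≫ hom Y Z y = hom X Z (x.comp y) := compL_ofS t x y

theorem hom_ind {X Y : RepZero F t} {P : (X ⟶ Y) → Prop} (h0 : P 0)
    (hadd : ∀ f g, P f → P g → P (f + g)) (hs : ∀ (c : F) (x : SDiagram X.V Y.V), P (c • hom X Y x))
    (f : X ⟶ Y) : P f :=
  ind (P := P) t h0 hadd hs f

/-- The linear functional `connTrace` on the endomorphisms of an object. -/
noncomputable def endTrace (X : RepZero F t) : (X ⟶ X) →ₗ[F] F :=
  (connTrace : (Diagram X.V X.V →₀ F) →ₗ[F] F)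

theorem endTrace_hom {X : RepZero F 0} [Nonempty X.V] (x : SDiagram X.V X.V) :
    endTrace X (hom X X x) = if x.comps = 1 then 1 else 0 := connTrace_ofS x

theorem endTrace_comm {X Y : RepZero F 0} [Nonempty X.V] [Nonempty Y.V] (f : X ⟶ Y) (g : Y ⟶ X) :
    endTrace X (f ≫ g) = endTrace Y (g ≫ f) := connTrace_comm _ _

end RepZero

/-! ### Matrix entries of morphisms and of the structure maps in Deligne's category. -/

namespace RepS

open Idempotents

variable {F : Type u} [Field F] {t : F}

/-- The embedding of the category of partition diagrams. -/
noncomputable abbrev emb (F : Type u) [Field F] (t : F) : RepZero F t ⥤ RepS F t :=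
  Mat_.embedding _ ⋙ toKaroubi _

/-- The matrix entries of a morphism. -/
def entry {V W : RepS F t} (f : V ⟶ W) (i : V.X.ι) (j : W.X.ι) : V.X.X i ⟶ W.X.X j := f.f i j

theorem entry_ext {V W : RepS F t} {f g : V ⟶ W} (h : ∀ i j, entry f i j = entry g i j) : f = g :=
  Karoubi.hom_ext _ _ (by ext i j; exact h i j)

theorem entry_comp {U V W : RepS F t} (f : U ⟶ V) (g : V ⟶ W) (i : U.X.ι) (k : W.X.ι) :
    entry (f ≫ g) i k = ∑ j, entry f i j ≫ entry g j k := rfl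

theorem entry_comp_unique {U V W : RepS F t} (f : U ⟶ V) (g : V ⟶ W) (i : U.X.ι) (k : W.X.ι)
    (j : V.X.ι) (hj : ∀ j', j' = j) : entry (f ≫ g) i k = entry f i j ≫ entry g j k := by
  rw [entry_comp, Finset.sum_eq_single j]
  · intro j' _ h
    exact absurd (hj j') h
  · simp

theorem entry_add {V W : RepS F t} (f g : V ⟶ W) (i : V.X.ι) (j : W.X.ι) :
    entry (f + g) i j = entry f i j + entry g i j := rfl

theorem entry_sum {V W : RepS F t} {ι : Type*} (s : Finset ι) (f : ι → (V ⟶ W)) (i : V.X.ι)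
    (j : W.X.ι) : entry (∑ k ∈ s, f k) i j = ∑ k ∈ s, entry (f k) i j := by
  classical
  induction s using Finset.induction_on with
  | empty => rfl
  | insert a s ha ih => rw [Finset.sum_insert ha, Finset.sum_insert ha, ← ih, entry_add]

theorem entry_smul {V W : RepS F t} (c : F) (f : V ⟶ W) (i : V.X.ι) (j : W.X.ι) :
    entry (c • f) i j = c • entry f i j := rfl

/-- The projection to a summand. -/
noncomputable def proj (V : RepS F t) (i : V.X.ι) : V ⟶ (emb F t).obj (V.X.X i) where
  f := fun j _ => V.p j i
  comm := by
    refine (congrArg (V.p ≫ ·) (Category.comp_id _)).trans ?_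
    ext j k
    exact congrFun (congrFun V.idem j) i

/-- The inclusion of a summand. -/
noncomputable def incl (V : RepS F t) (i : V.X.ι) : (emb F t).obj (V.X.X i) ⟶ V where
  f := fun _ j => V.p i j
  comm := by
    refine (Category.id_comp _).trans ?_
    ext k j
    exact congrFun (congrFun V.idem i) j

/-- The projections and inclusions are the columns and rows of the idempotent `V.p`, so the sum is
`V.p ≫ V.p`, the identity of `V` in the Karoubi envelope. They need not be orthogonal; only this
resolution of the identity is used, to reduce statements about `V` to single objects `[U]`. -/
theorem sum_proj_incl (V : RepS F t) : ∑ i, proj V i ≫ incl V i = 𝟙 V := by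
  refine entry_ext fun j k => ?_
  rw [entry_sum]
  refine Eq.trans (Finset.sum_congr rfl fun i _ => ?_) (congrFun (congrFun V.idem j) k)
  exact entry_comp_unique (proj V i) (incl V i) j k PUnit.unit (fun _ => rfl)

theorem entry_rightUnitor_hom (X : RepZero F t) :
    entry (ρ_ ((emb F t).obj X)).hom (PUnit.unit, PUnit.unit) PUnit.unit = (ρ_ X).hom := by
  have h : (ρ_ ((emb F t).obj X)).hom.f = (ρ_ ((Mat_.embedding _).obj X)).hom := by
    refine (KarEnv.isCut_rightUnit _).1.trans ?_
    change (𝟙 _ ⊗ₘ 𝟙 _) ≫ _ = _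
    rw [id_tensorHom_id, Category.id_comp]
    rfl
  refine (congrFun (congrFun h _) _).trans ?_
  exact (MatEnv.isPerm_rightUnit ((Mat_.embedding _).obj X)).1 (PUnit.unit, PUnit.unit)

theorem entry_rightUnitor_inv (X : RepZero F t) :
    entry (ρ_ ((emb F t).obj X)).inv PUnit.unit (PUnit.unit, PUnit.unit) = (ρ_ X).inv := by
  have h : (ρ_ ((emb F t).obj X)).inv.f = (ρ_ ((Mat_.embedding _).obj X)).inv := by
    refine (KarEnv.isCut_rightUnit_inv _).1.trans ?_
    change 𝟙 _ ≫ _ = _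
    rw [Category.id_comp]
    rfl
  refine (congrFun (congrFun h _) _).trans ?_
  exact (MatEnv.isPerm_rightUnit_inv ((Mat_.embedding _).obj X)).1 PUnit.unit

theorem entry_associator_dual_hom (X Y Z : RepZero F t) :
    entry (α_ ((emb F t).obj X) ((emb F t).obj Y) ((emb F t).obj Z)ᘁ).hom
      ((PUnit.unit, PUnit.unit), PUnit.unit) (PUnit.unit, PUnit.unit, PUnit.unit) =
      (α_ X Y Zᘁ).hom := by
  have h : (α_ ((emb F t).obj X) ((emb F t).obj Y) ((emb F t).obj Z)ᘁ).hom.f =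
      (α_ ((Mat_.embedding _).obj X) ((Mat_.embedding _).obj Y) ((Mat_.embedding _).obj Z)ᘁ).hom := by
    refine (KarEnv.isCut_assoc _ _ _).1.trans ?_
    -- The idempotent of a dual is the mate of the original idempotent, so even for embedded objects
    -- it has to be rewritten as an identity.
    change ((𝟙 _ ⊗ₘ 𝟙 _) ⊗ₘ (𝟙 _)ᘁ) ≫ _ = _
    rw [rightAdjointMate_id, id_tensorHom_id, id_tensorHom_id, Category.id_comp]
    rfl
  refine (congrFun (congrFun h _) _).trans ?_
  exact (MatEnv.isPerm_assoc ((Mat_.embedding _).obj X) ((Mat_.embedding _).obj Y)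
    ((Mat_.embedding _).obj Z)ᘁ).1 ((PUnit.unit, PUnit.unit), PUnit.unit)

theorem entry_associator_dual_inv (X Y Z : RepZero F t) :
    entry (α_ ((emb F t).obj X) ((emb F t).obj Y) ((emb F t).obj Z)ᘁ).inv
      (PUnit.unit, PUnit.unit, PUnit.unit) ((PUnit.unit, PUnit.unit), PUnit.unit) =
      (α_ X Y Zᘁ).inv := by
  have h : (α_ ((emb F t).obj X) ((emb F t).obj Y) ((emb F t).obj Z)ᘁ).inv.f =
      (α_ ((Mat_.embedding _).obj X) ((Mat_.embedding _).obj Y) ((Mat_.embedding _).obj Z)ᘁ).inv := by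
    refine (KarEnv.isCut_assoc_inv _ _ _).1.trans ?_
    change (𝟙 _ ⊗ₘ (𝟙 _ ⊗ₘ (𝟙 _)ᘁ)) ≫ _ = _
    rw [rightAdjointMate_id, id_tensorHom_id, id_tensorHom_id, Category.id_comp]
    rfl
  refine (congrFun (congrFun h _) _).trans ?_
  exact (MatEnv.isPerm_assoc_inv ((Mat_.embedding _).obj X) ((Mat_.embedding _).obj Y)
    ((Mat_.embedding _).obj Z)ᘁ).1 (PUnit.unit, PUnit.unit, PUnit.unit)

theorem entry_emb_whiskerLeft (X : RepZero F t) {V W : RepS F t} (f : V ⟶ W) (i : V.X.ι)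
    (j : W.X.ι) :
    entry ((emb F t).obj X ◁ f) (PUnit.unit, i) (PUnit.unit, j) = X ◁ entry f i j := by
  refine (congrArg (· ⊗ₘ entry f i j)
    (Mat_.id_apply_self ((Mat_.embedding (RepZero F t)).obj X) PUnit.unit)).trans ?_
  exact id_tensorHom _ _

theorem entry_whiskerRight_emb_dual (X : RepZero F t) {V W : RepS F t} (f : V ⟶ W) (i : V.X.ι)
    (j : W.X.ι) :
    entry (f ▷ ((emb F t).obj X)ᘁ) (i, PUnit.unit) (j, PUnit.unit) = entry f i j ▷ X := by
  change entry f i j ⊗ₘ ((𝟙 ((Mat_.embedding _).obj X))ᘁ : Mat_.Hom _ _) PUnit.unit PUnit.unit = _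
  rw [rightAdjointMate_id]
  refine (congrArg (entry f i j ⊗ₘ ·) (Mat_.id_apply_self (MatEnv.dual
    ((Mat_.embedding (RepZero F t)).obj X)) PUnit.unit)).trans ?_
  exact tensorHom_id _ _

theorem entry_coev (X : RepZero F t) :
    entry (η_ ((emb F t).obj X) ((emb F t).obj X)ᘁ) PUnit.unit (PUnit.unit, PUnit.unit) =
      η_ X Xᘁ := by
  have h : (η_ ((emb F t).obj X) ((emb F t).obj X)ᘁ).f =
      η_ ((Mat_.embedding _).obj X) ((Mat_.embedding _).obj X)ᘁ := by
    refine (KarEnv.coev_f _).trans ?_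
    change _ ≫ 𝟙 _ ▷ _ = _
    rw [id_whiskerRight, Category.comp_id]
    rfl
  refine (congrFun (congrFun h _) _).trans ?_
  exact MatEnv.coev_self ((Mat_.embedding _).obj X) PUnit.unit

theorem entry_ev (X : RepZero F t) :
    entry (ε_ ((emb F t).obj X) ((emb F t).obj X)ᘁ) (PUnit.unit, PUnit.unit) PUnit.unit =
      ε_ X Xᘁ := by
  have h : (ε_ ((emb F t).obj X) ((emb F t).obj X)ᘁ).f =
      ε_ ((Mat_.embedding _).obj X) ((Mat_.embedding _).obj X)ᘁ := by
    refine (KarEnv.ev_f _).trans ?_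
    change _ ◁ 𝟙 _ ≫ _ = _
    rw [MonoidalCategory.whiskerLeft_id, Category.id_comp]
    rfl
  refine (congrFun (congrFun h _) _).trans ?_
  exact MatEnv.ev_self ((Mat_.embedding _).obj X) PUnit.unit

theorem entry_braiding_dual (X : RepZero F t) :
    entry (β_ ((emb F t).obj X) ((emb F t).obj X)ᘁ).hom (PUnit.unit, PUnit.unit)
      (PUnit.unit, PUnit.unit) = (β_ X Xᘁ).hom := by
  have h : (β_ ((emb F t).obj X) ((emb F t).obj X)ᘁ).hom.f =
      (β_ ((Mat_.embedding _).obj X) ((Mat_.embedding _).obj X)ᘁ).hom := by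
    refine (KarEnv.isCut_braid _ _).1.trans ?_
    change (𝟙 _ ⊗ₘ (𝟙 _)ᘁ) ≫ _ = _
    rw [rightAdjointMate_id, id_tensorHom_id, Category.id_comp]
    rfl
  refine (congrFun (congrFun h _) _).trans ?_
  exact (MatEnv.isPerm_braid ((Mat_.embedding _).obj X) ((Mat_.embedding _).obj X)ᘁ).1
    (PUnit.unit, PUnit.unit)

theorem entry_evPrime (X : RepZero F t) :
    entry (evPrime ((emb F t).obj X)) (PUnit.unit, PUnit.unit) PUnit.unit =
      (β_ X Xᘁ).hom ≫ ε_ X Xᘁ := by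
  have h : evPrime ((emb F t).obj X) = (β_ ((emb F t).obj X) ((emb F t).obj X)ᘁ).hom ≫
      ε_ ((emb F t).obj X) ((emb F t).obj X)ᘁ := by
    -- The twist is the identity, so `evPrime` is braiding followed by evaluation.
    change 𝟙 _ ▷ _ ≫ _ = _
    rw [id_whiskerRight, Category.id_comp]
  rw [h]
  refine (entry_comp_unique _ _ _ _ (PUnit.unit, PUnit.unit) (fun _ => rfl)).trans ?_
  have h1 := entry_braiding_dual (t := t) X
  have h2 := entry_ev (t := t) X
  exact congrArg₂ (fun (a : X ⊗ Xᘁ ⟶ Xᘁ ⊗ X) (b : Xᘁ ⊗ X ⟶ 𝟙_ _) => a ≫ b) h1 h2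

/-- The right partial trace in the category of partition diagrams. -/
noncomputable def ptrHom {X Y : RepZero F t} (f : X ⊗ Y ⟶ X ⊗ Y) : X ⟶ X :=
  (ρ_ X).inv ≫ X ◁ η_ Y (HasRightDual.rightDual Y) ≫ (α_ X Y (HasRightDual.rightDual Y)).inv ≫
    f ▷ (HasRightDual.rightDual Y) ≫ (α_ X Y (HasRightDual.rightDual Y)).hom ≫
    X ◁ ((β_ Y (HasRightDual.rightDual Y)).hom ≫ ε_ Y (HasRightDual.rightDual Y)) ≫ (ρ_ X).hom

/-- Between embedded objects every index set is a point, so matrix products have a single term. The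
seven factors of the partial trace are compared one by one. -/
theorem entry_trR {X Y : RepZero F t}
    (f : (emb F t).obj X ⊗ (emb F t).obj Y ⟶ (emb F t).obj X ⊗ (emb F t).obj Y) :
    entry (trR f) PUnit.unit PUnit.unit =
      ptrHom (X := X) (Y := Y) (entry f (PUnit.unit, PUnit.unit) (PUnit.unit, PUnit.unit)) := by
  have h1 := entry_rightUnitor_inv (t := t) X
  have h2 := (entry_emb_whiskerLeft X (η_ ((emb F t).obj Y) ((emb F t).obj Y)ᘁ) PUnit.unit
    (PUnit.unit, PUnit.unit)).trans
    (congrArg (X ◁ ·) (entry_coev (t := t) Y))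
  have h3 := entry_associator_dual_inv (t := t) X Y Y
  have h4 := entry_whiskerRight_emb_dual Y f (PUnit.unit, PUnit.unit) (PUnit.unit, PUnit.unit)
  have h5 := entry_associator_dual_hom (t := t) X Y Y
  have h6 := (entry_emb_whiskerLeft X (evPrime ((emb F t).obj Y)) (PUnit.unit, PUnit.unit)
    PUnit.unit).trans
    (congrArg (X ◁ ·) (entry_evPrime (t := t) Y))
  have h7 := entry_rightUnitor_hom (t := t) X
  refine (entry_comp_unique _ _ _ _ (PUnit.unit, PUnit.unit) (fun _ => rfl)).trans ?_
  refine congrArg₂ (fun (a : X ⟶ X ⊗ 𝟙_ _) (b : X ⊗ 𝟙_ _ ⟶ X) => a ≫ b) h1 ?_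
  refine (entry_comp_unique _ _ _ _ (PUnit.unit, PUnit.unit, PUnit.unit) (fun _ => rfl)).trans ?_
  refine congrArg₂ (fun (a : X ⊗ 𝟙_ _ ⟶ X ⊗ Y ⊗ Yᘁ) (b : X ⊗ Y ⊗ Yᘁ ⟶ X) => a ≫ b) h2 ?_
  refine (entry_comp_unique _ _ _ _ ((PUnit.unit, PUnit.unit), PUnit.unit) (fun _ => rfl)).trans ?_
  refine congrArg₂ (fun (a : X ⊗ Y ⊗ Yᘁ ⟶ (X ⊗ Y) ⊗ Yᘁ) (b : (X ⊗ Y) ⊗ Yᘁ ⟶ X) => a ≫ b) h3 ?_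
  refine (entry_comp_unique _ _ _ _ ((PUnit.unit, PUnit.unit), PUnit.unit) (fun _ => rfl)).trans ?_
  refine congrArg₂ (fun (a : (X ⊗ Y) ⊗ Yᘁ ⟶ (X ⊗ Y) ⊗ Yᘁ) (b : (X ⊗ Y) ⊗ Yᘁ ⟶ X) => a ≫ b) h4 ?_
  refine (entry_comp_unique _ _ _ _ (PUnit.unit, PUnit.unit, PUnit.unit) (fun _ => rfl)).trans ?_
  refine congrArg₂ (fun (a : (X ⊗ Y) ⊗ Yᘁ ⟶ X ⊗ Y ⊗ Yᘁ) (b : X ⊗ Y ⊗ Yᘁ ⟶ X) => a ≫ b) h5 ?_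
  refine (entry_comp_unique _ _ _ _ (PUnit.unit, PUnit.unit) (fun _ => rfl)).trans ?_
  exact congrArg₂ (fun (a : X ⊗ Y ⊗ Yᘁ ⟶ X ⊗ 𝟙_ _) (b : X ⊗ 𝟙_ _ ⟶ X) => a ≫ b) h6 h7

/-- `SDiagram.ptr` composes the same diagrams in the same bracketing as `ptrHom`, so nothing remains
once composition and tensor product are evaluated on scaled diagrams. -/
theorem ptrHom_hom {X Y : RepZero F t} (x : SDiagram (X.V ⊕ Y.V) (X.V ⊕ Y.V)) :
    ptrHom (X := X) (Y := Y) (RepZero.hom (X ⊗ Y) (X ⊗ Y) x) = RepZero.hom X X x.ptr := by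
  change compL t (ofS t _) (compL t (tensorL (ofS t _) (ofS t _)) (compL t (ofS t _) (compL t
    (tensorL (ofS t _) (ofS t _)) (compL t (ofS t _) (compL t (tensorL (ofS t _)
      (compL t (ofS t _) (ofS t _))) (ofS t _)))))) = _
  simp only [compL_ofS, tensorL_ofS]
  rfl

theorem ptrHom_add {X Y : RepZero F t} (f g : X ⊗ Y ⟶ X ⊗ Y) :
    ptrHom (f + g) = ptrHom f + ptrHom g := by
  simp only [ptrHom, MonoidalPreadditive.add_whiskerRight, Preadditive.add_comp,
    Preadditive.comp_add]

theorem ptrHom_smul {X Y : RepZero F t} (c : F) (f : X ⊗ Y ⟶ X ⊗ Y) :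
    ptrHom (c • f) = c • ptrHom f := by
  have h : (c • f) ▷ Yᘁ = c • f ▷ Yᘁ :=
    LinearMap.map_smul₂ (tensorL (F := F)) c f (𝟙 Yᘁ : Diagram Y.V Y.V →₀ F)
  simp only [ptrHom, h, Linear.smul_comp, Linear.comp_smul]

theorem endTrace_ptrHom {X Y : RepZero F 0} [Nonempty X.V] (f : X ⊗ Y ⟶ X ⊗ Y) :
    RepZero.endTrace X (ptrHom f) = RepZero.endTrace (X ⊗ Y) f := by
  have : Nonempty (X ⊗ Y).V := ⟨Sum.inl (Classical.arbitrary X.V)⟩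
  induction f using RepZero.hom_ind with
  | h0 =>
    have := ptrHom_smul (0 : F) (0 : X ⊗ Y ⟶ X ⊗ Y)
    rw [zero_smul, zero_smul] at this
    rw [this, map_zero, map_zero]
  | hadd a b ha hb => rw [ptrHom_add, map_add, map_add, ha, hb]
  | hs c x =>
    rw [ptrHom_smul, map_smul, map_smul, ptrHom_hom, RepZero.endTrace_hom, RepZero.endTrace_hom,
      SDiagram.comps_ptr]

end RepS

/-! ### Existence of the trace. -/

namespace RepS

open Idempotents

variable {F : Type u} [Field F]

/-- The object is given by a sum of objects `[U]` with `U` nonempty. -/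
def Positive {t : F} (V : RepS F t) : Prop := ∀ i, Nonempty (V.X.X i).V

theorem Positive.tensor {t : F} {V : RepS F t} (hV : V.Positive) (W : RepS F t) :
    (V ⊗ W).Positive := fun i => (hV i.1).map Sum.inl

theorem positive_emb {t : F} (X : RepZero F t) [h : Nonempty X.V] : ((emb F t).obj X).Positive :=
  fun _ => h

/-- The sum of the functionals `endTrace` over the diagonal entries of an endomorphism. -/
noncomputable def diagTrace {t : F} (V : RepS F t) : (V ⟶ V) →ₗ[F] F where
  toFun f := ∑ i, RepZero.endTrace _ (entry f i i)
  map_add' f g := by simp only [entry_add, map_add, Finset.sum_add_distrib]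
  map_smul' c f := by
    simp only [entry_smul, map_smul, smul_eq_mul, Finset.mul_sum, RingHom.id_apply]

theorem diagTrace_apply {t : F} {V : RepS F t} (f : V ⟶ V) :
    diagTrace V f = ∑ i, RepZero.endTrace _ (entry f i i) := rfl

theorem diagTrace_comm {V W : RepS F 0} (hV : V.Positive) (hW : W.Positive) (f : V ⟶ W)
    (g : W ⟶ V) : diagTrace V (f ≫ g) = diagTrace W (g ≫ f) := by
  simp only [diagTrace_apply, entry_comp, map_sum]
  rw [Finset.sum_comm]
  refine Finset.sum_congr rfl fun j _ => Finset.sum_congr rfl fun i _ => ?_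
  have := hV i
  have := hW j
  exact RepZero.endTrace_comm _ _

theorem diagTrace_unique {t : F} {V : RepS F t} (f : V ⟶ V) (i : V.X.ι) (hi : ∀ j, j = i) :
    diagTrace V f = RepZero.endTrace _ (entry f i i) := by
  rw [diagTrace_apply, Finset.sum_eq_single i]
  · intro j _ h
    exact absurd (hi j) h
  · simp

/-- The partial trace axiom for a pair of sets. Only the untraced factor must be nonempty, which is
what allows arbitrary objects on the right. -/
theorem diagTrace_emb_tensor {X Y : RepZero F 0} [Nonempty X.V]
    (f : (emb F 0).obj X ⊗ (emb F 0).obj Y ⟶ (emb F 0).obj X ⊗ (emb F 0).obj Y) :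
    diagTrace _ f = diagTrace _ (trR f) := by
  refine (diagTrace_unique f (PUnit.unit, PUnit.unit) fun _ => rfl).trans
    (Eq.trans ?_ (diagTrace_unique (trR f) PUnit.unit fun _ => rfl).symm)
  exact (endTrace_ptrHom (X := X) (Y := Y) _).symm.trans (congrArg (RepZero.endTrace X) (entry_trR f).symm)

theorem diagTrace_sum {t : F} {V : RepS F t} {ι : Type*} (s : Finset ι) (f : ι → (V ⟶ V)) :
    diagTrace V (∑ i ∈ s, f i) = ∑ i ∈ s, diagTrace V (f i) := map_sum _ _ _

/-- Reduction to `diagTrace_emb_tensor`: the identities of `V` and of `W` are resolved through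
embedded objects. The factors in `V` are moved by naturality of `trR`, those in `W` by its
dinaturality, and both by cyclicity of `diagTrace`. -/
theorem diagTrace_tensor {V : RepS F 0} (hV : V.Positive) (W : RepS F 0) (f : V ⊗ W ⟶ V ⊗ W) :
    diagTrace (V ⊗ W) f = diagTrace V (trR f) := by
  have hV' : ∀ i, ((emb F 0).obj (V.X.X i)).Positive := fun i => @positive_emb _ _ _ _ (hV i)
  have h1 : ∀ i, trR (incl V i ▷ W ≫ f ≫ proj V i ▷ W) = incl V i ≫ trR f ≫ proj V i :=
    fun i => trR_natural _ _ _
  have h2 : diagTrace V (trR f) =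
      ∑ i, diagTrace _ (incl V i ≫ trR f ≫ proj V i) := by
    have h : trR f = ∑ i, proj V i ≫ incl V i ≫ trR f := by
      simp only [← Category.assoc]
      rw [← Preadditive.sum_comp, sum_proj_incl, Category.id_comp]
    nth_rw 1 [h]
    rw [diagTrace_sum]
    refine Finset.sum_congr rfl fun i _ => ?_
    rw [diagTrace_comm hV (hV' i), Category.assoc]
  have h3 : diagTrace (V ⊗ W) f =
      ∑ i, diagTrace _ (incl V i ▷ W ≫ f ≫ proj V i ▷ W) := by
    have h : f = ∑ i, proj V i ▷ W ≫ incl V i ▷ W ≫ f := by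
      simp only [← Category.assoc]
      rw [← Preadditive.sum_comp]
      simp only [← comp_whiskerRight]
      rw [← sum_whiskerRight, sum_proj_incl, id_whiskerRight, Category.id_comp]
    nth_rw 1 [h]
    rw [diagTrace_sum]
    refine Finset.sum_congr rfl fun i _ => ?_
    rw [diagTrace_comm (hV.tensor W) ((hV' i).tensor W), Category.assoc]
  rw [h2, h3]
  refine Finset.sum_congr rfl fun i _ => ?_
  rw [← h1]
  generalize incl V i ▷ W ≫ f ≫ proj V i ▷ W = g
  have : Nonempty (V.X.X i).V := hV i
  -- The first factor is now a single set, so only `W` remains to be split.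
  have h : g = ∑ j, (emb F 0).obj (V.X.X i) ◁ proj W j ≫ (emb F 0).obj (V.X.X i) ◁ incl W j ≫ g := by
    simp only [← Category.assoc]
    rw [← Preadditive.sum_comp]
    simp only [← MonoidalCategory.whiskerLeft_comp]
    rw [← whiskerLeft_sum, sum_proj_incl, MonoidalCategory.whiskerLeft_id, Category.id_comp]
  rw [h, trR_sum, diagTrace_sum, diagTrace_sum]
  refine Finset.sum_congr rfl fun j _ => ?_
  rw [trR_dinatural, ← diagTrace_emb_tensor, diagTrace_comm ((hV' i).tensor W)
    ((hV' i).tensor _)]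

/-- The functional on the endomorphisms of `V` obtained by cutting down `diagTrace`. -/
noncomputable def cutTrace (J : RepS F 0) (V : RepS F 0) (hV : (idealOf J).mem V) :
    (V ⟶ V) →ₗ[F] F :=
  diagTrace _ ∘ₗ Linear.leftComp F _ hV.choose_spec.choose_spec.choose ∘ₗ
    Linear.rightComp F _ hV.choose_spec.choose

/-- The value does not depend on the retraction, nor on the ambient object: any positive `G` having
`V` as a retract may replace the chosen `J ⊗ X`. This gives both trace axioms and later permits
computing on `L_n` inside `[n]` directly. -/
theorem cutTrace_eq {J : RepS F 0} (hJ : J.Positive) {V : RepS F 0} (hV : (idealOf J).mem V)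
    {G : RepS F 0} (hG : G.Positive) (f : V ⟶ G) (g : G ⟶ V) (h : f ≫ g = 𝟙 V) (k : V ⟶ V) :
    cutTrace J V hV k = diagTrace G (g ≫ k ≫ f) := by
  have hX := hJ.tensor hV.choose
  have h0 := hV.choose_spec.choose_spec.choose_spec
  change diagTrace _ (hV.choose_spec.choose_spec.choose ≫ k ≫ hV.choose_spec.choose) = _
  generalize hV.choose_spec.choose_spec.choose = g' at *
  generalize hV.choose_spec.choose = f' at *
  -- Inserting `f ≫ g = 𝟙` or `f' ≫ g' = 𝟙` writes the two endomorphisms as products of the same two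
  -- morphisms in opposite orders.
  have e1 : g' ≫ k ≫ f' = (g' ≫ f) ≫ (g ≫ k ≫ f') := by
    simp only [Category.assoc, reassoc_of% h]
  have e2 : g ≫ k ≫ f = (g ≫ k ≫ f') ≫ (g' ≫ f) := by
    simp only [Category.assoc, reassoc_of% h0]
  rw [e1, e2, diagTrace_comm hX hG]

/-- The trace on the ideal generated by a positive object. -/
noncomputable def modTrace (J : RepS F 0) (hJ : J.Positive) : ModTrace F (idealOf J) where
  app := cutTrace J
  app_tensor {U} hU W f := by
    obtain ⟨X, a, b, h⟩ := id hU
    have hX := hJ.tensor X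
    rw [cutTrace_eq hJ hU hX a b h, cutTrace_eq hJ _ (hX.tensor W) (a ▷ W) (b ▷ W)
      (by rw [← comp_whiskerRight, h, id_whiskerRight]), diagTrace_tensor hX, trR_natural]
  app_comm {U V} hU hV f g := by
    obtain ⟨X, a, b, h⟩ := id hU
    obtain ⟨Y, c, d, h'⟩ := id hV
    have hX := hJ.tensor X
    have hY := hJ.tensor Y
    rw [cutTrace_eq hJ hU hX a b h, cutTrace_eq hJ hV hY c d h']
    have e1 : d ≫ (f ≫ g) ≫ c = (d ≫ f ≫ a) ≫ (b ≫ g ≫ c) := by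
      simp only [Category.assoc, reassoc_of% h]
    have e2 : b ≫ (g ≫ f) ≫ a = (b ≫ g ≫ c) ≫ (d ≫ f ≫ a) := by
      simp only [Category.assoc, reassoc_of% h']
    rw [e1, e2, diagTrace_comm hY hX]

end RepS

/-! ### Traces are determined on the generator of the ideal. -/

section uniqueness

/-- An equality of ideals is needed, since the type of traces depends on the ideal; it transports
the problem from an arbitrary model `J` of `L(□)` to `[1]`. -/
theorem idealOf_congr {C : Type u} [Category.{v} C] [MonoidalCategory C] {J J' : C} (e : J ≅ J') :
    idealOf J = idealOf J' := by
  have h : ∀ {J J' : C} (e : J ≅ J') {V : C}, (idealOf J).mem V → (idealOf J').mem V := by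
    rintro J J' e V ⟨X, f, g, h⟩
    refine ⟨X, f ≫ e.hom ▷ X, e.inv ▷ X ≫ g, ?_⟩
    rw [Category.assoc, hom_inv_whiskerRight_assoc, h]
  have hm : (idealOf J).mem = (idealOf J').mem :=
    funext fun V => propext ⟨h e, h e.symm⟩
  revert hm
  generalize idealOf J = I
  generalize idealOf J' = I'
  cases I
  cases I'
  rintro ⟨⟩
  rfl

variable {K : Type w} [Field K] {C : Type u} [Category.{v} C] [Preadditive C] [Linear K C]
  [MonoidalCategory C] [BraidedCategory C] [RightRigidCategory C] [RibbonTwist C]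

/-- For a retract `V` of `J ⊗ X`, cyclicity carries an endomorphism of `V` to one of `J ⊗ X`, and
the partial trace then carries it to `End J`. -/
theorem ModTrace.ext_of_generator {J : C} (t₁ t₂ : ModTrace K (idealOf J))
    (h : t₁.app J (mem_idealOf J) = t₂.app J (mem_idealOf J)) : t₁ = t₂ := by
  have key : ∀ (tr : ModTrace K (idealOf J)) {V X : C} (hV : (idealOf J).mem V) (f : V ⟶ J ⊗ X)
      (g : J ⊗ X ⟶ V) (_ : f ≫ g = 𝟙 V) (k : V ⟶ V),
      tr.app V hV k = tr.app J (mem_idealOf J) (trR (g ≫ k ≫ f)) := by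
    intro tr V X hV f g hfg k
    rw [← tr.app_tensor, ← Category.assoc, ← tr.app_comm _ hV f (g ≫ k), reassoc_of% hfg]
  ext V hV k
  obtain ⟨X, f, g, hfg⟩ := id hV
  rw [key t₁ hV f g hfg, key t₂ hV f g hfg, h]

theorem ModTrace.dim_eq_of_iso {I : ObjIdeal C} (tr : ModTrace K I) {V W : C} (hV : I.mem V)
    (hW : I.mem W) (e : V ≅ W) : tr.dim V hV = tr.dim W hW := by
  rw [ModTrace.dim, ModTrace.dim, ← e.hom_inv_id, ← e.inv_hom_id, tr.app_comm]

end uniqueness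

/-! ### A relation satisfied by every trace, and uniqueness on the ideal of `[1]`. -/

theorem ker_le_ker_iff {X Y Z : Type*} {φ : X → Y} (s : Y → X) (hs : ∀ y, φ (s y) = y)
    (h : X → Z) : Setoid.ker φ ≤ Setoid.ker h ↔ ∀ x, h x = h (s (φ x)) := by
  constructor
  · intro hle x
    exact hle (show φ x = φ (s (φ x)) from (hs _).symm)
  · intro hh x y hxy
    change h x = h y
    rw [hh x, hh y, show φ x = φ y from hxy]

namespace SDiagram
variable {A : Type}

/-- The multiplication: the parts are the triples of copies of an element of `A`. -/
def mul (A : Type) : SDiagram (A ⊕ A) A := ⟨0, Setoid.ker (Sum.elim (Sum.elim id id) id)⟩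

/-- The left unit insertion: the second bottom copy is joined to the top, the first one is free. -/
def unitLeft (A : Type) : SDiagram A (A ⊕ A) := ⟨0, Setoid.ker (Sum.elim Sum.inr id)⟩

open scoped Classical in
theorem val_mul (f : A ⊕ A → Bool) (g : A → Bool) :
    (mul A).val f g = if f = Sum.elim g g then 1 else 0 := by
  have h : Setoid.ker (Sum.elim (Sum.elim id id) (id : A → A)) ≤ Setoid.ker (Sum.elim f g) ↔
      f = Sum.elim g g := by
    rw [ker_le_ker_iff Sum.inr fun _ => rfl]
    constructor
    · intro h
      ext (x | x)
      · exact h (Sum.inl (Sum.inl x))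
      · exact h (Sum.inl (Sum.inr x))
    · rintro rfl ((x | x) | x) <;> rfl
  simp [val, mul, Diagram.mat, h]

open scoped Classical in
theorem val_unitLeft (f : A → Bool) (g : A ⊕ A → Bool) :
    (unitLeft A).val f g = if f = g ∘ Sum.inr then 1 else 0 := by
  have h : Setoid.ker (Sum.elim Sum.inr (id : A ⊕ A → A ⊕ A)) ≤ Setoid.ker (Sum.elim f g) ↔
      f = g ∘ Sum.inr := by
    rw [ker_le_ker_iff Sum.inr fun _ => rfl]
    constructor
    · intro h
      ext x
      exact h (Sum.inl x)
    · rintro rfl (x | x) <;> rfl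
  simp [val, unitLeft, Diagram.mat, h]

theorem val_comp_mul [Finite A] (x : SDiagram A (A ⊕ A)) (f g : A → Bool) :
    (x.comp (mul A)).val f g = x.val f (Sum.elim g g) := by
  classical
  cases nonempty_fintype A
  rw [val_comp, Matrix.mul_apply]
  simp only [val_mul, mul_ite, mul_one, mul_zero, Finset.sum_ite_eq', Finset.mem_univ, if_true]

theorem unitLeft_mul [Finite A] : (unitLeft A).comp (mul A) = ofEquiv (Equiv.refl A) := by
  classical
  apply val_injective
  ext f g
  rw [val_comp_mul, val_unitLeft, val_ofEquiv]
  rfl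

theorem elim_self_eq {B : Type*} (b g : A → B) (f : A → B) :
    Sum.elim f b = Sum.elim g g ↔ f = g ∧ b = g := by
  constructor
  · intro h
    exact ⟨funext fun x => congrFun h (Sum.inl x), funext fun x => congrFun h (Sum.inr x)⟩
  · rintro ⟨rfl, rfl⟩
    rfl

/-- Closing the second strand produces no free loop, since `mul` ties it to the first top vertex,
while the first bottom vertex is free by the choice of `unitLeft`. Hence the exponent `0` and the
totally disconnected diagram. -/
theorem ptr_mul_unitLeft [Finite A] : ptr ((mul A).comp (unitLeft A)) = ⟨0, ⊥⟩ := by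
  classical
  cases nonempty_fintype A
  apply val_injective
  ext f g
  rw [val_ptr]
  simp only [val_comp, Matrix.mul_apply, val_mul, val_unitLeft, elim_self_eq,
    Sum.elim_comp_inr]
  simp [ite_and, eq_comm, val, Diagram.mat]

end SDiagram

namespace RepS

variable {F : Type u} [Field F] {t : F}

/-- The morphism from a tensor product of embedded objects given by a diagram. -/
noncomputable def fromTensor {X Y Z : RepZero F t} (f : X ⊗ Y ⟶ Z) :
    (emb F t).obj X ⊗ (emb F t).obj Y ⟶ (emb F t).obj Z where
  f := fun _ _ => f
  comm := by
    change (𝟙 ((Mat_.embedding _).obj X) ⊗ₘ 𝟙 ((Mat_.embedding _).obj Y)) ≫ _ ≫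
      𝟙 ((Mat_.embedding _).obj Z) = _
    rw [id_tensorHom_id]
    exact (Category.id_comp _).trans (Category.comp_id _)

/-- The morphism to a tensor product of embedded objects given by a diagram. -/
noncomputable def toTensor {X Y Z : RepZero F t} (f : Z ⟶ X ⊗ Y) :
    (emb F t).obj Z ⟶ (emb F t).obj X ⊗ (emb F t).obj Y where
  f := fun _ _ => f
  comm := by
    change 𝟙 ((Mat_.embedding _).obj Z) ≫ _ ≫
      (𝟙 ((Mat_.embedding _).obj X) ⊗ₘ 𝟙 ((Mat_.embedding _).obj Y)) = _
    rw [id_tensorHom_id]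
    exact (Category.id_comp _).trans (Category.comp_id _)

theorem toTensor_fromTensor {X Y Z W : RepZero F t} (f : Z ⟶ X ⊗ Y) (g : X ⊗ Y ⟶ W) :
    toTensor f ≫ fromTensor g = (emb F t).map (f ≫ g) :=
  entry_ext fun _ _ =>
    (entry_comp_unique _ _ _ _ (PUnit.unit, PUnit.unit) fun _ => rfl).trans rfl

theorem trR_fromTensor_toTensor {X Y Z : RepZero F t} (f : X ⊗ Y ⟶ Z) (g : Z ⟶ X ⊗ Y) :
    trR (fromTensor f ≫ toTensor g) = (emb F t).map (ptrHom (f ≫ g)) := by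
  refine entry_ext fun _ _ => (entry_trR _).trans ?_
  exact congrArg (ptrHom (X := X) (Y := Y))
    (entry_comp_unique (fromTensor f) (toTensor g) (PUnit.unit, PUnit.unit)
      (PUnit.unit, PUnit.unit) PUnit.unit fun _ => rfl)

/-- Every trace takes the same value on the identity of `[X]` and on the diagram without joins. -/
theorem app_bot {I : ObjIdeal (RepS F t)} (tr : ModTrace F I) (X : RepZero F t)
    (hX : I.mem ((emb F t).obj X)) :
    tr.app _ hX ((emb F t).map (RepZero.hom X X ⟨0, ⊥⟩)) = tr.app _ hX (𝟙 _) := by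
  have h : ∀ x : SDiagram X.V (X.V ⊕ X.V), x.comp (.mul X.V) = .ofEquiv (Equiv.refl X.V) →
      tr.app _ hX ((emb F t).map (RepZero.hom X X (SDiagram.ptr ((SDiagram.mul X.V).comp x)))) =
        tr.app _ hX (𝟙 _) := by
    intro x hx
    -- Cyclicity for a section `x` of the multiplication: one order of composition is the identity
    -- of `[X]`, the other is an endomorphism of `[X] ⊗ [X]` to which the partial trace applies.
    have h1 := tr.app_comm (I.tensor_mem hX ((emb F t).obj X)) hX
      (toTensor (RepZero.hom X (X ⊗ X) x)) (fromTensor (RepZero.hom (X ⊗ X) X (.mul X.V)))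
    rw [tr.app_tensor, toTensor_fromTensor, trR_fromTensor_toTensor] at h1
    have h2 : RepZero.hom X (X ⊗ X) x ≫ RepZero.hom (X ⊗ X) X (.mul X.V) = 𝟙 X :=
      (RepZero.hom_comp (Y := X ⊗ X) _ _).trans (congrArg (RepZero.hom X X) hx)
    have h3 : ptrHom (RepZero.hom (X ⊗ X) X (.mul X.V) ≫ RepZero.hom X (X ⊗ X) x) =
        RepZero.hom X X (SDiagram.ptr ((SDiagram.mul X.V).comp x)) :=
      (congrArg ptrHom (RepZero.hom_comp (X := X ⊗ X) (Z := X ⊗ X) _ _)).trans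
        (ptrHom_hom (X := X) (Y := X) _)
    rw [h2, h3, CategoryTheory.Functor.map_id] at h1
    exact h1.symm
  rw [← SDiagram.ptr_mul_unitLeft]
  exact h _ SDiagram.unitLeft_mul

theorem diagram_fin_one (p : Diagram (Fin 1) (Fin 1)) :
    p = ⊥ ∨ p = Diagram.ofEquiv (Equiv.refl _) := by
  by_cases h : p (Sum.inl 0) (Sum.inr 0)
  · right
    ext x y
    have hx : ∀ z, p z (Sum.inr 0) := by
      rintro (z | z)
      · rwa [Subsingleton.elim z 0]
      · rw [Subsingleton.elim z 0]
    refine ⟨fun _ => Subsingleton.elim (α := Fin 1) _ _, fun _ => p.trans (hx x) (p.symm (hx y))⟩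
  · left
    ext x y
    rw [Setoid.bot_def]
    constructor
    · intro hxy
      rcases x with x | x <;> rcases y with y | y <;> rw [Subsingleton.elim x 0,
        Subsingleton.elim y 0] at *
      · exact absurd hxy h
      · exact absurd (p.symm hxy) h
    · rintro rfl
      exact p.refl x

theorem end_fin_one (f : (RepZero.of (Fin 1) : RepZero F t) ⟶ RepZero.of (Fin 1)) :
    ∃ a b : F, f = a • 𝟙 _ + b • RepZero.hom (.of (Fin 1)) (.of (Fin 1)) ⟨0, ⊥⟩ := by
  induction f using RepZero.hom_ind with
  | h0 => exact ⟨0, 0, by simp⟩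
  | hadd f g hf hg =>
    obtain ⟨a, b, rfl⟩ := hf
    obtain ⟨c, d, rfl⟩ := hg
    exact ⟨a + c, b + d, by simp only [add_smul]; abel⟩
  | hs c x =>
    have h : RepZero.hom (.of (Fin 1)) (.of (Fin 1)) x =
        t ^ x.exp • RepZero.hom (.of (Fin 1)) (.of (Fin 1)) ⟨0, x.diag⟩ := by
      change Finsupp.single _ _ = _ • Finsupp.single _ _
      rw [Finsupp.smul_single, smul_eq_mul, pow_zero, mul_one]
    rw [h, smul_smul]
    rcases diagram_fin_one x.diag with hx | hx
    · exact ⟨0, c * t ^ x.exp, by rw [hx, zero_smul, zero_add]⟩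
    · refine ⟨c * t ^ x.exp, 0, ?_⟩
      rw [hx, zero_smul, add_zero]
      rfl

/-- On `a • 𝟙 + b • ⊥` any trace equals `(a + b)` times its value on the identity, by `app_bot`. The
argument works for every parameter `t`. -/
theorem modTrace_unique (tr₁ tr₂ : ModTrace F (idealOf ((emb F t).obj (RepZero.of (Fin 1)))))
    (h : tr₁.dim _ (mem_idealOf _) = tr₂.dim _ (mem_idealOf _)) : tr₁ = tr₂ := by
  refine ModTrace.ext_of_generator _ _ (LinearMap.ext fun k => ?_)
  obtain ⟨f, rfl⟩ : ∃ f, (emb F t).map f = k := ⟨entry k PUnit.unit PUnit.unit, rfl⟩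
  obtain ⟨a, b, rfl⟩ := end_fin_one f
  have e : (emb F t).map (a • 𝟙 _ + b • RepZero.hom (.of (Fin 1)) (.of (Fin 1)) ⟨0, ⊥⟩) =
      a • 𝟙 _ + b • (emb F t).map (RepZero.hom (.of (Fin 1)) (.of (Fin 1)) ⟨0, ⊥⟩) := by
    rw [← (emb F t).map_id]
    rfl
  rw [e]
  have h1 := app_bot tr₁ (.of (Fin 1)) (mem_idealOf _)
  have h2 := app_bot tr₂ (.of (Fin 1)) (mem_idealOf _)
  rw [ModTrace.dim, ModTrace.dim] at h
  simp only [map_add, map_smul]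
  rw [h1, h2, h]

end RepS

/-! ### Diagrams that are not permutations. -/

theorem swap_rel_iff {Z : Type*} [DecidableEq Z] (r : Setoid Z) {i j : Z}
    (h : r i j ∨ (∀ z, r i z → z = i) ∧ ∀ z, r j z → z = j) (x y : Z) :
    r (Equiv.swap i j x) (Equiv.swap i j y) ↔ r x y := by
  have key : ∀ x y, r x y → r (Equiv.swap i j x) (Equiv.swap i j y) := by
    intro x y hxy
    -- Either the transposition moves points only within their part, or it exchanges two singleton
    -- parts.
    rcases h with h | ⟨hi, hj⟩
    · have hs : ∀ x, r (Equiv.swap i j x) x := by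
        intro x
        rw [Equiv.swap_apply_def]
        split_ifs with h1 h2
        · rw [h1]; exact r.symm h
        · rw [h2]; exact h
        · exact r.refl x
      exact r.trans (hs x) (r.trans hxy (r.symm (hs y)))
    · by_cases hx : x = i ∨ x = j ∨ y = i ∨ y = j
      · have : y = x := by
          rcases hx with rfl | rfl | rfl | rfl
          · exact hi _ hxy
          · exact hj _ hxy
          · exact (hi _ (r.symm hxy)).symm
          · exact (hj _ (r.symm hxy)).symm
        rw [this]
      · push Not at hx
        rwa [Equiv.swap_apply_of_ne_of_ne hx.1 hx.2.1, Equiv.swap_apply_of_ne_of_ne hx.2.2.1 hx.2.2.2]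
  refine ⟨fun hxy => ?_, key x y⟩
  have := key _ _ hxy
  rwa [Equiv.swap_apply_self, Equiv.swap_apply_self] at this

theorem Diagram.mat_congr {A B A' B' : Type} {p : Diagram A B} {q : Diagram A' B'} {f : A → Bool}
    {g : B → Bool} {f' : A' → Bool} {g' : B' → Bool}
    (h : p ≤ Setoid.ker (Sum.elim f g) ↔ q ≤ Setoid.ker (Sum.elim f' g')) :
    mat p f g = mat q f' g' := by
  unfold mat
  by_cases hp : p ≤ Setoid.ker (Sum.elim f g)
  · rw [if_pos hp, if_pos (h.1 hp)]
  · rw [if_neg hp, if_neg fun hq => hp (h.2 hq)]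

namespace SDiagram
variable {A B C : Type}

theorem comap_le_ker_iff {X Y Z : Type*} (r : Setoid Y) (e : X ≃ Y) (h : X → Z) :
    r.comap e ≤ Setoid.ker h ↔ r ≤ Setoid.ker (h ∘ e.symm) := by
  constructor
  · intro hle x y hxy
    refine hle (show r (e (e.symm x)) (e (e.symm y)) from ?_)
    rwa [e.apply_symm_apply, e.apply_symm_apply]
  · intro hle x y hxy
    have := hle (show r (e x) (e y) from hxy)
    change h (e.symm (e x)) = h (e.symm (e y)) at this
    rwa [e.symm_apply_apply, e.symm_apply_apply] at this

/-- Concatenation with a bijection only relabels vertices and creates no loops. This turns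
invariance of a partition under a transposition into an identity of diagrams. -/
theorem ofEquiv_comp_eq [Finite A] [Finite B] [Finite C] (e : A ≃ B) (x : SDiagram B C) :
    (ofEquiv e).comp x = ⟨x.exp, x.diag.comap (Equiv.sumCongr e (Equiv.refl C))⟩ := by
  apply val_injective
  ext f g
  rw [val_ofEquiv_comp]
  have h : Sum.elim f g ∘ (Equiv.sumCongr e (Equiv.refl C)).symm = Sum.elim (f ∘ e.symm) g := by
    ext (z | z) <;> rfl
  refine congrArg (fun m : ℕ => 2 ^ x.exp • m) (Diagram.mat_congr ?_)
  rw [← h]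
  exact (comap_le_ker_iff _ _ _).symm

theorem comp_ofEquiv_eq [Finite A] [Finite B] [Finite C] (x : SDiagram A B) (e : B ≃ C) :
    x.comp (ofEquiv e) = ⟨x.exp, x.diag.comap (Equiv.sumCongr (Equiv.refl A) e.symm)⟩ := by
  apply val_injective
  ext f g
  rw [val_comp_ofEquiv]
  have h : Sum.elim f g ∘ (Equiv.sumCongr (Equiv.refl A) e.symm).symm = Sum.elim f (g ∘ e) := by
    ext (z | z) <;> rfl
  refine congrArg (fun m : ℕ => 2 ^ x.exp • m) (Diagram.mat_congr ?_)
  rw [← h]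
  exact (comap_le_ker_iff _ _ _).symm

/-- The identity diagram with the strands in `S` cut. -/
def cut (S : Set A) [DecidablePred (· ∈ S)] : SDiagram A A :=
  ⟨0, Setoid.ker (Sum.elim (fun i => if i ∈ S then Sum.inl i else Sum.inr i) Sum.inr :
    A ⊕ A → A ⊕ A)⟩

open scoped Classical in
theorem val_cut (S : Set A) [DecidablePred (· ∈ S)] (f g : A → Bool) :
    (cut S).val f g = if ∀ i, i ∉ S → f i = g i then 1 else 0 := by
  have h : (cut S).diag ≤ Setoid.ker (Sum.elim f g) ↔ ∀ i, i ∉ S → f i = g i := by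
    constructor
    · intro h i hi
      refine h (show (cut S).diag (Sum.inl i) (Sum.inr i) from ?_)
      change (if i ∈ S then Sum.inl i else Sum.inr i) = Sum.inr i
      rw [if_neg hi]
    · intro h
      have e : Sum.elim f g = Sum.elim f g ∘
          Sum.elim (fun i => if i ∈ S then Sum.inl i else Sum.inr i) Sum.inr := by
        ext (i | i)
        · simp only [Function.comp_apply, Sum.elim_inl]
          split_ifs with hi
          · rfl
          · exact h i hi
        · rfl
      intro x y hxy
      change Sum.elim f g x = Sum.elim f g y
      rw [e]
      exact congrArg (Sum.elim f g) hxy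
  change 2 ^ 0 • (if (cut S).diag ≤ Setoid.ker (Sum.elim f g) then 1 else 0) = _
  simp only [h, pow_zero, one_smul]

variable [DecidableEq A]

theorem ofEquiv_comp_cut [Finite A] (e : A ≃ A) (a : A) :
    (ofEquiv e).comp (cut {a}) = (cut {e.symm a}).comp (ofEquiv e) := by
  classical
  apply val_injective
  ext f g
  rw [val_ofEquiv_comp, val_comp_ofEquiv, val_cut, val_cut]
  congr 1
  refine propext ⟨fun h i hi => ?_, fun h i hi => ?_⟩
  · have := h (e i) (fun h' => hi (by rw [Set.mem_singleton_iff] at *; rw [← h', e.symm_apply_apply]))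
    rwa [Function.comp_apply, e.symm_apply_apply] at this
  · have := h (e.symm i) (fun h' => hi (e.symm.injective h'))
    rwa [Function.comp_apply, e.apply_symm_apply] at this

theorem val_cut_comp [Finite A] [Finite B] (a : A) (y : SDiagram A B) (f : A → Bool)
    (g : B → Bool) : ((cut {a}).comp y).val f g = ∑ c : Bool, y.val (Function.update f a c) g := by
  classical
  cases nonempty_fintype A
  rw [val_comp, Matrix.mul_apply]
  symm
  refine Fintype.sum_of_injective (fun c => Function.update f a c) ?_ _ _ ?_ ?_
  · exact Function.update_injective f a
  · intro k hk
    rw [val_cut, if_neg, zero_mul]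
    intro h
    refine hk ⟨k a, funext fun i => ?_⟩
    by_cases hi : i = a
    · subst hi
      exact Function.update_self _ _ _
    · exact (Function.update_of_ne hi _ _).trans (h i hi)
  · intro c
    rw [val_cut, if_pos, one_mul]
    intro i hi
    exact (Function.update_of_ne hi _ _).symm

/-- The middle vertex `a` is isolated, giving one loop and hence a factor `t`. At `t = 0` the square
of a cut vanishes. -/
theorem cut_comp_cut_self [Finite A] (a : A) :
    (cut {a}).comp (cut {a}) = ⟨1, (cut {a}).diag⟩ := by
  classical
  apply val_injective
  ext f g
  have h : ∀ c : Bool, (cut {a}).val (Function.update f a c) g = (cut {a}).val f g := by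
    intro c
    rw [val_cut, val_cut]
    congr 1
    refine propext (forall₂_congr fun i hi => ?_)
    rw [Function.update_of_ne hi]
  rw [val_cut_comp]
  simp only [h, Finset.sum_const, Finset.card_univ, Fintype.card_bool]
  simp [val, cut]

/-- After both cuts the top vertices `a` and `b` are singletons, so exchanging them changes nothing.
-/
theorem swap_comp_cut_comp_cut [Finite A] {a b : A} (hab : a ≠ b) :
    (ofEquiv (Equiv.swap a b)).comp ((cut {a}).comp (cut {b})) = (cut {a}).comp (cut {b}) := by
  classical
  apply val_injective
  ext f g
  rw [val_ofEquiv_comp, val_cut_comp, val_cut_comp]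
  refine Finset.sum_congr rfl fun c _ => ?_
  rw [val_cut, val_cut]
  congr 1
  refine propext (forall₂_congr fun i hi => ?_)
  by_cases hia : i = a
  · subst hia
    rw [Function.update_self, Function.update_self]
  · rw [Function.update_of_ne hia, Function.update_of_ne hia, Function.comp_apply,
      Equiv.symm_swap, Equiv.swap_apply_of_ne_of_ne hia hi]

/-- A diagram that is not a permutation is fixed by a transposition on one side, or it is a
permutation diagram with one strand cut. -/
theorem fixed_or_cut [Finite A] (p : Diagram A A) (hp : ∀ σ : A ≃ A, p ≠ Diagram.ofEquiv σ) :
    (∃ i j : A, i ≠ j ∧ (ofEquiv (Equiv.swap i j)).comp ⟨0, p⟩ = ⟨0, p⟩) ∨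
    (∃ i j : A, i ≠ j ∧ SDiagram.comp ⟨0, p⟩ (ofEquiv (Equiv.swap i j)) = ⟨0, p⟩) ∨
    ∃ (a : A) (σ : A ≃ A), (⟨0, p⟩ : SDiagram A A) = (cut {a}).comp (ofEquiv σ) := by
  classical
  rw [or_iff_not_imp_left]
  intro hT
  rw [or_iff_not_imp_left]
  intro hB
  -- Without a fixing transposition on top, no two top vertices are joined and at most one of them
  -- is isolated. On the bottom side it is enough that no two vertices are joined.
  have hT' : ∀ i j : A, i ≠ j → ¬ (p (Sum.inl i) (Sum.inl j) ∨
      (∀ z, p (Sum.inl i) z → z = Sum.inl i) ∧ ∀ z, p (Sum.inl j) z → z = Sum.inl j) := by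
    intro i j hij h
    refine hT ⟨i, j, hij, ?_⟩
    rw [ofEquiv_comp_eq]
    congr 1
    ext x y
    rw [← swap_rel_iff p h x y, ← Equiv.Perm.sumCongr_swap_refl]
    rfl
  have hB' : ∀ i j : A, i ≠ j → ¬ p (Sum.inr i) (Sum.inr j) := by
    intro i j hij h
    refine hB ⟨i, j, hij, ?_⟩
    rw [comp_ofEquiv_eq]
    congr 1
    ext x y
    rw [← swap_rel_iff p (Or.inl h) x y, ← Equiv.Perm.sumCongr_refl_swap]
    rfl
  have top : ∀ i j : A, p (Sum.inl i) (Sum.inl j) ↔ i = j := fun i j =>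
    ⟨fun h => by_contra fun hij => hT' i j hij (Or.inl h), fun h => h ▸ p.refl _⟩
  have bot : ∀ i j : A, p (Sum.inr i) (Sum.inr j) ↔ i = j := fun i j =>
    ⟨fun h => by_contra fun hij => hB' i j hij h, fun h => h ▸ p.refl _⟩
  -- The top vertices whose strand reaches the bottom. The partner is unique, so `p` is the graph of
  -- an injection `φ` defined on `D`.
  let D : A → Prop := fun i => ∃ j, p (Sum.inl i) (Sum.inr j)
  let φ : {i // D i} → A := fun i => i.2.choose
  have hφ : ∀ i : {i // D i}, p (Sum.inl i.1) (Sum.inr (φ i)) := fun i => i.2.choose_spec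
  have hinj : Function.Injective φ := by
    intro i j hij
    refine Subtype.ext ((top _ _).1 (p.trans (hφ i) ?_))
    rw [hij]
    exact p.symm (hφ j)
  cases nonempty_fintype A
  -- By finiteness the complements of the domain and the range of `φ` have equal size, so the
  -- partial matching extends to a permutation.
  let σ : A ≃ A := (Equiv.ofInjective φ hinj).extendSubtype (p := D) (q := (· ∈ Set.range φ))
  have hσ : ∀ i, D i → p (Sum.inl i) (Sum.inr (σ i)) := by
    intro i hi
    have : σ i = φ ⟨i, hi⟩ := Equiv.extendSubtype_apply_of_mem _ i hi
    rw [this]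
    exact hφ ⟨i, hi⟩
  have hR : ∀ i j, p (Sum.inl i) (Sum.inr j) ↔ D i ∧ σ i = j := by
    intro i j
    refine ⟨fun h => ⟨⟨j, h⟩, (bot _ _).1 (p.trans (p.symm (hσ i ⟨j, h⟩)) h)⟩, ?_⟩
    rintro ⟨h, rfl⟩
    exact hσ i h
  have hS : ∃ a, ¬ D a := by
    by_contra! hD
    refine hp σ ?_
    ext x y
    rcases x with i | i <;> rcases y with j | j
    · exact (top i j).trans σ.injective.eq_iff.symm
    · exact (hR i j).trans (and_iff_right (hD i))
    · exact (Setoid.comm' p).trans ((hR j i).trans ((and_iff_right (hD j)).trans eq_comm))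
    · exact bot i j
  obtain ⟨a, ha⟩ := hS
  -- A second unmatched top vertex would, together with `a`, form a pair of isolated vertices, which
  -- `hT'` excludes.
  have hDa : ∀ i, D i ↔ i ≠ a := by
    intro i
    refine ⟨fun h hia => ha (hia ▸ h), fun hia => by_contra fun h => hT' i a hia (Or.inr ⟨?_, ?_⟩)⟩
    · rintro (z | z) hz
      · rw [(top _ _).1 hz]
      · exact absurd ⟨z, hz⟩ h
    · rintro (z | z) hz
      · rw [(top _ _).1 hz]
      · exact absurd ⟨z, hz⟩ ha
  refine ⟨a, σ, ?_⟩
  rw [comp_ofEquiv_eq]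
  have key : ∀ i j : A, p (Sum.inl i) (Sum.inr j) ↔
      (if i ∈ ({a} : Set A) then Sum.inl i else Sum.inr i) = (Sum.inr (σ.symm j) : A ⊕ A) := by
    intro i j
    rw [hR, hDa]
    by_cases hi : i = a
    · subst hi
      simp
    · rw [if_neg (show i ∉ ({a} : Set A) from hi), Sum.inr.injEq, Equiv.eq_symm_apply]
      exact and_iff_right hi
  change SDiagram.mk 0 p = SDiagram.mk 0 _
  congr 1
  ext x y
  rcases x with i | i <;> rcases y with j | j
  · refine (top i j).trans ?_
    change i = j ↔ (if i ∈ ({a} : Set A) then Sum.inl i else Sum.inr i) =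
      (if j ∈ ({a} : Set A) then Sum.inl j else Sum.inr j : A ⊕ A)
    refine ⟨fun h => by rw [h], fun h => ?_⟩
    split_ifs at h
    · exact Sum.inl_injective h
    · exact Sum.inr_injective h
  · exact key i j
  · exact (Setoid.comm' p).trans ((key j i).trans eq_comm)
  · refine (bot i j).trans ?_
    change i = j ↔ (Sum.inr (σ.symm i) : A ⊕ A) = Sum.inr (σ.symm j)
    rw [Sum.inr.injEq, σ.symm.injective.eq_iff]

end SDiagram

theorem Diagram.ofEquiv_injective {A B : Type} :
    Function.Injective (Diagram.ofEquiv : A ≃ B → Diagram A B) := by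
  intro e e' h
  ext i
  have h1 : Diagram.ofEquiv e' (Sum.inl i) (Sum.inr (e i)) := by
    rw [← h]
    exact (rfl : e i = e i)
  exact h1.symm

/-! ### The antisymmetrizer and the primitive idempotents of sign type. -/

namespace RepZero

variable {F : Type u} [Field F] {n : ℕ}

/-- The object `[n]` at parameter zero. -/
noncomputable abbrev obj (F : Type u) [Field F] (n : ℕ) : RepZero F 0 := of (Fin n)

/-- The endomorphism of `[n]` given by a scaled diagram. -/
noncomputable abbrev endo (F : Type u) [Field F] {n : ℕ} (x : SDiagram (Fin n) (Fin n)) :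
    obj F n ⟶ obj F n := hom (obj F n) (obj F n) x

/-- The sign of a permutation as a scalar. -/
def sgn (F : Type u) [Field F] {n : ℕ} (σ : Equiv.Perm (Fin n)) : F :=
  ((Equiv.Perm.sign σ : ℤ) : F)

theorem sgn_mul (σ τ : Equiv.Perm (Fin n)) : sgn F (σ * τ) = sgn F σ * sgn F τ := by
  simp [sgn]

theorem sgn_mul_self (σ : Equiv.Perm (Fin n)) : sgn F σ * sgn F σ = 1 := by
  rw [sgn, ← Int.cast_mul, Int.units_coe_mul_self, Int.cast_one]

theorem sgn_swap {i j : Fin n} (h : i ≠ j) : sgn F (Equiv.swap i j) = -1 := by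
  simp [sgn, Equiv.Perm.sign_swap h]

/-- The endomorphism of `[n]` given by a permutation. -/
noncomputable abbrev perm (F : Type u) [Field F] {n : ℕ} (σ : Equiv.Perm (Fin n)) :
    obj F n ⟶ obj F n := endo F (SDiagram.ofEquiv σ)

/-- The product is reversed because categorical composition applies `σ` first. -/
theorem perm_comp (σ τ : Equiv.Perm (Fin n)) : perm F σ ≫ perm F τ = perm F (τ * σ) := by
  rw [perm, perm, hom_comp, SDiagram.ofEquiv_comp_ofEquiv]
  rfl

theorem perm_one : perm F (1 : Equiv.Perm (Fin n)) = 𝟙 _ := rfl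

/-- The antisymmetrizer of `[n]`. -/
noncomputable def alt (F : Type u) [Field F] (n : ℕ) : obj F n ⟶ obj F n :=
  (n.factorial : F)⁻¹ • ∑ σ : Equiv.Perm (Fin n), sgn F σ • perm F σ

theorem perm_comp_alt (τ : Equiv.Perm (Fin n)) : perm F τ ≫ alt F n = sgn F τ • alt F n := by
  rw [alt, Linear.comp_smul, Preadditive.comp_sum, smul_comm (sgn F τ),
    Finset.smul_sum (r := sgn F τ)]
  congr 1
  refine Fintype.sum_equiv (Equiv.mulRight τ) _ _ fun σ => ?_
  rw [Linear.comp_smul, perm_comp, Equiv.coe_mulRight, sgn_mul, smul_smul, mul_left_comm,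
    sgn_mul_self, mul_one]

theorem alt_comp_perm (τ : Equiv.Perm (Fin n)) : alt F n ≫ perm F τ = sgn F τ • alt F n := by
  rw [alt, Linear.smul_comp, Preadditive.sum_comp, smul_comm (sgn F τ),
    Finset.smul_sum (r := sgn F τ)]
  congr 1
  refine Fintype.sum_equiv (Equiv.mulLeft τ) _ _ fun σ => ?_
  rw [Linear.smul_comp, perm_comp, Equiv.coe_mulLeft, sgn_mul, smul_smul, ← mul_assoc,
    sgn_mul_self, one_mul]

/-- The signed sum of the coefficients of the permutation diagrams. -/
noncomputable def signSum (F : Type u) [Field F] (n : ℕ) : (obj F n ⟶ obj F n) →ₗ[F] F :=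
  (∑ σ : Equiv.Perm (Fin n), sgn F σ • Finsupp.lapply (Diagram.ofEquiv σ) :
    (Diagram (Fin n) (Fin n) →₀ F) →ₗ[F] F)

theorem signSum_apply (f : Diagram (Fin n) (Fin n) →₀ F) :
    signSum F n f = ∑ σ : Equiv.Perm (Fin n), sgn F σ * f (Diagram.ofEquiv σ) := by
  change (∑ σ : Equiv.Perm (Fin n), sgn F σ • Finsupp.lapply (R := F) (Diagram.ofEquiv σ)) f = _
  simp only [LinearMap.sum_apply, LinearMap.smul_apply, Finsupp.lapply_apply, smul_eq_mul]

theorem signSum_perm (τ : Equiv.Perm (Fin n)) : signSum F n (perm F τ) = sgn F τ := by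
  refine (signSum_apply _).trans ?_
  rw [Finset.sum_eq_single τ]
  · change _ * Finsupp.single (Diagram.ofEquiv τ) _ _ = _
    rw [Finsupp.single_eq_same, SDiagram.ofEquiv, pow_zero, mul_one]
  · intro σ _ h
    change _ * Finsupp.single (Diagram.ofEquiv τ) _ _ = _
    rw [Finsupp.single_eq_of_ne, mul_zero]
    exact fun h' => h (Diagram.ofEquiv_injective h')
  · simp

theorem signSum_endo (p : Diagram (Fin n) (Fin n)) (hp : ∀ σ, p ≠ Diagram.ofEquiv σ) :
    signSum F n (endo F ⟨0, p⟩) = 0 := by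
  refine (signSum_apply _).trans (Finset.sum_eq_zero fun σ _ => ?_)
  change _ * Finsupp.single p _ _ = _
  rw [Finsupp.single_eq_of_ne, mul_zero]
  exact fun h' => hp σ h'.symm

theorem endo_exp (x : SDiagram (Fin n) (Fin n)) :
    hom (obj F n) (obj F n) x = (0 : F) ^ x.exp • endo F ⟨0, x.diag⟩ := by
  change Finsupp.single _ _ = _ • Finsupp.single _ _
  rw [Finsupp.smul_single, smul_eq_mul, pow_zero, mul_one]

theorem alt_comp_eq (f : obj F n ⟶ obj F n) :
    alt F n ≫ f = (n.factorial : F)⁻¹ • ∑ σ : Equiv.Perm (Fin n), sgn F σ • (perm F σ ≫ f) := by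
  simp only [alt, Linear.smul_comp, Preadditive.sum_comp]

variable [CharZero F]

theorem alt_idem : alt F n ≫ alt F n = alt F n := by
  rw [alt_comp_eq]
  simp only [perm_comp_alt, smul_smul, sgn_mul_self, one_smul]
  rw [Finset.sum_const, Finset.card_univ, Fintype.card_perm, Fintype.card_fin,
    ← Nat.cast_smul_eq_nsmul F, smul_smul, inv_mul_cancel₀ (by exact_mod_cast n.factorial_ne_zero),
    one_smul]

theorem signSum_alt : signSum F n (alt F n) = 1 := by
  rw [alt, map_smul, map_sum]
  simp only [map_smul, signSum_perm, smul_eq_mul, sgn_mul_self]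
  rw [Finset.sum_const, Finset.card_univ, Fintype.card_perm, Fintype.card_fin, nsmul_one,
    inv_mul_cancel₀ (by exact_mod_cast n.factorial_ne_zero)]

theorem alt_ne_zero : alt F n ≠ 0 := by
  intro h
  have := signSum_alt (F := F) (n := n)
  rw [h, map_zero] at this
  exact zero_ne_one this

theorem eq_zero_of_eq_neg {V : Type*} [AddCommGroup V] [Module F V] {x : V} (h : x = -x) :
    x = 0 := by
  have h2 : (2 : F) • x = 0 := by
    rw [two_smul]
    nth_rw 1 [h]
    exact neg_add_cancel x
  exact (smul_eq_zero.1 h2).resolve_left two_ne_zero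

/-- The antisymmetrizer absorbs the transposition with sign `-1`, so the composite equals its own
negative. -/
theorem alt_comp_eq_zero {f : obj F n ⟶ obj F n} {i j : Fin n} (hij : i ≠ j)
    (h : perm F (Equiv.swap i j) ≫ f = f) : alt F n ≫ f = 0 := by
  have h1 : alt F n ≫ f = -(alt F n ≫ f) := by
    conv_lhs => rw [← h, ← Category.assoc, alt_comp_perm, sgn_swap hij, neg_smul, one_smul,
      Preadditive.neg_comp]
  exact eq_zero_of_eq_neg (F := F) h1

theorem comp_alt_eq_zero {f : obj F n ⟶ obj F n} {i j : Fin n} (hij : i ≠ j)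
    (h : f ≫ perm F (Equiv.swap i j) = f) : f ≫ alt F n = 0 := by
  have h1 : f ≫ alt F n = -(f ≫ alt F n) := by
    conv_lhs => rw [← h, Category.assoc, perm_comp_alt, sgn_swap hij, neg_smul, one_smul,
      Preadditive.comp_neg]
  exact eq_zero_of_eq_neg (F := F) h1

/-- The identity of `[n]` with one strand cut. -/
noncomputable abbrev cutEnd (F : Type u) [Field F] {n : ℕ} (a : Fin n) : obj F n ⟶ obj F n :=
  endo F (SDiagram.cut {a})

/-- The parameter `t = 0` enters for `a = b`, where a loop appears; for `a ≠ b` antisymmetry alone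
gives zero. -/
theorem alt_cut_cut (a b : Fin n) : alt F n ≫ cutEnd F a ≫ cutEnd F b = 0 := by
  by_cases hab : a = b
  · subst hab
    rw [cutEnd, hom_comp, SDiagram.cut_comp_cut_self, endo_exp, pow_one, zero_smul,
      Limits.comp_zero]
  · refine alt_comp_eq_zero hab ?_
    rw [cutEnd, cutEnd, hom_comp, hom_comp, SDiagram.swap_comp_cut_comp_cut hab]

/-- In each term of the inner antisymmetrizer the permutation moves past the second cut, changing
only its position; then `alt_cut_cut` applies. This makes the radical of `s P s` square to zero. -/
theorem alt_cut_alt_cut (a b : Fin n) : alt F n ≫ cutEnd F a ≫ alt F n ≫ cutEnd F b = 0 := by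
  have h : ∀ σ : Equiv.Perm (Fin n),
      perm F σ ≫ cutEnd F b = cutEnd F (σ.symm b) ≫ perm F σ := by
    intro σ
    rw [perm, hom_comp, cutEnd, hom_comp, SDiagram.ofEquiv_comp_cut]
  rw [alt_comp_eq (cutEnd F b), Linear.comp_smul, Linear.comp_smul, Preadditive.comp_sum, Preadditive.comp_sum,
    Finset.sum_eq_zero, smul_zero]
  intro σ _
  rw [Linear.comp_smul, Linear.comp_smul, h, ← Category.assoc, ← Category.assoc]
  have := alt_cut_cut (F := F) a (σ.symm b)
  rw [← Category.assoc] at this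
  rw [this, Limits.zero_comp, smul_zero]

/-- By linearity it suffices to treat single diagrams. Permutations contribute a sign, diagrams
fixed by a transposition contribute zero, and a cut permutation contributes a multiple of one cut
between antisymmetrizers. -/
theorem exists_alt_conj (f : obj F n ⟶ obj F n) : ∃ c : Fin n → F,
    alt F n ≫ f ≫ alt F n =
      signSum F n f • alt F n + ∑ a, c a • (alt F n ≫ cutEnd F a ≫ alt F n) := by
  induction f using hom_ind with
  | h0 => exact ⟨0, by simp⟩
  | hadd f g hf hg =>
    obtain ⟨c, hc⟩ := hf
    obtain ⟨d, hd⟩ := hg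
    refine ⟨c + d, ?_⟩
    rw [Preadditive.add_comp, Preadditive.comp_add, hc, hd, map_add]
    simp only [add_smul, Pi.add_apply, Finset.sum_add_distrib]
    abel
  | hs k x =>
    have key : ∃ c : Fin n → F, alt F n ≫ endo F ⟨0, x.diag⟩ ≫ alt F n =
        signSum F n (endo F ⟨0, x.diag⟩) • alt F n +
          ∑ a, c a • (alt F n ≫ cutEnd F a ≫ alt F n) := by
      by_cases hp : ∃ σ, x.diag = Diagram.ofEquiv σ
      · obtain ⟨σ, hσ⟩ := hp
        refine ⟨0, ?_⟩
        have h : endo F ⟨0, x.diag⟩ = perm F σ := by rw [hσ]; rfl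
        rw [h, signSum_perm, perm_comp_alt, Linear.comp_smul, alt_idem]
        simp
      · push Not at hp
        simp only [signSum_endo _ hp, zero_smul, zero_add]
        rcases SDiagram.fixed_or_cut x.diag hp with ⟨i, j, hij, h⟩ | ⟨i, j, hij, h⟩ | ⟨a, σ, h⟩
        · refine ⟨0, ?_⟩
          rw [← Category.assoc, alt_comp_eq_zero hij (by rw [hom_comp, h])]
          simp
        · refine ⟨0, ?_⟩
          rw [comp_alt_eq_zero hij (by rw [hom_comp, h])]
          simp
        -- The right-hand antisymmetrizer absorbs `σ` and leaves its sign.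
        · refine ⟨Pi.single a (sgn F σ), ?_⟩
          rw [h, endo, ← hom_comp (Y := obj F n), Category.assoc, perm_comp_alt, Linear.comp_smul,
            Linear.comp_smul, Finset.sum_eq_single a]
          · rw [Pi.single_eq_same]
          · intro b _ hb
            rw [Pi.single_eq_of_ne hb, zero_smul]
          · simp
    obtain ⟨c, hc⟩ := key
    refine ⟨fun a => k * 0 ^ x.exp * c a, ?_⟩
    rw [endo_exp, smul_smul, map_smul, Linear.smul_comp, Linear.comp_smul, hc, smul_add, smul_smul,
      Finset.smul_sum]
    simp only [smul_smul, smul_eq_mul]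

/-- The algebra `s P s`, for the antisymmetrizer `s`, is local with square zero radical. -/
theorem alt_conj (f : obj F n ⟶ obj F n) : ∃ y : obj F n ⟶ obj F n,
    alt F n ≫ f ≫ alt F n = signSum F n f • alt F n + y ∧ alt F n ≫ y = y ∧ y ≫ alt F n = y ∧
      y ≫ y = 0 := by
  obtain ⟨c, hc⟩ := exists_alt_conj f
  refine ⟨_, hc, ?_, ?_, ?_⟩
  · simp only [Preadditive.comp_sum, Linear.comp_smul]
    simp only [← Category.assoc, alt_idem]
  · simp only [Preadditive.sum_comp, Linear.smul_comp, Category.assoc, alt_idem]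
  · rw [Preadditive.sum_comp]
    refine Finset.sum_eq_zero fun a _ => ?_
    rw [Preadditive.comp_sum]
    refine Finset.sum_eq_zero fun b _ => ?_
    have h : (alt F n ≫ cutEnd F a ≫ alt F n) ≫ alt F n ≫ cutEnd F b ≫ alt F n =
        (alt F n ≫ cutEnd F a ≫ alt F n ≫ cutEnd F b) ≫ alt F n := by
      simp only [Category.assoc]
      rw [← Category.assoc (alt F n) (alt F n), alt_idem]
    rw [Linear.smul_comp, Linear.comp_smul, h, alt_cut_alt_cut, Limits.zero_comp, smul_zero,
      smul_zero]

/-- A summand `a` of `s` lies in `s P s`, so `a = α s + y` with `y` of square zero. Idempotency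
forces `α` to be `0` or `1` and `y = 0`. -/
theorem isPrimitiveIdem_alt : IsPrimitiveIdem (alt F n) := by
  refine ⟨alt_idem, alt_ne_zero, fun a b ha hb hab hba hsum => ?_⟩
  have h1 : alt F n ≫ a = a := by rw [← hsum, Preadditive.add_comp, ha, hba, add_zero]
  have h2 : a ≫ alt F n = a := by rw [← hsum, Preadditive.comp_add, ha, hab, add_zero]
  obtain ⟨y, hy, hsy, hys, hyy⟩ := alt_conj a
  rw [h2, h1] at hy
  generalize signSum F n a = α at hy
  have hsq : α • α • alt F n + α • y + α • y = α • alt F n + y := by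
    have h := ha
    rw [hy] at h
    simp only [Preadditive.add_comp, Preadditive.comp_add, Linear.smul_comp, Linear.comp_smul,
      alt_idem, hsy, hys, hyy, add_zero] at h
    rw [← h]
    module
  have hd : (α * α - α) • alt F n = (1 - 2 * α) • y := by
    have : (α * α - α) • alt F n - (1 - 2 * α) • y =
        (α • α • alt F n + α • y + α • y) - (α • alt F n + y) := by module
    rw [← sub_eq_zero, this, hsq, sub_self]
  -- Squaring removes the nilpotent part, so linear independence of `s` and `y` is not needed.
  have h0 : (α * α - α) * (α * α - α) = 0 := by
    have h : ((α * α - α) • alt F n) ≫ ((α * α - α) • alt F n) = 0 := by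
      rw [hd, Linear.smul_comp, Linear.comp_smul, hyy, smul_zero, smul_zero]
    rw [Linear.smul_comp, Linear.comp_smul, alt_idem, smul_smul] at h
    exact (smul_eq_zero.1 h).resolve_right alt_ne_zero
  have hα : α * α - α = 0 := mul_self_eq_zero.1 h0
  rw [hα, zero_smul] at hd
  have hy0 : y = 0 := by
    refine (smul_eq_zero.1 hd.symm).resolve_left fun h => ?_
    -- Uses `(1 - 2α)² - 4(α² - α) = 1`: the factor `1 - 2α` is invertible when `α` is idempotent.
    have : (1 : F) = 0 := by linear_combination (1 - 2 * α) * h - 4 * hα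
    exact one_ne_zero this
  rw [hy0, add_zero] at hy
  have : α = 0 ∨ α = 1 := by
    have : α * (α - 1) = 0 := by linear_combination hα
    exact (mul_eq_zero.1 this).imp_right sub_eq_zero.1
  rcases this with h | h
  · left
    rw [hy, h, zero_smul]
  · right
    rw [h, one_smul] at hy
    rw [hy] at hsum
    simpa using hsum

/-- A primitive idempotent with nonzero signed sum of permutation coefficients splits off the
antisymmetrizer. -/
theorem exists_factorization {e : obj F n ⟶ obj F n} (he : IsPrimitiveIdem e)
    (h : signSum F n e ≠ 0) : ∃ a b : obj F n ⟶ obj F n, a ≫ b = alt F n ∧ b ≫ a = e ∧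
      alt F n ≫ a = a ∧ a ≫ e = a ∧ e ≫ b = b ∧ b ≫ alt F n = b := by
  obtain ⟨y, hy, hsy, hys, hyy⟩ := alt_conj e
  generalize signSum F n e = α at *
  obtain ⟨hee, -, hprim⟩ := he
  -- The inverse of `s e s = α s + y` in `s P s`, a geometric series that stops because `y ≫ y = 0`.
  let w := α⁻¹ • alt F n - (α⁻¹ * α⁻¹) • y
  have hsw : alt F n ≫ w = w := by
    simp only [w, Preadditive.comp_sub, Linear.comp_smul, alt_idem, hsy]
  have hws : w ≫ alt F n = w := by
    simp only [w, Preadditive.sub_comp, Linear.smul_comp, alt_idem, hys]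
  have hsesw : (alt F n ≫ e) ≫ e ≫ w = alt F n := by
    have h1 : (alt F n ≫ e) ≫ e ≫ w = (alt F n ≫ e ≫ alt F n) ≫ w := by
      simp only [Category.assoc, hsw]
      rw [← Category.assoc e e, hee]
    rw [h1, hy]
    simp only [w, Preadditive.add_comp, Preadditive.comp_sub, Linear.smul_comp, Linear.comp_smul,
      alt_idem, hsy, hys, hyy]
    rw [add_zero, smul_add, smul_smul, smul_smul, inv_mul_cancel₀ h, one_smul, mul_assoc,
      inv_mul_cancel₀ h, mul_one]
    abel
  set a := alt F n ≫ e with ha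
  set b := e ≫ w with hb
  have hae : a ≫ e = a := by rw [ha, Category.assoc, hee]
  have heb : e ≫ b = b := by rw [hb, ← Category.assoc, hee]
  have hsa : alt F n ≫ a = a := by rw [ha, ← Category.assoc, alt_idem]
  have hbs : b ≫ alt F n = b := by rw [hb, Category.assoc, hws]
  have hi : (b ≫ a) ≫ b ≫ a = b ≫ a := by
    rw [Category.assoc, ← Category.assoc a b, hsesw, hsa]
  have hei : e ≫ b ≫ a = b ≫ a := by rw [← Category.assoc, heb]
  have hie : (b ≫ a) ≫ e = b ≫ a := by rw [Category.assoc, hae]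
  refine ⟨a, b, hsesw, ?_, hsa, hae, heb, hbs⟩
  -- The idempotent `b ≫ a` is a summand of `e`. It cannot vanish, as then `s` would, so by
  -- primitivity it is all of `e`.
  rcases hprim (b ≫ a) (e - b ≫ a) hi
    (by rw [Preadditive.sub_comp, Preadditive.comp_sub, Preadditive.comp_sub, hee, hei, hie, hi]; abel)
    (by rw [Preadditive.comp_sub, hie, hi, sub_self])
    (by rw [Preadditive.sub_comp, hei, hi, sub_self]) (by abel) with h0 | h0
  · exfalso
    have : alt F n = 0 := by
      rw [← alt_idem, ← hsesw, Category.assoc, ← Category.assoc b, h0, Limits.zero_comp,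
        Limits.comp_zero]
    exact alt_ne_zero this
  · exact (sub_eq_zero.1 h0).symm

end RepZero

/-! ### The Young symmetrizer of a column and the sign character. -/

section column

theorem mem_columnDiagram {n : ℕ} {c : ℕ × ℕ} : c ∈ columnDiagram n ↔ c.1 < n ∧ c.2 = 0 := by
  rw [columnDiagram, YoungDiagram.mem_ofRowLens]
  simp

/-- The standard numbering of a column. -/
def columnTableau (n : ℕ) : Fin n ≃ (columnDiagram n).cells where
  toFun i := ⟨(i, 0), (YoungDiagram.mem_cells _).2 (mem_columnDiagram.2 ⟨i.2, rfl⟩)⟩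
  invFun c := ⟨c.1.1, (mem_columnDiagram.1 ((YoungDiagram.mem_cells _).1 c.2)).1⟩
  left_inv _ := rfl
  right_inv c := Subtype.ext (Prod.ext rfl
    (mem_columnDiagram.1 ((YoungDiagram.mem_cells _).1 c.2)).2.symm)

variable {F : Type u} [Field F] {n m : ℕ}

/-- In a single column the row stabiliser is trivial and the column stabiliser is the whole
symmetric group. -/
theorem youngSymmetrizer_column (T : Fin m ≃ (columnDiagram n).cells) :
    youngSymmetrizer F T =
      ∑ σ : Equiv.Perm (Fin m), MonoidAlgebra.single σ (RepZero.sgn F σ) := by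
  have h2 : ∀ i, (T i).1.2 = 0 := fun i =>
    (mem_columnDiagram.1 ((YoungDiagram.mem_cells _).1 (T i).2)).2
  have h1 : ∀ i j, (T i).1.1 = (T j).1.1 → i = j := fun i j h =>
    T.injective (Subtype.ext (Prod.ext h ((h2 i).trans (h2 j).symm)))
  have e1 : (∑ p : {p : Equiv.Perm (Fin m) // ∀ i, (T (p i)).1.1 = (T i).1.1},
      MonoidAlgebra.single p.1 (1 : F)) = 1 := by
    rw [Finset.sum_eq_single ⟨1, fun _ => rfl⟩]
    · rfl
    · rintro ⟨p, hp⟩ _ hne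
      exact absurd (Subtype.ext (Equiv.ext fun i => h1 _ _ (hp i))) hne
    · simp
  rw [youngSymmetrizer, e1, one_mul]
  exact Fintype.sum_equiv (Equiv.subtypeUnivEquiv fun q i => by rw [h2, h2]) _ _ fun q => rfl

/-- The sign character of the group algebra. -/
noncomputable def signChar (F : Type u) [Field F] (m : ℕ) :
    MonoidAlgebra F (Equiv.Perm (Fin m)) →ₐ[F] F :=
  MonoidAlgebra.lift F F (Equiv.Perm (Fin m))
    { toFun := RepZero.sgn F
      map_one' := by simp [RepZero.sgn]
      map_mul' := RepZero.sgn_mul }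

theorem signChar_single (σ : Equiv.Perm (Fin m)) (c : F) :
    signChar F m (MonoidAlgebra.single σ c) = c * RepZero.sgn F σ := by
  rw [signChar, MonoidAlgebra.lift_single]
  rfl

theorem signChar_permPart (e : RepZero.obj F m ⟶ RepZero.obj F m) :
    signChar F m (permPart e) = RepZero.signSum F m e := by
  refine Eq.trans ?_ (RepZero.signSum_apply e).symm
  rw [permPart, map_sum]
  refine Finset.sum_congr rfl fun σ _ => ?_
  rw [signChar_single, mul_comm]

/-- The signed sum spans a copy of the sign representation, so the group algebra acts on it through
`signChar`. -/
theorem mul_signed_sum (z : MonoidAlgebra F (Equiv.Perm (Fin m))) :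
    z * ∑ σ : Equiv.Perm (Fin m), MonoidAlgebra.single σ (RepZero.sgn F σ) =
      signChar F m z • ∑ σ : Equiv.Perm (Fin m), MonoidAlgebra.single σ (RepZero.sgn F σ) := by
  induction z using MonoidAlgebra.induction_linear with
  | zero => simp
  | add f g hf hg => rw [add_mul, hf, hg, map_add, add_smul]
  | single τ c =>
    rw [signChar_single, Finset.mul_sum, Finset.smul_sum]
    refine Fintype.sum_equiv (Equiv.mulLeft τ) _ _ fun σ => ?_
    rw [MonoidAlgebra.single_mul_single, Equiv.coe_mulLeft, MonoidAlgebra.smul_single,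
      RepZero.sgn_mul, smul_eq_mul, mul_assoc, ← mul_assoc (RepZero.sgn F τ), RepZero.sgn_mul_self,
      one_mul]

theorem signed_sum_ne_zero [CharZero F] :
    (∑ σ : Equiv.Perm (Fin m), MonoidAlgebra.single σ (RepZero.sgn F σ)) ≠ 0 := by
  intro h
  have h1 := congrArg (signChar F m) h
  simp only [map_sum, signChar_single, RepZero.sgn_mul_self, map_zero, Finset.sum_const,
    Finset.card_univ, Fintype.card_perm, nsmul_one] at h1
  exact (Nat.factorial_ne_zero _) (by exact_mod_cast h1)

/-- Translates the Specht module condition in `IsL` for a column into the scalar condition required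
by `exists_factorization`. -/
theorem signSum_ne_zero_iff [CharZero F] (T : Fin m ≃ (columnDiagram n).cells)
    (e : RepZero.obj F m ⟶ RepZero.obj F m) :
    (∃ x, permPart e * x * youngSymmetrizer F T ≠ 0) ↔ RepZero.signSum F m e ≠ 0 := by
  simp only [youngSymmetrizer_column, mul_signed_sum, map_mul, signChar_permPart]
  constructor
  · rintro ⟨x, hx⟩ h
    exact hx (by rw [h, zero_mul, zero_smul])
  · intro h
    refine ⟨1, ?_⟩
    rw [map_one, mul_one]
    exact smul_ne_zero h signed_sum_ne_zero

end column

/-! ### Permutations with connected closure. -/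

section cycles

variable {n : ℕ}

/-- The closure is generated by the pairs `(i, σ i)`, so its parts are the orbits of `σ`, fixed
points included. -/
theorem closure_ofEquiv_iff {A : Type} (σ : Equiv.Perm A) (i j : A) :
    Diagram.closure (Diagram.ofEquiv σ) i j ↔ σ.SameCycle i j := by
  constructor
  · have : Diagram.closure (Diagram.ofEquiv σ) ≤ Equiv.Perm.SameCycle.setoid σ := by
      refine (Diagram.map_le _ _ _).2 ?_
      rintro (x | x) (y | y) hxy
      · exact (σ.injective hxy).sameCycle σ
      · exact ⟨1, hxy⟩
      · exact Equiv.Perm.SameCycle.symm ⟨1, Eq.symm hxy⟩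
      · exact Eq.sameCycle hxy σ
    exact fun h => this h
  · rintro ⟨k, rfl⟩
    have step : ∀ x, Diagram.closure (Diagram.ofEquiv σ) x (σ x) := fun x =>
      (Diagram.map_le _ _ _).1 (le_refl (Diagram.closure (Diagram.ofEquiv σ)))
        (Sum.inl x) (Sum.inr (σ x)) rfl
    induction k using Int.induction_on with
    | zero => exact Setoid.refl' _ _
    | succ k ih =>
      refine Setoid.trans' _ ih ?_
      rw [add_comm, zpow_add, zpow_one, Equiv.Perm.mul_apply]
      exact step _
    | pred k ih =>
      refine Setoid.trans' _ ih (Setoid.symm' _ ?_)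
      have h : (σ ^ (-(k : ℤ))) i = σ ((σ ^ (-(k : ℤ) - 1)) i) := by
        rw [← Equiv.Perm.mul_apply, ← zpow_one_add]
        congr 2
        ring
      rw [h]
      exact step _

theorem comps_ofEquiv_eq_one {A : Type} [Finite A] [Nonempty A] (σ : Equiv.Perm A) :
    (SDiagram.ofEquiv σ).comps = 1 ↔ ∀ i j, σ.SameCycle i j := by
  rw [SDiagram.comps, SDiagram.ofEquiv, zero_add, Diagram.comps, Nat.card_eq_one_iff_unique]
  simp only [← closure_ofEquiv_iff]
  constructor
  · rintro ⟨h, -⟩ i j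
    exact Quotient.exact (Subsingleton.elim _ _)
  · intro h
    refine ⟨⟨fun x y => ?_⟩, ⟨Quotient.mk _ (Classical.arbitrary A)⟩⟩
    induction x using Quotient.inductionOn
    induction y using Quotient.inductionOn
    exact Quotient.sound (h _ _)

/-- The bound is needed: for `n = 1` the identity is transitive but has empty cycle type. That case
is treated separately below. -/
theorem sameCycle_all_iff (hn : 2 ≤ n) (σ : Equiv.Perm (Fin n)) :
    (∀ i j, σ.SameCycle i j) ↔ σ.cycleType = {n} := by
  constructor
  · intro h
    have hne : ∀ i, σ i ≠ i := by
      intro i hi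
      have : Nontrivial (Fin n) := Fin.nontrivial_iff_two_le.2 hn
      obtain ⟨j, hj⟩ := exists_ne i
      obtain ⟨k, hk⟩ := h i j
      rw [Equiv.Perm.zpow_apply_eq_self_of_apply_eq_self hi] at hk
      exact hj hk.symm
    have hc : σ.IsCycle := ⟨⟨0, by omega⟩, hne _, fun _ _ => h _ _⟩
    have hs : σ.support = Finset.univ :=
      Finset.eq_univ_iff_forall.2 fun i => Equiv.Perm.mem_support.2 (hne i)
    rw [hc.cycleType, hs, Finset.card_univ, Fintype.card_fin]
  · intro h i j
    have hc : σ.IsCycle := Equiv.Perm.card_cycleType_eq_one.1 (by rw [h]; rfl)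
    have hs : σ.support = Finset.univ := by
      rw [← Finset.card_eq_iff_eq_univ, ← Equiv.Perm.sum_cycleType, h, Multiset.sum_singleton,
        Fintype.card_fin]
    exact hc.sameCycle (Equiv.Perm.mem_support.1 (hs ▸ Finset.mem_univ i))
      (Equiv.Perm.mem_support.1 (hs ▸ Finset.mem_univ j))

theorem card_sameCycle_all (hn : 0 < n) :
    Nat.card {σ : Equiv.Perm (Fin n) // ∀ i j, σ.SameCycle i j} = (n - 1).factorial := by
  classical
  rcases Nat.lt_or_ge n 2 with h | h
  · obtain rfl : n = 1 := by omega
    have : ∀ (σ : Equiv.Perm (Fin 1)) (i j), σ.SameCycle i j := fun σ i j =>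
      (Subsingleton.elim i j).sameCycle σ
    rw [Nat.card_congr (Equiv.subtypeUnivEquiv this), Nat.card_eq_fintype_card, Fintype.card_perm]
    rfl
  · rw [Nat.card_congr (Equiv.subtypeEquivRight (sameCycle_all_iff h)), Nat.card_eq_fintype_card,
      Fintype.card_subtype, Equiv.Perm.card_of_cycleType_singleton h (by rw [Fintype.card_fin]),
      Fintype.card_fin, Nat.choose_self, mul_one]

theorem sgn_sameCycle_all {F : Type u} [Field F] (hn : 0 < n) {σ : Equiv.Perm (Fin n)}
    (h : ∀ i j, σ.SameCycle i j) : RepZero.sgn F σ = (-1) ^ (n + 1) := by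
  rcases Nat.lt_or_ge n 2 with h' | h'
  · obtain rfl : n = 1 := by omega
    rw [Subsingleton.elim σ 1]
    simp [RepZero.sgn]
  · rw [RepZero.sgn, Equiv.Perm.sign_of_cycleType, (sameCycle_all_iff h' σ).1 h]
    simp

/-- Permutations with more than one cycle have disconnected closure and drop out; the remaining ones
share the sign `(-1)^(n+1)`. -/
theorem endTrace_alt {F : Type u} [Field F] (hn : 0 < n) :
    RepZero.endTrace _ (RepZero.alt F n) = (-1) ^ (n + 1) *
      (Nat.card {σ : Equiv.Perm (Fin n) // ∀ i j, σ.SameCycle i j} : F) / (n.factorial : F) := by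
  classical
  have : Nonempty (Fin n) := ⟨⟨0, hn⟩⟩
  rw [RepZero.alt, map_smul, map_sum, smul_eq_mul, div_eq_inv_mul]
  congr 1
  have h : ∀ σ : Equiv.Perm (Fin n), RepZero.endTrace _ (RepZero.sgn F σ • RepZero.perm F σ) =
      if ∀ i j, σ.SameCycle i j then (-1) ^ (n + 1) else 0 := by
    intro σ
    rw [map_smul, RepZero.endTrace_hom, smul_eq_mul]
    by_cases hσ : ∀ i j, σ.SameCycle i j
    · rw [if_pos hσ, if_pos ((comps_ofEquiv_eq_one σ).2 hσ), mul_one, sgn_sameCycle_all hn hσ]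
    · rw [if_neg hσ, if_neg fun h => hσ ((comps_ofEquiv_eq_one σ).1 h), mul_zero]
  simp only [h]
  rw [← Finset.sum_filter, Finset.sum_const, nsmul_eq_mul, mul_comm, Nat.card_eq_fintype_card,
    Fintype.card_subtype]

end cycles

/-! ### The objects `L_n`, their membership in the ideal and their modified dimensions. -/

namespace RepS

variable {F : Type u} [Field F]

/-- The isomorphism given by a factorization of two idempotents. -/
noncomputable def ofIdemIso {t : F} {X Y : RepZero F t} {e : X ⟶ X} {e' : Y ⟶ Y} (he : e ≫ e = e)
    (he' : e' ≫ e' = e') (a : X ⟶ Y) (b : Y ⟶ X) (hab : a ≫ b = e) (hba : b ≫ a = e')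
    (ha : e ≫ a ≫ e' = a) (hb : e' ≫ b ≫ e = b) : ofIdem e he ≅ ofIdem e' he' where
  hom := ⟨(Mat_.embedding _).map a, by
    change (Mat_.embedding _).map e ≫ _ ≫ (Mat_.embedding _).map e' = _
    rw [← Functor.map_comp, ← Functor.map_comp, ha]⟩
  inv := ⟨(Mat_.embedding _).map b, by
    change (Mat_.embedding _).map e' ≫ _ ≫ (Mat_.embedding _).map e = _
    rw [← Functor.map_comp, ← Functor.map_comp, hb]⟩
  hom_inv_id := Idempotents.Karoubi.hom_ext _ _ (by
    change (Mat_.embedding _).map a ≫ (Mat_.embedding _).map b = (Mat_.embedding _).map e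
    rw [← Functor.map_comp, hab])
  inv_hom_id := Idempotents.Karoubi.hom_ext _ _ (by
    change (Mat_.embedding _).map b ≫ (Mat_.embedding _).map a = (Mat_.embedding _).map e'
    rw [← Functor.map_comp, hba])

theorem exists_retract {t : F} {X : RepZero F t} {e : X ⟶ X} (he : e ≫ e = e) :
    ∃ (f : ofIdem e he ⟶ (emb F t).obj X) (g : (emb F t).obj X ⟶ ofIdem e he),
      f ≫ g = 𝟙 _ ∧ g ≫ f = (emb F t).map e := by
  have h : (Mat_.embedding _).map e ≫ (Mat_.embedding _).map e = (Mat_.embedding _).map e := by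
    rw [← Functor.map_comp, he]
  refine ⟨⟨(Mat_.embedding _).map e, ?_⟩, ⟨(Mat_.embedding _).map e, ?_⟩,
    Idempotents.Karoubi.hom_ext _ _ h, Idempotents.Karoubi.hom_ext _ _ h⟩
  · change (Mat_.embedding _).map e ≫ (Mat_.embedding _).map e ≫ 𝟙 _ = _
    rw [Category.comp_id, h]
  · change 𝟙 _ ≫ (Mat_.embedding _).map e ≫ (Mat_.embedding _).map e = _
    rw [Category.id_comp, h]

/-- For `n > 0` one point splits off: `[n] ≅ [1] ⊗ [n - 1]`. -/
theorem mem_idealOf_emb {t : F} {n : ℕ} (hn : 0 < n) :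
    (idealOf ((emb F t).obj (RepZero.of (Fin 1)))).mem ((emb F t).obj (RepZero.of (Fin n))) := by
  let ε : Fin n ≃ Fin 1 ⊕ Fin (n - 1) := (finCongr (by omega)).trans finSumFinEquiv.symm
  let i : RepZero.of (Fin n) ≅ (RepZero.of (Fin 1) ⊗ RepZero.of (Fin (n - 1)) : RepZero F t) :=
    RepZero.isoOfEquiv ε
  exact ⟨(emb F t).obj (RepZero.of (Fin (n - 1))), toTensor i.hom, fromTensor i.inv, by
    rw [toTensor_fromTensor, i.hom_inv_id, CategoryTheory.Functor.map_id]⟩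

theorem alt_one : RepZero.alt F 1 = 𝟙 _ := by
  rw [RepZero.alt, Fintype.sum_unique, ← RepZero.perm_one]
  simp [RepZero.sgn]

theorem positive_emb_fin {n : ℕ} (hn : 0 < n) :
    ((emb F 0).obj (RepZero.of (Fin n))).Positive :=
  fun _ => ⟨⟨0, hn⟩⟩

variable [CharZero F]

theorem isL_alt (n : ℕ) : IsL (columnDiagram n) (ofIdem (RepZero.alt F n) RepZero.alt_idem) :=
  ⟨n, columnTableau n, RepZero.alt F n, RepZero.isPrimitiveIdem_alt,
    (signSum_ne_zero_iff _ _).2 (by rw [RepZero.signSum_alt]; exact one_ne_zero), ⟨Iso.refl _⟩⟩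

theorem iso_of_isL {n : ℕ} {L : RepS F 0} (hL : IsL (columnDiagram n) L) :
    Nonempty (L ≅ ofIdem (RepZero.alt F n) RepZero.alt_idem) := by
  obtain ⟨m, T, e, he, hx, ⟨i⟩⟩ := hL
  obtain rfl : m = n := by
    simpa using Fintype.card_congr (T.trans (columnTableau n).symm)
  obtain ⟨a, b, hab, hba, hsa, hae, heb, hbs⟩ :=
    RepZero.exists_factorization he ((signSum_ne_zero_iff T e).1 hx)
  exact ⟨i ≪≫ ofIdemIso he.1 RepZero.alt_idem b a hba hab (by rw [hbs, heb]) (by rw [hae, hsa])⟩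

/-- At `t = 0` the object `[1]` is itself indecomposable, because the antisymmetrizer of one point
is the identity and is primitive. -/
theorem iso_emb_of_isL {J : RepS F 0} (hJ : IsL (columnDiagram 1) J) :
    Nonempty (J ≅ (emb F 0).obj (RepZero.of (Fin 1))) := by
  obtain ⟨i⟩ := iso_of_isL hJ
  obtain ⟨f, g, hfg, hgf⟩ := exists_retract (RepZero.alt_idem (F := F) (n := 1))
  exact ⟨i ≪≫ ⟨f, g, hfg, by rw [hgf, alt_one, CategoryTheory.Functor.map_id]⟩⟩

/-- By `cutTrace_eq` the dimension may be computed in `[n]`, where the identity of `L_n` becomes the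
antisymmetrizer. -/
theorem modTrace_dim_of_isL {n : ℕ} (hn : 0 < n) {L : RepS F 0} (hL : IsL (columnDiagram n) L)
    (h : (idealOf ((emb F 0).obj (RepZero.of (Fin 1)))).mem L) :
    (modTrace _ (positive_emb_fin one_pos)).dim L h = (-1) ^ (n + 1) *
      (Nat.card {σ : Equiv.Perm (Fin n) // ∀ i j, σ.SameCycle i j} : F) / (n.factorial : F) := by
  obtain ⟨i⟩ := iso_of_isL hL
  obtain ⟨f, g, hfg, hgf⟩ := exists_retract (RepZero.alt_idem (F := F) (n := n))
  refine (cutTrace_eq (positive_emb_fin one_pos) h (positive_emb_fin hn) (i.hom ≫ f) (g ≫ i.inv)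
    (by rw [Category.assoc, reassoc_of% hfg, i.hom_inv_id]) (𝟙 L)).trans ?_
  rw [Category.id_comp, Category.assoc, i.inv_hom_id_assoc, hgf, ← endTrace_alt hn]
  exact diagTrace_unique _ PUnit.unit fun _ => rfl

theorem mem_of_isL {n : ℕ} (hn : 0 < n) {L : RepS F 0} (hL : IsL (columnDiagram n) L) :
    (idealOf ((emb F 0).obj (RepZero.of (Fin 1)))).mem L := by
  obtain ⟨i⟩ := iso_of_isL hL
  obtain ⟨f, g, hfg, -⟩ := exists_retract (RepZero.alt_idem (F := F) (n := n))
  exact (idealOf _).retract_mem (i.hom ≫ f) (g ≫ i.inv)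
    (by rw [Category.assoc, reassoc_of% hfg, i.hom_inv_id]) (mem_idealOf_emb hn)

/-- The ideal is a variable `I` so that the equality with the ideal of `[1]` can be substituted,
while the normalisation remains at the given `J`. -/
theorem existsUnique_modTrace {J : RepS F 0} (hJ : IsL (columnDiagram 1) J)
    {I : ObjIdeal (RepS F 0)} (hI : I = idealOf ((emb F 0).obj (RepZero.of (Fin 1))))
    (hm : I.mem J) :
    (∃! tr : ModTrace F I, tr.dim J hm = 1) ∧
      ∀ tr : ModTrace F I, tr.dim J hm = 1 →
        ∀ n : ℕ, 0 < n → ∀ L : RepS F 0, IsL (columnDiagram n) L → ∃ hL : I.mem L,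
          tr.dim L hL = (-1) ^ (n + 1) *
            (Nat.card {σ : Equiv.Perm (Fin n) // ∀ i j, σ.SameCycle i j} : F) /
              (n.factorial : F) := by
  subst hI
  obtain ⟨i⟩ := iso_emb_of_isL hJ
  have h1 : (modTrace _ (positive_emb_fin one_pos)).dim J hm = 1 := by
    rw [modTrace_dim_of_isL one_pos hJ, card_sameCycle_all one_pos]
    simp
  have huniq : ∀ tr : ModTrace F (idealOf ((emb F 0).obj (RepZero.of (Fin 1)))),
      tr.dim J hm = 1 → tr = modTrace _ (positive_emb_fin one_pos) := by
    intro tr htr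
    refine modTrace_unique _ _ ?_
    -- Modified dimensions are invariant under isomorphism, which moves the normalisation from `J`
    -- to `[1]`.
    rw [← tr.dim_eq_of_iso hm _ i, ← ModTrace.dim_eq_of_iso _ hm _ i, htr, h1]
  refine ⟨⟨_, h1, huniq⟩, fun tr htr n hn L hL => ⟨mem_of_isL hn hL, ?_⟩⟩
  rw [huniq tr htr, modTrace_dim_of_isL hn hL]

end RepS

end Deligne

/-- Over a field `F` of characteristic zero, the objects `L_n = L((1^n))` of `Rep(S_0; F)` exist, the
ideal generated by `L((1))` carries exactly one trace with value `1` on the identity of `L((1))`, and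
for this trace the modified dimension of `L_n`, `n > 0`, is `(-1)^(n+1)` times the number of `n`-cycles
in `S_n` divided by `n!`, that is `(-1)^(n+1) / n`. -/
theorem mainTheorem6 {F : Type*} [Field F] [CharZero F] :
    (∀ n : ℕ, ∃ L : Deligne.RepS F 0, Deligne.IsL (Deligne.columnDiagram n) L) ∧
    ∀ J : Deligne.RepS F 0, Deligne.IsL (Deligne.columnDiagram 1) J →
      (∃! tr : Deligne.ModTrace F (Deligne.idealOf J), tr.dim J (Deligne.mem_idealOf J) = 1) ∧
      ∀ tr : Deligne.ModTrace F (Deligne.idealOf J), tr.dim J (Deligne.mem_idealOf J) = 1 →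
        ∀ n : ℕ, 0 < n → ∀ L : Deligne.RepS F 0, Deligne.IsL (Deligne.columnDiagram n) L →
          ∃ hL : (Deligne.idealOf J).mem L,
            tr.dim L hL = (-1) ^ (n + 1) *
              (Nat.card {σ : Equiv.Perm (Fin n) // ∀ i j, σ.SameCycle i j} : F) /
                (n.factorial : F) ∧
            tr.dim L hL = (-1) ^ (n + 1) / (n : F) := by
  refine ⟨fun n => ⟨_, Deligne.RepS.isL_alt n⟩, fun J hJ => ?_⟩
  obtain ⟨i⟩ := Deligne.RepS.iso_emb_of_isL hJ
  obtain ⟨h1, h2⟩ := Deligne.RepS.existsUnique_modTrace hJ (Deligne.idealOf_congr i)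
    (Deligne.mem_idealOf J)
  refine ⟨h1, fun tr htr n hn L hL => ?_⟩
  obtain ⟨hm, hd⟩ := h2 tr htr n hn L hL
  refine ⟨hm, hd, hd.trans ?_⟩
  -- With `(n-1)!` cycles of full length, the quotient by `n!` reduces to `1 / n`.
  have hf : (n.factorial : F) = n * ((n - 1).factorial : F) := by
    rw [← Nat.mul_factorial_pred hn.ne']
    push_cast
    rfl
  have hf0 : ((n - 1).factorial : F) ≠ 0 := by exact_mod_cast (n - 1).factorial_ne_zero
  rw [Deligne.card_sameCycle_all hn, hf, mul_div_mul_right _ _ hf0]
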